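/- Let $d\ge 1$ and let $\hat v:\mathbb Z^d\to\mathbb R$, $\hat v\not\equiv0$, satisfy $|\hat v(x)|\le Ce^{-a|x|}$ for some $C,a>0$. Put $\mathbb T^d=(-\pi,\pi]^d$ with Lebesgue measure, $$v(p)=(2\pi)^{-d/2}\sum_{x\in\mathbb Z^d}\hat v(x)e^{ix\cdot p},\qquad \mathfrak e(p)=\Big(\sum_{i=1}^d(1-\cos p_i)\Big)^2,\qquad \vec\pi=(\pi,\dots,\pi).$$ For $\mu\in\mathbb R$ let $\hat{\mathbf h}_\mu=\hat\varDelta\hat\varDelta-\mu\hat{\mathbf v}$ on $\ell^2(\mathbb Z^d)$, where $\hat\varDelta f(x)=\frac12\sum_{|s|=1}[f(x)-f(x+s)]$ and $\hat{\mathbf v}f(x)=\hat v(x)\sum_y\hat v(y)f(y)$, and let $\mathbf h_\mu f=\mathfrak e f-\mu\, v\int_{\mathbb T^d}\overline{v(q)}f(q)\,dq$ on $L^2(\mathbb T^d)$ be its momentum representation. For measurable $f$, not necessarily in $L^2(\mathbb T^d)$, with $\bar v f\in L^1(\mathbb T^d)$, the equation $\mathbf h_\mu f=zf$ means that this formula holds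 almost everywhere; a solution that is not almost everywhere zero and not in $L^2(\mathbb T^d)$ is called a resonance state. Let $$\mu^o=\Big(\int_{\mathbb T^d}\frac{|v(q)|^2dq}{4d^2-\mathfrak e(q)}\Big)^{-1}\in[0,\infty),\qquad \hat C_v=\int_{\mathbb T^d}\frac{|v(q)|^2dq}{(4d^2-\mathfrak e(q))^2}$$ (with $\infty^{-1}=0$). Let $n^o\ge0$ be such that $D^{2k}|v|^2(\vec\pi)=0$ for $0\le k<n^o$ and $D^{2n^o}|v|^2(\vec\pi)\ne0$, where $D^jf(p)$ is the $j$-th differential of $f$ at $p$ as a symmetric $j$-linear form. Put $N=2n^o+d$ and $$C_v=\frac{2^{2n^o+d-1}}{(8d)^{n^o+d/2}(2n^o)!}\int_{\mathbb S^{d-1}}D^{2n^o}|v|^2(\vec\pi)[w,\dots,w]\,d\mathcal H^{d-1}(w).$$ Then $C_v>0$ and $\hat C_v\in(0,+\infty]$. If $N\ge3$, then $f=\dfrac{v}{4d^2-\mathfrak e}$ is a non-zero solution of $\mathbf h_{-\mu^o}f=4d^2f$; $f\notin L^2(\mathbb T^d)$ if $N\in\{3,4\}$, and $f\in L^2(\mathbb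 T^d)$ (so $\hat C_v<\infty$) if $N\ge5$. For arbitrary $N$, $f$ is a resonance state of $\mathbf h_{-\mu^o}$ at energy $4d^2$ if and only if $N\in\{3,4\}$. For every $\mu<-\mu^o$, $\mathbf h_\mu$ (equivalently $\hat{\mathbf h}_\mu$) has exactly one eigenvalue $e(\mu)>4d^2$. Write $\tau=-(\mu+\mu^o)$, so that $\tau>0$. In each case below there are real coefficients such that, for all sufficiently small $\tau>0$, the series converges and the equality holds. (a) $d$ odd. (a1) If $N=1$, then $\mu^o=0$ and $(e(\mu)-4d^2)^{1/2}=-\pi C_v\,\mu+\sum_{n\ge1}C_{1,n}\mu^{n+1}$. (a2) If $N=3$, then $\mu^o>0$ and $(e(\mu)-4d^2)^{1/2}=(\pi C_v(\mu^o)^2)^{-1}\tau+\sum_{n\ge1}C_{3,n}\tau^{n+1}$. (a3) If $N\ge5$, then $\mu^o>0$ and $(e(\mu)-4d^2)^{1/2}=(\hat C_v(\mu^o)^2)^{-1/2}\tau^{1/2}+\sum_{n\ge1}C_{5,n}\tau^{(n+1)/2}$. (b) $d$ even. (b1) If $N=2$, then $\mu^o=0$ and, with some $c>0$ and $C_2=C_v$,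 $e(\mu)-4d^2=c\,e^{\frac1{C_2\mu}}+\sum_{n+m\ge1,\ n,m\ge0}C_{2,nm}\,\mu^{n+1}\big(-\tfrac1\mu e^{\frac1{C_2\mu}}\big)^{m+1}$. (b2) If $N=4$, then $\mu^o>0$ and, with $\sigma=-\frac1{\ln\tau}$, $\eta=-\frac{\ln\ln\tau^{-1}}{\ln\tau}$, $e(\mu)-4d^2=(C_v(\mu^o)^2)^{-1}\tau\sigma+\sum_{n+m+k\ge1,\ n,m,k\ge0}C_{4,nmk}\,\tau^{n+1}\sigma^{m+1}\eta^k$. (b3) If $N\ge6$, then $\mu^o>0$ and $e(\mu)-4d^2=(\hat C_v(\mu^o)^2)^{-1}\tau+\sum_{n+m\ge1,\ n,m\ge0}C_{6,nm}\,\tau^{n+1}(-\tau\ln\tau)^m$. -/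

import Mathlib

open MeasureTheory

noncomputable section

namespace DiscreteBilaplacian

/-- Momentum space; the torus is represented by the fundamental cube below. -/
abbrev Momentum (d : ℕ) : Type := EuclideanSpace ℝ (Fin d)

/-- The lattice `ℤ^d`. -/
abbrev Lattice (d : ℕ) : Type := Fin d → ℤ

/-- The Euclidean length of a lattice point. -/
def latticeLength {d : ℕ} (x : Lattice d) : ℝ := Real.sqrt (∑ i, (x i : ℝ) ^ 2)

/-- Exponential decay of a real function on the lattice. -/
def ExpDecay {d : ℕ} (vhat : Lattice d → ℝ) : Prop :=
  ∃ C : ℝ, 0 < C ∧ ∃ a : ℝ, 0 < a ∧ ∀ x, |vhat x| ≤ C * Real.exp (-a * latticeLength x)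

/-! ### The operator on the lattice -/

/-- The discrete Laplacian `½ ∑_{|s| = 1} (f x - f (x + s))`; the `s` are the `± eᵢ`. -/
def latticeLaplacian {d : ℕ} (f : Lattice d → ℂ) (x : Lattice d) : ℂ :=
  (1 / 2) * ∑ i, ((f x - f (x + Pi.single i 1)) + (f x - f (x - Pi.single i 1)))

/-- The discrete bilaplacian minus `μ` times the rank-one operator generated by `vhat`. -/
def latticeOp {d : ℕ} (vhat : Lattice d → ℝ) (μ : ℝ) (f : Lattice d → ℂ) (x : Lattice d) : ℂ :=
  latticeLaplacian (latticeLaplacian f) x - (μ : ℂ) * ((vhat x : ℂ) * ∑' y, (vhat y : ℂ) * f y)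

/-- `z` is an eigenvalue of the lattice operator on `ℓ²(ℤ^d)`. -/
def IsLatticeEigenvalue {d : ℕ} (vhat : Lattice d → ℝ) (μ z : ℝ) : Prop :=
  ∃ f : Lattice d → ℂ, Memℓp f 2 ∧ f ≠ 0 ∧ ∀ x, latticeOp vhat μ f x = (z : ℂ) * f x

/-! ### The momentum representation -/

/-- Lebesgue measure on the torus `(-π, π]^d` (total mass `(2π)^d`). -/
def torusMeasure (d : ℕ) : Measure (Momentum d) :=
  volume.restrict {p | ∀ i, p i ∈ Set.Ioc (-Real.pi) Real.pi}

/-- The dispersion relation `(∑ᵢ (1 - cos pᵢ))²`. -/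
def dispersion {d : ℕ} (p : Momentum d) : ℝ := (∑ i, (1 - Real.cos (p i))) ^ 2

/-- The point `(π, …, π)`. -/
def piVec (d : ℕ) : Momentum d := WithLp.toLp 2 (fun _ => Real.pi)

/-- The (unitarily normalized) Fourier transform of the generator `vhat`. -/
def fourierV {d : ℕ} (vhat : Lattice d → ℝ) (p : Momentum d) : ℂ :=
  (((2 * Real.pi) ^ (-(d : ℝ) / 2) : ℝ) : ℂ) *
    ∑' x : Lattice d, (vhat x : ℂ) * Complex.exp (Complex.I * ((∑ i, (x i : ℝ) * p i : ℝ) : ℂ))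

/-- `f` is a (not necessarily square-integrable) solution of `h_μ f = z f`, where
`h_μ f = 𝔢 f - μ v ∫ v̄ f` on the torus. -/
def IsSolution {d : ℕ} (vhat : Lattice d → ℝ) (μ z : ℝ) (f : Momentum d → ℂ) : Prop :=
  AEStronglyMeasurable f (torusMeasure d) ∧
  Integrable (fun q => (starRingEnd ℂ) (fourierV vhat q) * f q) (torusMeasure d) ∧
  ∀ᵐ p ∂(torusMeasure d),
    (dispersion p : ℂ) * f p
      - (μ : ℂ) * (fourierV vhat p *
          ∫ q, (starRingEnd ℂ) (fourierV vhat q) * f q ∂(torusMeasure d))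
      = (z : ℂ) * f p

/-- `f` is non-zero as an element of the space of functions modulo null sets. -/
def IsNonzero {d : ℕ} (f : Momentum d → ℂ) : Prop :=
  ¬ (∀ᵐ p ∂(torusMeasure d), f p = 0)

/-- `z` is an eigenvalue of `h_μ` on `L²` of the torus. -/
def IsEigenvalue {d : ℕ} (vhat : Lattice d → ℝ) (μ z : ℝ) : Prop :=
  ∃ f : Momentum d → ℂ, MemLp f 2 (torusMeasure d) ∧ IsNonzero f ∧ IsSolution vhat μ z f

/-- `f` is a resonance state of `h_μ` at energy `z`: a non-zero solution outside `L²`. -/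
def IsResonance {d : ℕ} (vhat : Lattice d → ℝ) (μ z : ℝ) (f : Momentum d → ℂ) : Prop :=
  IsSolution vhat μ z f ∧ IsNonzero f ∧ ¬ MemLp f 2 (torusMeasure d)

/-- The upper coupling constant threshold `(∫ |v|² / (4d² - 𝔢))⁻¹ ∈ [0, ∞)`
(equal to `0` when the integral is infinite). -/
def muTop {d : ℕ} (vhat : Lattice d → ℝ) : ℝ :=
  ((∫⁻ q, ENNReal.ofReal (‖fourierV vhat q‖ ^ 2 / (4 * (d : ℝ) ^ 2 - dispersion q))
    ∂(torusMeasure d))⁻¹).toReal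

/-- `Ĉ_v = ∫ |v|² / (4d² - 𝔢)² ∈ [0, ∞]`. -/
def CvHat {d : ℕ} (vhat : Lattice d → ℝ) : ENNReal :=
  ∫⁻ q, ENNReal.ofReal (‖fourierV vhat q‖ ^ 2 / (4 * (d : ℝ) ^ 2 - dispersion q) ^ 2)
    ∂(torusMeasure d)

/-- The `j`-th order differential of `|v|²` at `(π, …, π)`. -/
def diffAtPi {d : ℕ} (vhat : Lattice d → ℝ) (j : ℕ) :
    ContinuousMultilinearMap ℝ (fun _ : Fin j => Momentum d) ℝ :=
  iteratedFDeriv ℝ j (fun p => ‖fourierV vhat p‖ ^ 2) (piVec d)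

/-- `2n` is the order of vanishing of `|v|²` at `(π, …, π)`. -/
def HasVanishingOrder {d : ℕ} (vhat : Lattice d → ℝ) (n : ℕ) : Prop :=
  (∀ k < n, diffAtPi vhat (2 * k) = 0) ∧ diffAtPi vhat (2 * n) ≠ 0

/-- The constant `C_v`; the integral is with respect to surface measure on the unit sphere. -/
def Cv {d : ℕ} (vhat : Lattice d → ℝ) (n : ℕ) : ℝ :=
  (2 : ℝ) ^ (2 * n + d - 1) / ((8 * (d : ℝ)) ^ ((n : ℝ) + (d : ℝ) / 2) * ((2 * n).factorial : ℝ)) *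
    ∫ w : Metric.sphere (0 : Momentum d) 1,
      diffAtPi vhat (2 * n) (fun _ => (w : Momentum d)) ∂(volume : Measure (Momentum d)).toSphere

/-- The function `v / (4d² - 𝔢)`. -/
def thresholdState {d : ℕ} (vhat : Lattice d → ℝ) (p : Momentum d) : ℂ :=
  fourierV vhat p / ((4 * (d : ℝ) ^ 2 - dispersion p : ℝ) : ℂ)

/-- `e` assigns to every `μ < -μ^o` the eigenvalue above `4d²` (there is exactly one, on the
lattice as well as in the momentum representation). -/
def IsTopEigenvalueFunction {d : ℕ} (vhat : Lattice d → ℝ) (e : ℝ → ℝ) : Prop :=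
  ∀ μ < -muTop vhat, 4 * (d : ℝ) ^ 2 < e μ ∧
    ∀ z : ℝ, 4 * (d : ℝ) ^ 2 < z →
      ((IsEigenvalue vhat μ z ↔ z = e μ) ∧ (IsLatticeEigenvalue vhat μ z ↔ z = e μ))

end DiscreteBilaplacian

end

noncomputable section
namespace DiscreteBilaplacian

open Filter Topology

/-! ### Power series in one and three real variables -/

/-! The perturbation has rank one, so the spectral problem above `4d²` is scalar. Put `F(x) = ∫ |v|²
/ (4d² - 𝔢 + x)`. For `x > 0`, solving `h_μ f = (4d² + x) f` for `f` and pairing with `v̄` shows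
that `4d² + x` is an eigenvalue exactly when `-μ F(x) = 1` (`isEigenvalue_iff`, and
`isLatticeEigenvalue_iff` on the lattice). `F` is positive, continuous and strictly decreasing,
tends to `0` at infinity, and by monotone convergence its limit at `0+` is `∫ |v|² / (4d² - 𝔢)`;
hence there is exactly one root for each `μ < -μ^o`. By the same argument `Ĉ_v` is the limit of
`(F(0+) - F(x)) / x`, which decides whether the threshold state is square integrable.

Everything else follows from the singularity of `F` at `0+` (`exists_resolvent_expansion`): if `N =
2k + 1 + p` with `p ∈ {0, 1}`, then `F(x) = A(x) + x^k B(x) s(x)` with `A`, `B` analytic at `0`,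
`B(0) = (-1)^k C_v`, and `s = π/√x` for `p = 0`, `s = -log x` for `p = 1`. To obtain it, the maximum
of `𝔢` is translated to the origin, where `4d² - 𝔢 = E(4d - E)` with `E = ∑ (1 - cos qᵢ)`. With `x =
κ(4d + κ)`, partial fractions leave only `1/(E + κ)` as a singular integrand. In the coordinates `y
= 2 sin(q/2)` one has exactly `E = |y|²/2`, and spherical means of the even analytic density give a
radial integral of `r^(d-1) h(r²) / (r²/2 + κ)`. Since `h(r²) - h(-2κ)` is divisible by `r² + 2κ`,
only `h(-2κ)` times an elementary integral is singular. The leading Taylor form of `|v|²` is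
nonnegative and nonzero, hence `C_v > 0`.

Thus `F → ∞` and `μ^o = 0` for `k = 0`; for `k = 1` the limit is finite but `Ĉ_v = ∞`; for `k ≥ 2`,
`Ĉ_v = -A'(0)` is finite. In each of the six cases the unknown `x` is rescaled by its expected
leading size. After division by the leading factor the equation becomes analytic in the unknown and
in the small parameters (`μ`, `τ`, `√τ`, `σ`, `η`, ...), with nonzero derivative in the unknown, and
the analytic implicit function theorem (`exists_analyticAt_implicit`) yields the convergent series.
-/

theorem analyticAt_zero_of_hasSum {b : ℕ → ℝ} {f : ℝ → ℝ} {δ : ℝ} (hδ : 0 < δ)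
    (h : ∀ x, |x| < δ → HasSum (fun l => b l * x ^ l) (f x)) : AnalyticAt ℝ f 0 := by
  refine ⟨FormalMultilinearSeries.ofScalars ℝ b, ?_⟩
  rw [hasFPowerSeriesAt_iff]
  filter_upwards [Metric.ball_mem_nhds (0 : ℝ) hδ] with z hz
  have := h z (by simpa using hz)
  simpa [mul_comm, FormalMultilinearSeries.coeff_ofScalars] using this

theorem exists_hasSum_of_analyticAt {f : ℝ → ℝ} (hf : AnalyticAt ℝ f 0) :
    ∃ C : ℕ → ℝ, C 0 = f 0 ∧ ∃ δ > 0, ∀ x, |x| < δ → HasSum (fun l => C l * x ^ l) (f x) := by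
  obtain ⟨p, hp⟩ := hf
  have h0 := hasFPowerSeriesAt_iff.1 hp
  obtain ⟨δ, hδ, h⟩ := Metric.eventually_nhds_iff.1 h0
  have key : ∀ x, |x| < δ → HasSum (fun l => p.coeff l * x ^ l) (f x) := by
    intro x hx
    have := h (y := x) (by simpa using hx)
    simpa [mul_comm] using this
  refine ⟨p.coeff, ?_, δ, hδ, key⟩
  have h1 := key 0 (by simpa using hδ)
  have h2 : HasSum (fun l => p.coeff l * (0 : ℝ) ^ l) (p.coeff 0) := by
    convert hasSum_single (f := fun l => p.coeff l * (0 : ℝ) ^ l) 0 ?_ using 1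
    · simp
    · intro b hb
      simp [hb]
  exact h2.unique h1

/-- The multi-index of a word in three letters. -/
def wordIndex (w : Σ j : ℕ, (Fin j → Fin 3)) : ℕ × ℕ × ℕ :=
  ((Finset.univ.filter fun i => w.2 i = 0).card, (Finset.univ.filter fun i => w.2 i = 1).card,
    (Finset.univ.filter fun i => w.2 i = 2).card)

/-- The standard basis of `ℝ × ℝ × ℝ`. -/
def tripleBasis : Fin 3 → ℝ × ℝ × ℝ := ![(1, 0, 0), (0, 1, 0), (0, 0, 1)]

theorem norm_tripleBasis (i : Fin 3) : ‖tripleBasis i‖ = 1 := by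
  fin_cases i <;> simp [tripleBasis, Prod.norm_def]

theorem prod_word (c : Fin 3 → ℝ) (w : Σ j : ℕ, (Fin j → Fin 3)) :
    ∏ i, c (w.2 i) =
      c 0 ^ (wordIndex w).1 * c 1 ^ (wordIndex w).2.1 * c 2 ^ (wordIndex w).2.2 := by
  have : ∀ x : Fin 3, c x = ∏ k : Fin 3, (if x = k then c k else 1) := by
    intro x; simp
  rw [Finset.prod_congr rfl fun i _ => this (w.2 i), Finset.prod_comm, Fin.prod_univ_three]
  simp [wordIndex, Finset.prod_ite, mul_assoc]

/-- By multilinearity the degree-`j` term at `(x, y, z)` is a sum over words of length `j` in the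
three basis vectors. The sum over all words converges absolutely once `|x| + |y| + |z|` is below the
radius, so it may be regrouped by the number of occurrences of each letter. -/
theorem exists_hasSum_triple_of_analyticAt {f : ℝ × ℝ × ℝ → ℝ} (hf : AnalyticAt ℝ f 0) :
    ∃ C : ℕ → ℕ → ℕ → ℝ, C 0 0 0 = f 0 ∧ ∃ δ > 0, ∀ x y z, |x| < δ → |y| < δ → |z| < δ →
      HasSum (fun k : ℕ × ℕ × ℕ => C k.1 k.2.1 k.2.2 * x ^ k.1 * y ^ k.2.1 * z ^ k.2.2)
        (f (x, y, z)) := by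
  obtain ⟨p, r, hp⟩ := hf
  obtain ⟨s, hs0, hsr⟩ := ENNReal.lt_iff_exists_nnreal_btwn.1 hp.r_pos
  have hs0' : (0 : ℝ) < s := by exact_mod_cast hs0
  have hsum := p.summable_norm_mul_pow (r := s) (hsr.trans_le hp.r_le)
  let T : (Σ j : ℕ, (Fin j → Fin 3)) → ℝ := fun w => p w.1 fun i => tripleBasis (w.2 i)
  have key : ∀ x y z, |x| < (s : ℝ) / 3 → |y| < (s : ℝ) / 3 → |z| < (s : ℝ) / 3 →
      HasSum (fun k : ℕ × ℕ × ℕ => (∑' w : {w // wordIndex w = (k.1, k.2.1, k.2.2)}, T w) *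
        x ^ k.1 * y ^ k.2.1 * z ^ k.2.2) (f (x, y, z)) := by
    intro x y z hx hy hz
    let c : Fin 3 → ℝ := ![x, y, z]
    have hX : (x, y, z) = ∑ i, c i • tripleBasis i := by
      simp [Fin.sum_univ_three, c, tripleBasis]
    have hin : (x, y, z) ∈ Metric.eball (0 : ℝ × ℝ × ℝ) r := by
      have : ‖(x, y, z)‖ < s := by
        simp only [Prod.norm_def, Real.norm_eq_abs]
        refine max_lt (by linarith) (max_lt (by linarith) (by linarith))
      rw [Metric.mem_eball, edist_zero_right]
      refine lt_of_lt_of_le ?_ hsr.le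
      rw [enorm_eq_nnnorm]; exact_mod_cast this
    have h1 := hp.hasSum hin
    rw [zero_add] at h1
    let S : (Σ j : ℕ, (Fin j → Fin 3)) → ℝ := fun w => (∏ i, c (w.2 i)) * T w
    have hfin : ∀ j, (p j fun _ => (x, y, z)) = ∑ w : Fin j → Fin 3, S ⟨j, w⟩ := by
      intro j
      rw [hX, ContinuousMultilinearMap.map_sum]
      refine Finset.sum_congr rfl fun w _ => ?_
      rw [ContinuousMultilinearMap.map_smul_univ]
      simp [S, T]
    have hnorm : ∀ j (w : Fin j → Fin 3), ‖S ⟨j, w⟩‖ ≤ ‖p j‖ * ∏ i, |c (w i)| := by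
      intro j w
      simp only [S, T, norm_mul, Real.norm_eq_abs, Finset.abs_prod]
      rw [mul_comm]
      gcongr
      have := (p j).le_opNorm fun i => tripleBasis (w i)
      simpa [norm_tripleBasis] using this
    have hSsum : Summable S := by
      refine Summable.of_norm ?_
      rw [summable_sigma_of_nonneg (fun _ => norm_nonneg _)]
      refine ⟨fun j => (hasSum_fintype _).summable, ?_⟩
      refine Summable.of_nonneg_of_le (fun j => tsum_nonneg fun _ => norm_nonneg _) (fun j => ?_) hsum
      rw [tsum_fintype]
      calc ∑ w : Fin j → Fin 3, ‖S ⟨j, w⟩‖ ≤ ∑ w : Fin j → Fin 3, ‖p j‖ * ∏ i, |c (w i)| :=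
            Finset.sum_le_sum fun w _ => hnorm j w
        _ = ‖p j‖ * (∑ i, |c i|) ^ j := by
            rw [← Finset.mul_sum]
            congr 1
            have := Finset.prod_univ_sum (fun _ : Fin j => (Finset.univ : Finset (Fin 3)))
              (fun _ i => |c i|)
            rw [Fintype.piFinset_univ] at this
            rw [← this]
            simp
        _ ≤ ‖p j‖ * (s : ℝ) ^ j := by
            gcongr
            simp only [Fin.sum_univ_three, c, Matrix.cons_val]
            linarith
    have hS : HasSum S (f (x, y, z)) := by
      have h2 := hSsum.hasSum.sigma (fun j => hasSum_fintype fun w : Fin j → Fin 3 => S ⟨j, w⟩)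
      simp only [← hfin] at h2
      rw [h1.unique h2]
      exact hSsum.hasSum
    -- All words with the same letter counts carry the same monomial, so each fibre of `wordIndex`
    -- contributes one coefficient.
    have h3 := (Equiv.sigmaFiberEquiv wordIndex).hasSum_iff.2 hS
    have h4 := h3.sigma (fun k => (h3.summable.sigma_factor k).hasSum)
    refine h4.congr_fun ?_ |> fun h => h
    rintro ⟨k1, k2, k3⟩
    have : ∀ w : {w // wordIndex w = (k1, k2, k3)}, S w.1 = T w.1 * (x ^ k1 * y ^ k2 * z ^ k3) := by
      rintro ⟨w, hw⟩
      simp only [S]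
      rw [prod_word, hw]
      simp only [c, Matrix.cons_val]
      ring
    simp only [Function.comp_def, Equiv.sigmaFiberEquiv, Equiv.coe_fn_mk, this]
    rw [tsum_mul_right]
    ring
  refine ⟨fun a b c => ∑' w : {w // wordIndex w = (a, b, c)}, T w, ?_, (s : ℝ) / 3, by positivity, key⟩
  have h1 := key 0 0 0 (by simpa using hs0') (by simpa using hs0') (by simpa using hs0')
  refine HasSum.unique ?_ h1
  convert hasSum_single (f := fun k : ℕ × ℕ × ℕ =>
    (∑' w : {w // wordIndex w = (k.1, k.2.1, k.2.2)}, T w) *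
        (0 : ℝ) ^ k.1 * (0 : ℝ) ^ k.2.1 * (0 : ℝ) ^ k.2.2) 0 ?_ using 1
  · simp
  · rintro ⟨k1, k2, k3⟩ hk
    by_cases h1 : k1 = 0
    · by_cases h2 : k2 = 0
      · have : k3 ≠ 0 := by rintro rfl; exact hk (by simp [h1, h2])
        simp [this]
      · simp [h2]
    · simp [h1]

/-! ### Analytic dependence of integrals on a parameter -/

theorem analyticAt_integral_tsum {α : Type*} [MeasurableSpace α] {m : Measure α} {f : ℕ → α → ℝ}
    {b : ℕ → ℝ} {δ : ℝ} (hδ : 0 < δ) (hf : ∀ l, Integrable (f l) m)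
    (hb : ∀ l, ∫ a, ‖f l a‖ ∂m ≤ b l) (hs : Summable fun l => b l * δ ^ l) :
    AnalyticAt ℝ (fun x => ∫ a, ∑' l, f l a * x ^ l ∂m) 0 := by
  refine analyticAt_zero_of_hasSum (b := fun l => ∫ a, f l a ∂m) hδ fun x hx => ?_
  have h := hasSum_integral_of_summable_integral_norm (F := fun l a => f l a * x ^ l) (μ := m)
    (fun l => (hf l).mul_const _) ?_
  · simpa [integral_mul_const] using h
  · refine Summable.of_nonneg_of_le (fun l => integral_nonneg fun _ => norm_nonneg _) (fun l => ?_) hs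
    simp only [norm_mul, integral_mul_const, norm_pow, Real.norm_eq_abs]
    have h0 : 0 ≤ ∫ a, |f l a| ∂m := integral_nonneg fun _ => abs_nonneg _
    have := hb l
    simp only [Real.norm_eq_abs] at this
    gcongr
    exact h0.trans this

/-- Geometric series in `κ`: the terms `(-κ)^l f / a^(l+1)` are dominated by `|f| c⁻¹ (|κ|/c)^l`.
This handles every part of the integral where the denominator stays away from zero. -/
theorem analyticAt_integral_div_add {α : Type*} [MeasurableSpace α] {m : Measure α} {f a : α → ℝ}
    {c : ℝ} (hc : 0 < c) (hf : Integrable f m) (ha : AEStronglyMeasurable a m)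
    (hca : ∀ᵐ x ∂m, c ≤ a x) :
    AnalyticAt ℝ (fun κ => ∫ x, f x / (a x + κ) ∂m) 0 := by
  have hint : ∀ l : ℕ, Integrable (fun x => (-1) ^ l * (f x / a x ^ (l + 1))) m := by
    intro l
    refine Integrable.const_mul ?_ _
    simp_rw [div_eq_mul_inv]
    refine hf.mul_bdd (c := (c ^ (l + 1))⁻¹) ?_ ?_
    · exact ((ha.aemeasurable.pow_const (l + 1)).inv).aestronglyMeasurable
    · filter_upwards [hca] with x hx
      rw [norm_inv, norm_pow, Real.norm_eq_abs, abs_of_pos (hc.trans_le hx)]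
      gcongr
  have key := analyticAt_integral_tsum (δ := c / 2) (m := m)
    (f := fun l x => (-1) ^ l * (f x / a x ^ (l + 1)))
    (b := fun l => (∫ x, |f x| ∂m) * (c ^ (l + 1))⁻¹) (by positivity) hint ?_ ?_
  · refine key.congr ?_
    filter_upwards [Metric.ball_mem_nhds (0 : ℝ) hc] with κ hκ
    refine integral_congr_ae ?_
    filter_upwards [hca] with x hx
    have hκ' : |κ| < c := by simpa using hκ
    have hax : 0 < a x := hc.trans_le hx
    have hr : |-κ / a x| < 1 := by
      rw [abs_div, abs_neg, abs_of_pos hax, div_lt_one hax]; linarith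
    have hg := (hasSum_geometric_of_abs_lt_one hr).mul_left (f x / a x)
    have hne : a x + κ ≠ 0 := by
      have := abs_lt.1 hκ'
      linarith
    have he : f x / a x * (1 - -κ / a x)⁻¹ = f x / (a x + κ) := by
      have : 1 - -κ / a x = (a x + κ) / a x := by
        rw [neg_div, sub_neg_eq_add, add_div, div_self hax.ne']
      rw [this, inv_div, div_mul_div_cancel₀ hax.ne']
    rw [he] at hg
    rw [← hg.tsum_eq]
    refine tsum_congr fun l => ?_
    rw [div_pow, neg_pow κ]
    field_simp
    ring
  · intro l
    rw [← integral_mul_const]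
    refine integral_mono_ae (hint l).norm (hf.abs.mul_const _) ?_
    filter_upwards [hca] with x hx
    simp only [norm_mul, norm_pow, norm_neg, norm_one, one_pow, one_mul, norm_div, Real.norm_eq_abs]
    rw [abs_of_pos (hc.trans_le hx), div_eq_mul_inv]
    gcongr
  · have : (fun l : ℕ => (∫ x, |f x| ∂m) * (c ^ (l + 1))⁻¹ * (c / 2) ^ l) =
        fun l => (∫ x, |f x| ∂m) * c⁻¹ * (1 / 2) ^ l := by
      funext l
      rw [div_pow, one_div, inv_pow, pow_succ]
      field_simp
    rw [this]
    exact (summable_geometric_of_lt_one (by norm_num) (by norm_num)).mul_left _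

end DiscreteBilaplacian
end

noncomputable section
namespace DiscreteBilaplacian

open Filter Topology

/-! ### The radial integral -/

/-- The model singularity at `0+`: `π / √x` for the parity `0` and `- log x` otherwise. -/
def singular (e : ℕ) (x : ℝ) : ℝ := if e = 0 then Real.pi / Real.sqrt x else -Real.log x

/-- The power series whose coefficients are those of `c` shifted by `l`. -/
def shiftedSeries (c : ℕ → ℝ) (l : ℕ) (u : ℝ) : ℝ := ∑' i, c (i + l) * u ^ i

section Shifted

variable {c : ℕ → ℝ} {t : ℝ}

theorem summable_shiftedSeries (ht : 0 < t) (hc : Summable fun j => |c j| * t ^ j) (l : ℕ) :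
    Summable fun i => |c (i + l)| * t ^ i := by
  have h := ((summable_nat_add_iff l).2 hc).mul_right (t ^ l)⁻¹
  refine h.congr fun i => ?_
  rw [pow_add]
  field_simp

theorem summable_shiftedSeries_term (ht : 0 < t) (hc : Summable fun j => |c j| * t ^ j) (l : ℕ)
    {u : ℝ} (hu : |u| ≤ t) : Summable fun i => c (i + l) * u ^ i := by
  refine Summable.of_norm_bounded (summable_shiftedSeries ht hc l) fun i => ?_
  rw [norm_mul, norm_pow, Real.norm_eq_abs, Real.norm_eq_abs]
  gcongr

theorem abs_shiftedSeries_le (ht : 0 < t) (hc : Summable fun j => |c j| * t ^ j) (l : ℕ)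
    {u : ℝ} (hu : |u| ≤ t) :
    |shiftedSeries c l u| ≤ (∑' j, |c j| * t ^ j) * (t ^ l)⁻¹ := by
  have h1 : |shiftedSeries c l u| ≤ ∑' i, |c (i + l)| * t ^ i := by
    rw [← Real.norm_eq_abs]
    refine tsum_of_norm_bounded (f := fun i => c (i + l) * u ^ i)
      (summable_shiftedSeries ht hc l).hasSum fun i => ?_
    rw [norm_mul, norm_pow, Real.norm_eq_abs, Real.norm_eq_abs]
    gcongr
  refine h1.trans ?_
  have h2 : (fun i => |c (i + l)| * t ^ i) = fun i => (|c (i + l)| * t ^ (i + l)) * (t ^ l)⁻¹ := by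
    funext i
    rw [pow_add]
    field_simp
  rw [h2, tsum_mul_right]
  refine mul_le_mul_of_nonneg_right ?_ (by positivity)
  exact tsum_comp_le_tsum_of_inj hc (fun _ => by positivity) (add_left_injective l)

theorem shiftedSeries_eq (ht : 0 < t) (hc : Summable fun j => |c j| * t ^ j) (l : ℕ)
    {u : ℝ} (hu : |u| ≤ t) : shiftedSeries c l u = c l + u * shiftedSeries c (l + 1) u := by
  unfold shiftedSeries
  rw [(summable_shiftedSeries_term ht hc l hu).tsum_eq_zero_add, ← tsum_mul_left]
  congr 1
  · simp
  · refine tsum_congr fun i => ?_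
    rw [show i + 1 + l = i + (l + 1) by ring]
    ring

theorem shiftedSeries_of_vanishing (ht : 0 < t) (hc : Summable fun j => |c j| * t ^ j) (k : ℕ)
    (hk : ∀ j < k, c j = 0) {u : ℝ} (hu : |u| ≤ t) :
    shiftedSeries c 0 u = u ^ k * shiftedSeries c k u := by
  induction k with
  | zero => simp
  | succ k ih =>
    rw [ih fun j hj => hk j (by omega), shiftedSeries_eq ht hc k hu, hk k (by omega), pow_succ]
    ring

theorem shiftedSeries_zero (l : ℕ) : shiftedSeries c l 0 = c l := by
  unfold shiftedSeries
  rw [tsum_eq_single 0]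
  · simp
  · intro b hb
    simp [hb]

theorem continuousOn_shiftedSeries (ht : 0 < t) (hc : Summable fun j => |c j| * t ^ j) (l : ℕ) :
    ContinuousOn (shiftedSeries c l) (Set.Icc (-t) t) := by
  refine continuousOn_tsum (fun i => by fun_prop) (summable_shiftedSeries ht hc l) fun i u hu => ?_
  rw [norm_mul, norm_pow, Real.norm_eq_abs, Real.norm_eq_abs]
  have := abs_le.2 hu
  gcongr

theorem analyticAt_shiftedSeries (ht : 0 < t) (hc : Summable fun j => |c j| * t ^ j) (l : ℕ) :
    AnalyticAt ℝ (shiftedSeries c l) 0 :=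
  analyticAt_zero_of_hasSum ht fun _ hx => (summable_shiftedSeries_term ht hc l hx.le).hasSum

/-- With `h_l` the shifted series, the recursion `h_l(u) = c_l + u h_{l+1}(u)` makes `(u - s)
h_{l+1}(u) s^l` telescope up to `-c_l s^l`. The point is that the difference quotient is a power
series in `s`, even for `u` on the boundary of the disc of summability. -/
theorem shiftedSeries_sub (ht : 0 < t) (hc : Summable fun j => |c j| * t ^ j)
    {u s : ℝ} (hu : |u| ≤ t) (hs : |s| < t) :
    shiftedSeries c 0 u - shiftedSeries c 0 s = (u - s) * ∑' l, shiftedSeries c (l + 1) u * s ^ l := by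
  set a : ℕ → ℝ := fun l => shiftedSeries c l u * s ^ l with ha
  have hasum : Summable a := by
    refine Summable.of_norm_bounded (g := fun l => (∑' j, |c j| * t ^ j) * (|s| / t) ^ l) ?_ fun l => ?_
    · exact (summable_geometric_of_lt_one (by positivity) ((div_lt_one ht).2 hs)).mul_left _
    · rw [ha, norm_mul, norm_pow, Real.norm_eq_abs, Real.norm_eq_abs, div_pow, div_eq_inv_mul,
        ← mul_assoc]
      gcongr
      exact abs_shiftedSeries_le ht hc l hu
  have hcs := summable_shiftedSeries_term ht hc 0 hs.le
  have hterm : ∀ l, (u - s) * (shiftedSeries c (l + 1) u * s ^ l) =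
      a l - a (l + 1) - c (l + 0) * s ^ l := by
    intro l
    simp only [ha, shiftedSeries_eq ht hc l hu, add_zero]
    ring
  rw [← tsum_mul_left, tsum_congr hterm,
    (hasum.sub ((summable_nat_add_iff 1).2 hasum)).tsum_sub hcs,
    hasum.tsum_sub ((summable_nat_add_iff 1).2 hasum), hasum.tsum_eq_zero_add]
  simp [ha, shiftedSeries]

end Shifted

/-- The primitive is `(2/a) arctan(r/a)` with `a = √(2κ)`. The reflection `arctan(ρ/a) = π/2 -
arctan(a/ρ)` isolates the singular term `π/a`. -/
theorem integral_Ioo_div_even {ρ κ : ℝ} (hρ : 0 < ρ) (hκ : 0 < κ) :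
    ∫ r in Set.Ioo 0 ρ, 1 / (r ^ 2 / 2 + κ) =
      Real.pi / Real.sqrt (2 * κ) -
        2 / Real.sqrt (2 * κ) * Real.arctan (Real.sqrt (2 * κ) / ρ) := by
  set a := Real.sqrt (2 * κ) with ha
  have ha0 : 0 < a := Real.sqrt_pos.2 (by positivity)
  have ha2 : a ^ 2 = 2 * κ := Real.sq_sqrt (by positivity)
  rw [← integral_Ioc_eq_integral_Ioo, ← intervalIntegral.integral_of_le hρ.le]
  have hd : ∀ x ∈ Set.uIcc 0 ρ, HasDerivAt (fun r => 2 / a * Real.arctan (r / a))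
      (1 / (x ^ 2 / 2 + κ)) x := by
    intro x _
    have := (((hasDerivAt_id x).div_const a).arctan).const_mul (2 / a)
    refine this.congr_deriv ?_
    have h1 : x ^ 2 / 2 + κ ≠ 0 := by positivity
    have h2 : 1 + (id x / a) ^ 2 ≠ 0 := by positivity
    have hκ' : κ = a ^ 2 / 2 := by linarith
    rw [hκ']
    simp only [id]
    have h3 : a ^ 2 + x ^ 2 ≠ 0 := by positivity
    have h4 : x ^ 2 + a ^ 2 ≠ 0 := by positivity
    field_simp
    ring
  rw [intervalIntegral.integral_eq_sub_of_hasDerivAt hd]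
  · rw [← inv_div a ρ, Real.arctan_inv_of_pos (by positivity)]
    simp
    ring
  · refine ContinuousOn.intervalIntegrable ?_
    refine ContinuousOn.div (by fun_prop) (by fun_prop) fun x _ => ?_
    positivity

theorem integral_Ioo_div_odd {ρ κ : ℝ} (hρ : 0 < ρ) (hκ : 0 < κ) :
    ∫ r in Set.Ioo 0 ρ, r / (r ^ 2 / 2 + κ) = Real.log (ρ ^ 2 / 2 + κ) - Real.log κ := by
  rw [← integral_Ioc_eq_integral_Ioo, ← intervalIntegral.integral_of_le hρ.le]
  have hd : ∀ x ∈ Set.uIcc 0 ρ, HasDerivAt (fun r => Real.log (r ^ 2 / 2 + κ))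
      (x / (x ^ 2 / 2 + κ)) x := by
    intro x _
    have h1 : x ^ 2 / 2 + κ ≠ 0 := by positivity
    have := (((hasDerivAt_pow 2 x).div_const 2).add_const κ).log h1
    convert this using 1
    simp
  rw [intervalIntegral.integral_eq_sub_of_hasDerivAt hd]
  · simp
  · refine ContinuousOn.intervalIntegrable ?_
    refine ContinuousOn.div (by fun_prop) (by fun_prop) fun x _ => ?_
    positivity

/-- The arctangent is odd, so its quotient by the argument is a power series in the square.
Consequently the second term of `integral_Ioo_div_even` is analytic in `κ`. -/
theorem exists_analyticAt_arctan_sqrt :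
    ∃ a : ℝ → ℝ, AnalyticAt ℝ a 0 ∧
      ∀ x, 0 < x → x < 1 → Real.arctan (Real.sqrt x) = Real.sqrt x * a x := by
  refine ⟨fun x => ∑' n : ℕ, (-1 : ℝ) ^ n / (2 * n + 1) * x ^ n,
    analyticAt_zero_of_hasSum one_pos fun x hx => Summable.hasSum ?_, fun x hx hx1 => ?_⟩
  · refine Summable.of_norm_bounded (summable_geometric_of_lt_one (abs_nonneg x) hx) fun n => ?_
    rw [norm_mul, norm_div, norm_pow, norm_pow, norm_neg, norm_one, one_pow, Real.norm_eq_abs,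
      Real.norm_eq_abs, abs_of_pos (by positivity : (0 : ℝ) < 2 * n + 1)]
    refine mul_le_of_le_one_left (by positivity) ?_
    rw [div_le_one (by positivity)]
    have : (0 : ℝ) ≤ n := Nat.cast_nonneg n
    linarith
  · have hs : ‖Real.sqrt x‖ < 1 := by
      rw [Real.norm_eq_abs, abs_of_nonneg (Real.sqrt_nonneg _), Real.sqrt_lt' one_pos]
      simpa using hx1
    rw [← (Real.hasSum_arctan hs).tsum_eq, ← tsum_mul_left]
    refine tsum_congr fun n => ?_
    rw [pow_succ, pow_mul, Real.sq_sqrt hx.le]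
    push_cast
    ring

/-- The singular expansion of the base integrals. -/
theorem exists_base_expansion {ρ : ℝ} (hρ : 0 < ρ) {e : ℕ} (he : e = 0 ∨ e = 1) :
    ∃ A : ℝ → ℝ, AnalyticAt ℝ A 0 ∧ ∀ᶠ κ in 𝓝[>] (0 : ℝ),
      ∫ r in Set.Ioo 0 ρ, r ^ e / (r ^ 2 / 2 + κ) =
        A κ + (if e = 0 then (Real.sqrt 2)⁻¹ else 1) * singular e κ := by
  rcases he with rfl | rfl
  · obtain ⟨a, ha, haeq⟩ := exists_analyticAt_arctan_sqrt
    refine ⟨fun κ => -(2 / ρ * a (2 * κ / ρ ^ 2)), ?_, ?_⟩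
    · have : AnalyticAt ℝ a (2 * (0 : ℝ) / ρ ^ 2) := by simpa using ha
      have h2 : AnalyticAt ℝ (fun κ : ℝ => a (2 * κ / ρ ^ 2)) 0 :=
        AnalyticAt.fun_comp (f := fun κ : ℝ => 2 * κ / ρ ^ 2) this (by fun_prop (disch := positivity))
      fun_prop
    · have hδ : (0 : ℝ) < ρ ^ 2 / 2 := by positivity
      filter_upwards [Ioo_mem_nhdsGT hδ] with κ hκ
      have hκ0 : 0 < κ := hκ.1
      simp only [pow_zero, integral_Ioo_div_even hρ hκ0, singular, if_true]
      have h1 := haeq (2 * κ / ρ ^ 2) (by positivity) (by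
        rw [div_lt_one (by positivity)]; linarith [hκ.2])
      rw [Real.sqrt_div (by positivity), Real.sqrt_sq hρ.le] at h1
      rw [h1, Real.sqrt_mul (by norm_num)]
      have : 0 < Real.sqrt κ := Real.sqrt_pos.2 hκ0
      field_simp
      ring
  · refine ⟨fun κ => Real.log (ρ ^ 2 / 2 + κ), ?_, ?_⟩
    · exact AnalyticAt.log (by fun_prop) (by simp; positivity)
    · filter_upwards [self_mem_nhdsWithin] with κ hκ
      simp only [pow_one, integral_Ioo_div_odd hρ hκ, singular]
      simp
      ring

/-- The singular expansion of a radial integral with density `r ^ e * h (r ^ 2)`. -/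
theorem exists_radial_expansion {c : ℕ → ℝ} {ρ : ℝ} (hρ : 0 < ρ)
    (hc : Summable fun j => |c j| * (ρ ^ 2) ^ j) {e : ℕ} (he : e = 0 ∨ e = 1) {k : ℕ}
    (hk : ∀ j < k, c j = 0) :
    ∃ A B : ℝ → ℝ, AnalyticAt ℝ A 0 ∧ AnalyticAt ℝ B 0 ∧
      B 0 = (-2) ^ k * c k * (if e = 0 then (Real.sqrt 2)⁻¹ else 1) ∧
      ∀ᶠ κ in 𝓝[>] (0 : ℝ),
        ∫ r in Set.Ioo 0 ρ, r ^ e * (∑' j, c j * (r ^ 2) ^ j) / (r ^ 2 / 2 + κ) =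
          A κ + κ ^ k * B κ * singular e κ := by
  obtain ⟨A0, hA0, hbase⟩ := exists_base_expansion hρ he
  have ht : 0 < ρ ^ 2 := by positivity
  set h := shiftedSeries c 0 with hh
  have hscale : ∀ {f : ℝ → ℝ}, AnalyticAt ℝ f 0 → AnalyticAt ℝ (fun κ : ℝ => f (-2 * κ)) 0 := by
    intro f hf
    have : AnalyticAt ℝ f (-2 * (0 : ℝ)) := by simpa using hf
    exact AnalyticAt.fun_comp (f := fun κ : ℝ => -2 * κ) this (by fun_prop)
  have hhan := hscale (analyticAt_shiftedSeries ht hc 0)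
  have hkan := hscale (analyticAt_shiftedSeries ht hc k)
  -- With `s = -2κ` the denominator is `r²/2 + κ = (r² - s)/2`, so `D(s)` is the integral of the
  -- divided difference of `h`; this is the origin of the factor `2`.
  set D : ℝ → ℝ := fun s => ∫ r in Set.Ioo 0 ρ,
    ∑' l, (r ^ e * 2 * shiftedSeries c (l + 1) (r ^ 2)) * s ^ l with hD
  set K := ∑' j, |c j| * (ρ ^ 2) ^ j with hK
  have hK0 : 0 ≤ K := tsum_nonneg fun j => by positivity
  have hmaps : ∀ r ∈ Set.Icc (0 : ℝ) ρ, |r ^ 2| ≤ ρ ^ 2 := by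
    intro r hr
    rw [abs_of_nonneg (sq_nonneg r)]
    exact pow_le_pow_left₀ hr.1 hr.2 2
  have hcont : ∀ l, ContinuousOn (fun r : ℝ => shiftedSeries c l (r ^ 2)) (Set.Icc 0 ρ) := by
    intro l
    refine (continuousOn_shiftedSeries ht hc l).comp (by fun_prop) fun r hr => abs_le.1 (hmaps r hr)
  have hDan : AnalyticAt ℝ D 0 := by
    -- Half of the radius `ρ²` makes the majorants a geometric series of ratio `1/2`.
    refine analyticAt_integral_tsum (δ := ρ ^ 2 / 2)
      (b := fun l => ρ * (ρ ^ e * 2 * (K * ((ρ ^ 2) ^ (l + 1))⁻¹))) (by positivity) ?_ ?_ ?_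
    · intro l
      refine IntegrableOn.mono_set ?_ Set.Ioo_subset_Icc_self
      refine ContinuousOn.integrableOn_Icc ?_
      exact ContinuousOn.mul (by fun_prop) (hcont (l + 1))
    · intro l
      have := norm_setIntegral_le_of_norm_le_const (μ := volume) (s := Set.Ioo 0 ρ)
        (f := fun r => ‖r ^ e * 2 * shiftedSeries c (l + 1) (r ^ 2)‖)
        (C := ρ ^ e * 2 * (K * ((ρ ^ 2) ^ (l + 1))⁻¹)) (by simp) ?_
      · refine (le_abs_self _).trans (this.trans (le_of_eq ?_))
        simp [hρ.le]
        ring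
      · intro r hr
        rw [norm_norm, norm_mul, norm_mul, norm_pow, Real.norm_eq_abs, Real.norm_eq_abs,
          Real.norm_eq_abs, abs_of_pos hr.1, abs_of_pos (by norm_num : (0 : ℝ) < 2)]
        have h1 := abs_shiftedSeries_le ht hc (l + 1) (hmaps r ⟨hr.1.le, hr.2.le⟩)
        have h2 : r ^ e ≤ ρ ^ e := pow_le_pow_left₀ hr.1.le hr.2.le e
        gcongr
    · have : (fun l : ℕ => ρ * (ρ ^ e * 2 * (K * ((ρ ^ 2) ^ (l + 1))⁻¹)) * (ρ ^ 2 / 2) ^ l) =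
          fun l => ρ * (ρ ^ e * 2 * (K * (ρ ^ 2)⁻¹)) * (1 / 2) ^ l := by
        funext l
        rw [div_pow, one_div, inv_pow, pow_succ (ρ ^ 2) l]
        field_simp
      rw [this]
      exact (summable_geometric_of_lt_one (by norm_num) (by norm_num)).mul_left _
  -- The numerator is split as `(h(r²) - h(-2κ)) + h(-2κ)`. The second part multiplies the base
  -- integral, and `h(-2κ) = (-2κ)^k h_k(-2κ)` supplies both the factor `κ^k` and the constant
  -- `(-2)^k`.
  refine ⟨fun κ => D (-2 * κ) + h (-2 * κ) * A0 κ,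
    fun κ => (-2) ^ k * shiftedSeries c k (-2 * κ) * (if e = 0 then (Real.sqrt 2)⁻¹ else 1),
    (hscale hDan).add (hhan.mul hA0), by fun_prop, ?_, ?_⟩
  · simp [shiftedSeries_zero]
  · have hδ : 0 < ρ ^ 2 / 2 := by positivity
    filter_upwards [hbase, Ioo_mem_nhdsGT hδ] with κ hb hκ
    have hκ0 : 0 < κ := hκ.1
    have hs : |-2 * κ| < ρ ^ 2 := by
      rw [abs_mul, abs_of_pos hκ0]; norm_num; linarith [hκ.2]
    have hint2 : IntegrableOn (fun r : ℝ => r ^ e / (r ^ 2 / 2 + κ)) (Set.Ioo 0 ρ) := by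
      refine IntegrableOn.mono_set (ContinuousOn.integrableOn_Icc ?_) Set.Ioo_subset_Icc_self
      exact ContinuousOn.div (by fun_prop) (by fun_prop) fun x _ => by positivity
    have hint1 : IntegrableOn (fun r : ℝ => r ^ e * (h (r ^ 2) - h (-2 * κ)) / (r ^ 2 / 2 + κ))
        (Set.Ioo 0 ρ) := by
      refine IntegrableOn.mono_set (ContinuousOn.integrableOn_Icc ?_) Set.Ioo_subset_Icc_self
      refine ContinuousOn.div ?_ (by fun_prop) fun x _ => by positivity
      exact ContinuousOn.mul (by fun_prop) ((hcont 0).sub continuousOn_const)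
    have hdecomp : ∀ r ∈ Set.Ioo 0 ρ, r ^ e * (∑' j, c j * (r ^ 2) ^ j) / (r ^ 2 / 2 + κ) =
        r ^ e * (h (r ^ 2) - h (-2 * κ)) / (r ^ 2 / 2 + κ) +
          h (-2 * κ) * (r ^ e / (r ^ 2 / 2 + κ)) := by
      intro r hr
      have : (∑' j, c j * (r ^ 2) ^ j) = h (r ^ 2) := by simp [hh, shiftedSeries]
      rw [this]
      ring
    have hDeq : ∫ r in Set.Ioo 0 ρ, r ^ e * (h (r ^ 2) - h (-2 * κ)) / (r ^ 2 / 2 + κ) =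
        D (-2 * κ) := by
      refine setIntegral_congr_fun measurableSet_Ioo fun r hr => ?_
      rw [hh, shiftedSeries_sub ht hc (hmaps r ⟨hr.1.le, hr.2.le⟩) hs]
      simp_rw [mul_assoc (r ^ e * 2)]
      rw [tsum_mul_left]
      have : r ^ 2 / 2 + κ ≠ 0 := by positivity
      field_simp
      ring
    rw [setIntegral_congr_fun measurableSet_Ioo hdecomp, integral_add hint1 (hint2.const_mul _),
      integral_const_mul, hDeq, hb]
    have hv := shiftedSeries_of_vanishing ht hc k hk hs.le
    rw [← hh] at hv
    have hp : (-2 * κ) ^ k = (-2) ^ k * κ ^ k := mul_pow _ _ _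
    rw [mul_add, ← add_assoc]
    congr 1
    rw [hv, hp]
    ring

end DiscreteBilaplacian
end

noncomputable section
namespace DiscreteBilaplacian

open Filter Topology

/-! ### Analyticity of the Fourier transform of the generator -/

theorem summable_prod_of_summable {d : ℕ} {f : ℤ → ℝ} (hf0 : ∀ k, 0 ≤ f k) (hf : Summable f) :
    Summable fun x : Lattice d => ∏ i, f (x i) := by
  refine summable_of_sum_le (c := ∏ _i : Fin d, ∑' k, f k)
    (fun x => Finset.prod_nonneg fun i _ => hf0 _) fun s => ?_
  classical
  let t : Fin d → Finset ℤ := fun i => s.image fun x => x i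
  calc ∑ x ∈ s, ∏ i, f (x i) ≤ ∑ x ∈ Fintype.piFinset t, ∏ i, f (x i) := by
        refine Finset.sum_le_sum_of_subset_of_nonneg ?_
          fun x _ _ => Finset.prod_nonneg fun i _ => hf0 _
        intro x hx
        rw [Fintype.mem_piFinset]
        exact fun i => Finset.mem_image_of_mem _ hx
    _ = ∏ i, ∑ k ∈ t i, f k := (Finset.prod_univ_sum t fun _ k => f k).symm
    _ ≤ ∏ _i : Fin d, ∑' k, f k := by
        refine Finset.prod_le_prod (fun i _ => Finset.sum_nonneg fun k _ => hf0 k) fun i _ => ?_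
        exact hf.sum_le_tsum _ fun k _ => hf0 k

theorem summable_exp_neg_abs {b : ℝ} (hb : 0 < b) :
    Summable fun k : ℤ => Real.exp (-b * |(k : ℝ)|) := by
  have h : Summable fun n : ℕ => Real.exp (-b * n) := by
    have := Real.summable_exp_nat_mul_iff.2 (by linarith : -b < 0)
    simpa [mul_comm] using this
  refine Summable.of_nat_of_neg ?_ ?_ <;> simpa using h

theorem abs_le_latticeLength {d : ℕ} (x : Lattice d) (i : Fin d) :
    |(x i : ℝ)| ≤ latticeLength x := by
  refine Real.abs_le_sqrt ?_
  exact Finset.single_le_sum (f := fun i => (x i : ℝ) ^ 2) (fun _ _ => sq_nonneg _)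
    (Finset.mem_univ i)

theorem latticeLength_nonneg {d : ℕ} (x : Lattice d) : 0 ≤ latticeLength x := Real.sqrt_nonneg _

/-- Since `∑ |xᵢ| ≤ d |x|`, the exponential is dominated by a product of one-dimensional
exponentials. Dividing by `d + 1` instead of `d` avoids a separate case `d = 0`. -/
theorem summable_exp_neg_latticeLength {d : ℕ} {a : ℝ} (ha : 0 < a) :
    Summable fun x : Lattice d => Real.exp (-a * latticeLength x) := by
  have hd : (0 : ℝ) < d + 1 := by positivity
  refine Summable.of_nonneg_of_le (fun _ => (Real.exp_pos _).le) (fun x => ?_)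
    (summable_prod_of_summable (d := d) (f := fun k => Real.exp (-(a / (d + 1)) * |(k : ℝ)|))
      (fun _ => (Real.exp_pos _).le) (summable_exp_neg_abs (by positivity)))
  rw [← Real.exp_sum, ← Finset.mul_sum]
  refine Real.exp_le_exp.2 ?_
  have h1 : ∑ i, |(x i : ℝ)| ≤ d * latticeLength x := by
    have := Finset.sum_le_card_nsmul Finset.univ (fun i => |(x i : ℝ)|) (latticeLength x)
      fun i _ => abs_le_latticeLength x i
    simpa using this
  have h2 : a / (d + 1) * ∑ i, |(x i : ℝ)| ≤ a / (d + 1) * ((d + 1) * latticeLength x) := by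
    gcongr
    have := latticeLength_nonneg x
    nlinarith
  have h3 : a / (d + 1) * ((d + 1) * latticeLength x) = a * latticeLength x := by
    field_simp
  linarith

/-- Exponential decay makes the weighted sums of the generator converge. -/
theorem ExpDecay.exists_summable {d : ℕ} {vhat : Lattice d → ℝ} (h : ExpDecay vhat) :
    ∃ s : ℝ, 0 < s ∧ Summable fun x => |vhat x| * Real.exp (s * latticeLength x) := by
  obtain ⟨C, hC, a, ha, hv⟩ := h
  refine ⟨a / 2, by positivity, ?_⟩
  refine Summable.of_nonneg_of_le (fun _ => by positivity) (fun x => ?_)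
    ((summable_exp_neg_latticeLength (d := d) (a := a / 2) (by positivity)).mul_left C)
  calc |vhat x| * Real.exp (a / 2 * latticeLength x)
      ≤ C * Real.exp (-a * latticeLength x) * Real.exp (a / 2 * latticeLength x) := by
        gcongr; exact hv x
    _ = C * Real.exp (-(a / 2) * latticeLength x) := by
        rw [mul_assoc, ← Real.exp_add]; ring_nf

theorem ExpDecay.summable_abs {d : ℕ} {vhat : Lattice d → ℝ} (h : ExpDecay vhat) :
    Summable fun x => |vhat x| := by
  obtain ⟨s, hs, hsum⟩ := h.exists_summable
  refine Summable.of_nonneg_of_le (fun _ => abs_nonneg _) (fun x => ?_) hsum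
  refine le_mul_of_one_le_right (abs_nonneg _) (Real.one_le_exp ?_)
  have := latticeLength_nonneg x
  positivity

/-- The continuous linear form `q ↦ i x·q`. -/
def phaseForm {d : ℕ} (x : Lattice d) : Momentum d →L[ℝ] ℂ :=
  ∑ i, (EuclideanSpace.proj i : Momentum d →L[ℝ] ℝ).smulRight (Complex.I * (x i : ℂ))

theorem phaseForm_apply {d : ℕ} (x : Lattice d) (q : Momentum d) :
    phaseForm x q = Complex.I * ((∑ i, (x i : ℝ) * q i : ℝ) : ℂ) := by
  simp only [phaseForm, FunLike.coe_sum, Finset.sum_apply, ContinuousLinearMap.smulRight_apply,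
    Complex.real_smul, Complex.ofReal_sum, Finset.mul_sum]
  refine Finset.sum_congr rfl fun i _ => ?_
  rw [show (EuclideanSpace.proj i : Momentum d →L[ℝ] ℝ) q = q i from rfl]
  push_cast
  ring

theorem norm_phaseForm_le {d : ℕ} (x : Lattice d) : ‖phaseForm x‖ ≤ latticeLength x := by
  refine ContinuousLinearMap.opNorm_le_bound _ (latticeLength_nonneg x) fun q => ?_
  rw [phaseForm_apply, norm_mul, Complex.norm_I, one_mul, Complex.norm_real, Real.norm_eq_abs,
    EuclideanSpace.norm_eq, latticeLength, ← Real.sqrt_mul (Finset.sum_nonneg fun _ _ => sq_nonneg _)]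
  refine Real.abs_le_sqrt ?_
  simpa using Finset.sum_mul_sq_le_sq_mul_sq Finset.univ (fun i => (x i : ℝ)) (fun i => q i)

theorem norm_exp_phaseForm {d : ℕ} (x : Lattice d) (q : Momentum d) :
    ‖Complex.exp (phaseForm x q)‖ = 1 := by
  rw [phaseForm_apply, mul_comm, Complex.norm_exp_ofReal_mul_I]

theorem fourierV_eq {d : ℕ} (vhat : Lattice d → ℝ) (p : Momentum d) :
    fourierV vhat p = (((2 * Real.pi) ^ (-(d : ℝ) / 2) : ℝ) : ℂ) *
      ∑' x : Lattice d, (vhat x : ℂ) * Complex.exp (phaseForm x p) := by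
  simp only [fourierV, phaseForm_apply]

/-- A sum of exponentials of linear forms with exponentially summable weights is analytic. -/
theorem analyticAt_tsum_exp {ι E : Type*} [NormedAddCommGroup E] [NormedSpace ℝ E]
    {a : ι → ℂ} {L : ι → E →L[ℝ] ℂ} {s : ℝ} (hs : 0 < s)
    (hsum : Summable fun x => ‖a x‖ * Real.exp (s * ‖L x‖)) {p : E}
    (hre : ∀ x, ‖Complex.exp (L x p)‖ ≤ 1) :
    AnalyticAt ℝ (fun q => ∑' x, a x * Complex.exp (L x q)) p := by
  -- One term of the exponential series is at most its sum; this bounds the `n`-th Taylor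
  -- coefficient by a multiple of `s^(-n)` and makes the radius of convergence at least `s`.
  have hb : ∀ x (n : ℕ), ‖a x‖ * ((n.factorial : ℝ)⁻¹ * ‖L x‖ ^ n) * s ^ n ≤
      ‖a x‖ * Real.exp (s * ‖L x‖) := by
    intro x n
    have := Real.pow_div_factorial_le_exp (s * ‖L x‖) (by positivity) n
    calc ‖a x‖ * ((n.factorial : ℝ)⁻¹ * ‖L x‖ ^ n) * s ^ n
        = ‖a x‖ * ((s * ‖L x‖) ^ n / n.factorial) := by rw [mul_pow]; ring
      _ ≤ _ := by gcongr
  let t : (n : ℕ) → ι → ContinuousMultilinearMap ℝ (fun _ : Fin n => E) ℂ := fun n x =>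
    (a x * Complex.exp (L x p) * (n.factorial : ℂ)⁻¹) •
      (ContinuousMultilinearMap.mkPiAlgebraFin ℝ n ℂ).compContinuousLinearMap fun _ => L x
  have htn : ∀ n x, ‖t n x‖ ≤ ‖a x‖ * ((n.factorial : ℝ)⁻¹ * ‖L x‖ ^ n) := by
    intro n x
    have h1 : ‖(ContinuousMultilinearMap.mkPiAlgebraFin ℝ n ℂ).compContinuousLinearMap
        fun _ => L x‖ ≤ ‖L x‖ ^ n := by
      refine (ContinuousMultilinearMap.norm_compContinuousLinearMap_le _ _).trans ?_
      simp
    calc ‖t n x‖ ≤ ‖a x * Complex.exp (L x p) * (n.factorial : ℂ)⁻¹‖ * ‖L x‖ ^ n := by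
          rw [norm_smul]; gcongr
      _ ≤ ‖a x‖ * 1 * (n.factorial : ℝ)⁻¹ * ‖L x‖ ^ n := by
          rw [norm_mul, norm_mul, norm_inv, Complex.norm_natCast]
          gcongr
          exact hre x
      _ = _ := by ring
  have htn_sum : ∀ n, Summable fun x => ‖a x‖ * ((n.factorial : ℝ)⁻¹ * ‖L x‖ ^ n) := by
    intro n
    have h : Summable fun x => ‖a x‖ * ((n.factorial : ℝ)⁻¹ * ‖L x‖ ^ n) * s ^ n :=
      Summable.of_nonneg_of_le (fun x => by positivity) (fun x => hb x n) hsum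
    exact (summable_mul_right_iff (by positivity)).1 h
  have ht_sum : ∀ n, Summable (t n) := fun n =>
    Summable.of_norm_bounded (htn_sum n) fun x => htn n x
  let P : FormalMultilinearSeries ℝ E ℂ := fun n => ∑' x, t n x
  have hPapply : ∀ n (y : E), HasSum
      (fun x => a x * Complex.exp (L x p) * ((n.factorial : ℂ)⁻¹ * L x y ^ n))
      (P n fun _ => y) := by
    intro n y
    have := ContinuousMultilinearMap.hasSum_eval (ht_sum n).hasSum fun _ => y
    have h2 : ∀ x, t n x (fun _ => y) =
        a x * Complex.exp (L x p) * ((n.factorial : ℂ)⁻¹ * L x y ^ n) := by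
      intro x
      simp [t, mul_assoc]
    simp only [h2] at this
    exact this
  refine ⟨P, ENNReal.ofReal s, ?_, by simpa using hs, fun {y} hy => ?_⟩
  · rw [← ENNReal.ofNNReal_toNNReal]
    refine P.le_radius_of_bound (∑' x, ‖a x‖ * Real.exp (s * ‖L x‖)) fun n => ?_
    rw [Real.coe_toNNReal s hs.le]
    have h1 : ‖P n‖ ≤ ∑' x, ‖a x‖ * ((n.factorial : ℝ)⁻¹ * ‖L x‖ ^ n) :=
      tsum_of_norm_bounded (htn_sum n).hasSum (htn n)
    calc ‖P n‖ * s ^ n ≤ (∑' x, ‖a x‖ * ((n.factorial : ℝ)⁻¹ * ‖L x‖ ^ n)) * s ^ n := by gcongr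
      _ = ∑' x, ‖a x‖ * ((n.factorial : ℝ)⁻¹ * ‖L x‖ ^ n) * s ^ n := tsum_mul_right.symm
      _ ≤ _ := ((htn_sum n).mul_right _).tsum_le_tsum (fun x => hb x n) hsum
  · have hy' : ‖y‖ < s := by
      rw [Metric.mem_eball, edist_zero_right, ← ofReal_norm,
        ENNReal.ofReal_lt_ofReal_iff hs] at hy
      exact hy
    -- The double family indexed by frequency and Taylor degree is absolutely summable, so the sum
    -- over frequencies of the exponential series can be reordered into the sum over degrees.
    let u : ι × ℕ → ℂ := fun z =>
      a z.1 * Complex.exp (L z.1 p) * ((z.2.factorial : ℂ)⁻¹ * L z.1 y ^ z.2)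
    have hu : ∀ z, ‖u z‖ ≤ ‖a z.1‖ * ((z.2.factorial : ℝ)⁻¹ * (s * ‖L z.1‖) ^ z.2) := by
      rintro ⟨x, n⟩
      have h1 : ‖L x y‖ ≤ s * ‖L x‖ := by
        refine ((L x).le_opNorm y).trans ?_
        rw [mul_comm]
        gcongr
      simp only [u, norm_mul, norm_inv, Complex.norm_natCast, norm_pow]
      have := hre x
      calc ‖a x‖ * ‖Complex.exp (L x p)‖ * ((n.factorial : ℝ)⁻¹ * ‖L x y‖ ^ n)
          ≤ ‖a x‖ * 1 * ((n.factorial : ℝ)⁻¹ * (s * ‖L x‖) ^ n) := by gcongr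
        _ = _ := by ring
    have hexp : ∀ r : ℝ, HasSum (fun n : ℕ => (n.factorial : ℝ)⁻¹ * r ^ n) (Real.exp r) := by
      intro r
      have := NormedSpace.expSeries_div_hasSum_exp (𝔸 := ℝ) r
      rw [← Real.exp_eq_exp_ℝ] at this
      simpa [div_eq_inv_mul] using this
    have hcexp : ∀ r : ℂ, HasSum (fun n : ℕ => (n.factorial : ℂ)⁻¹ * r ^ n) (Complex.exp r) := by
      intro r
      have := NormedSpace.expSeries_div_hasSum_exp (𝔸 := ℂ) r
      rw [← Complex.exp_eq_exp_ℂ] at this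
      simpa [div_eq_inv_mul] using this
    have husum : Summable u := by
      refine Summable.of_norm_bounded
        (g := fun z : ι × ℕ => ‖a z.1‖ * ((z.2.factorial : ℝ)⁻¹ * (s * ‖L z.1‖) ^ z.2)) ?_ hu
      have hnn : ∀ z : ι × ℕ, 0 ≤ ‖a z.1‖ * ((z.2.factorial : ℝ)⁻¹ * (s * ‖L z.1‖) ^ z.2) :=
        fun z => by positivity
      rw [summable_prod_of_nonneg hnn]
      refine ⟨fun x => (hexp (s * ‖L x‖)).summable.mul_left ‖a x‖, ?_⟩
      refine hsum.congr fun x => ?_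
      exact ((hexp (s * ‖L x‖)).mul_left ‖a x‖).tsum_eq.symm
    have h1 : HasSum u (∑' x, a x * Complex.exp (L x (p + y))) := by
      have := husum.hasSum.prod_fiberwise (fun x => ((hcexp (L x y)).mul_left
        (a x * Complex.exp (L x p))))
      have h2 : ∑' x, a x * Complex.exp (L x (p + y)) = ∑' z, u z := by
        rw [← this.tsum_eq]
        refine tsum_congr fun x => ?_
        rw [map_add, Complex.exp_add, mul_assoc]
      rw [h2]
      exact husum.hasSum
    have h2 : HasSum (fun z : ℕ × ι => u (z.2, z.1)) (∑' x, a x * Complex.exp (L x (p + y))) :=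
      (Equiv.prodComm ℕ ι).hasSum_iff.2 h1
    exact h2.prod_fiberwise (fun n => hPapply n y)

theorem analyticAt_fourierV {d : ℕ} {vhat : Lattice d → ℝ} (h : ExpDecay vhat) (p : Momentum d) :
    AnalyticAt ℝ (fourierV vhat) p := by
  obtain ⟨s, hs, hsum⟩ := h.exists_summable
  have h1 : AnalyticAt ℝ (fun q => ∑' x : Lattice d, (vhat x : ℂ) * Complex.exp (phaseForm x q)) p := by
    refine analyticAt_tsum_exp hs ?_ fun x => (norm_exp_phaseForm x p).le
    refine Summable.of_nonneg_of_le (fun _ => by positivity) (fun x => ?_) hsum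
    rw [Complex.norm_real, Real.norm_eq_abs]
    gcongr
    exact norm_phaseForm_le x
  simp_rw [funext (fourierV_eq vhat)]
  exact analyticAt_const.mul h1

theorem continuous_fourierV {d : ℕ} {vhat : Lattice d → ℝ} (h : ExpDecay vhat) :
    Continuous (fourierV vhat) :=
  continuous_iff_continuousAt.2 fun p => (analyticAt_fourierV h p).continuousAt

theorem analyticAt_normSq_fourierV {d : ℕ} {vhat : Lattice d → ℝ} (h : ExpDecay vhat)
    (p : Momentum d) : AnalyticAt ℝ (fun p => ‖fourierV vhat p‖ ^ 2) p := by
  have h1 : (fun p => ‖fourierV vhat p‖ ^ 2) =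
      fun p => (Complex.reCLM (fourierV vhat p)) ^ 2 + (Complex.imCLM (fourierV vhat p)) ^ 2 := by
    funext p
    rw [Complex.sq_norm, Complex.normSq_apply]
    simp [sq]
  rw [h1]
  have hv := analyticAt_fourierV h p
  exact ((Complex.reCLM.analyticAt _).fun_comp hv).fun_pow 2 |>.add
    (((Complex.imCLM.analyticAt _).fun_comp hv).fun_pow 2)

theorem exists_norm_fourierV_le {d : ℕ} {vhat : Lattice d → ℝ} (h : ExpDecay vhat) :
    ∃ K, ∀ p, ‖fourierV vhat p‖ ≤ K := by
  refine ⟨‖(((2 * Real.pi) ^ (-(d : ℝ) / 2) : ℝ) : ℂ)‖ * ∑' x, |vhat x|, fun p => ?_⟩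
  rw [fourierV_eq, norm_mul]
  gcongr
  refine tsum_of_norm_bounded h.summable_abs.hasSum fun x => ?_
  rw [norm_mul, norm_exp_phaseForm, mul_one, Complex.norm_real, Real.norm_eq_abs]

/-- The generator is real, so its Fourier transform is conjugated by `p ↦ -p`. -/
theorem fourierV_neg {d : ℕ} (vhat : Lattice d → ℝ) (p : Momentum d) :
    fourierV vhat (-p) = (starRingEnd ℂ) (fourierV vhat p) := by
  rw [fourierV_eq, fourierV_eq, map_mul, Complex.conj_ofReal, Complex.conj_tsum]
  congr 1
  refine tsum_congr fun x => ?_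
  rw [map_mul, Complex.conj_ofReal, ← Complex.exp_conj, phaseForm_apply, phaseForm_apply, map_mul,
    Complex.conj_I, Complex.conj_ofReal]
  simp [mul_neg, Finset.sum_neg_distrib]

theorem fourierV_periodic {d : ℕ} (vhat : Lattice d → ℝ) {p q : Momentum d}
    (h : ∀ i, ∃ k : ℤ, p i = q i + k * (2 * Real.pi)) : fourierV vhat p = fourierV vhat q := by
  choose k hk using h
  rw [fourierV_eq, fourierV_eq]
  congr 1
  refine tsum_congr fun x => ?_
  congr 1
  rw [phaseForm_apply, phaseForm_apply, Complex.exp_eq_exp_iff_exists_int]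
  refine ⟨∑ i, x i * k i, ?_⟩
  have : (∑ i, (x i : ℝ) * p i) = (∑ i, (x i : ℝ) * q i) + (∑ i, x i * k i : ℤ) * (2 * Real.pi) := by
    push_cast
    rw [Finset.sum_mul, ← Finset.sum_add_distrib]
    refine Finset.sum_congr rfl fun i _ => ?_
    rw [hk i]
    ring
  rw [this]
  push_cast
  ring

/-- Modulo `2π`, `π - q` is `-(π + q)`, and reality of the generator turns the sign into a
conjugation. Hence `|v|²` is even about the maximum of the dispersion relation. -/
theorem norm_fourierV_pi_neg {d : ℕ} (vhat : Lattice d → ℝ) (q : Momentum d) :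
    ‖fourierV vhat (piVec d - q)‖ = ‖fourierV vhat (piVec d + q)‖ := by
  have h1 : fourierV vhat (piVec d - q) = fourierV vhat (-(piVec d + q)) := by
    refine fourierV_periodic vhat fun i => ⟨1, ?_⟩
    simp [piVec]
    ring
  rw [h1, fourierV_neg, RCLike.norm_conj]

end DiscreteBilaplacian
end

noncomputable section
namespace DiscreteBilaplacian

open Filter Topology

/-! ### Polar coordinates -/

/-- After extension by zero the integral runs over the whole space. The origin is a null set, and
its complement is measure-isomorphic to the sphere times the half-line with density `r^(d-1)`. -/
theorem integral_ball_eq_polar {d : ℕ} (hd : 1 ≤ d) {f : Momentum d → ℝ} {ρ : ℝ}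
    (hf : IntegrableOn f (Metric.ball 0 ρ)) :
    ∫ y in Metric.ball 0 ρ, f y = ∫ r in Set.Ioo 0 ρ, r ^ (d - 1) *
      ∫ w : Metric.sphere (0 : Momentum d) 1, f (r • (w : Momentum d))
        ∂(volume : Measure (Momentum d)).toSphere := by
  have : Nonempty (Fin d) := ⟨⟨0, hd⟩⟩
  set μ : Measure (Momentum d) := volume
  set F : Momentum d → ℝ := (Metric.ball 0 ρ).indicator f with hF
  have hFint : Integrable F := (integrable_indicator_iff measurableSet_ball).2 hf
  let Φ : Metric.sphere (0 : Momentum d) 1 × Set.Ioi (0 : ℝ) → ℝ := fun z => F (z.2.1 • z.1.1)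
  have hΦ : ∀ x : ({0}ᶜ : Set (Momentum d)), Φ (homeomorphUnitSphereProd (Momentum d) x) = F x := by
    intro x
    have hx : ‖(x : Momentum d)‖ ≠ 0 := norm_ne_zero_iff.2 x.2
    simp [Φ, smul_smul, hx]
  have hdim : Module.finrank ℝ (Momentum d) = d := by simp
  have mp := μ.measurePreserving_homeomorphUnitSphereProd
  rw [hdim] at mp
  have hemb := (homeomorphUnitSphereProd (Momentum d)).measurableEmbedding
  have hΦint : Integrable Φ (μ.toSphere.prod (.volumeIoiPow (d - 1))) := by
    rw [← mp.integrable_comp_emb hemb]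
    have h1 : (Φ ∘ homeomorphUnitSphereProd (Momentum d)) = F ∘ Subtype.val := funext hΦ
    rw [h1]
    rw [← integrableOn_iff_comap_subtypeVal (measurableSet_singleton _).compl]
    exact hFint.integrableOn
  calc ∫ y in Metric.ball 0 ρ, f y = ∫ y, F y := (integral_indicator measurableSet_ball).symm
    _ = ∫ x : ({(0)}ᶜ : Set (Momentum d)), F x ∂(μ.comap (↑)) := by
        rw [integral_subtype_comap (measurableSet_singleton _).compl F, restrict_compl_singleton]
    _ = ∫ z, Φ z ∂(μ.toSphere.prod (.volumeIoiPow (d - 1))) := by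
        rw [← mp.integral_comp hemb]
        simp only [hΦ]
    _ = ∫ r : Set.Ioi (0 : ℝ), (∫ w, Φ (w, r) ∂μ.toSphere) ∂(.volumeIoiPow (d - 1)) :=
        integral_prod_symm _ hΦint
    _ = ∫ r in Set.Ioi (0 : ℝ), r ^ (d - 1) * ∫ w : Metric.sphere (0 : Momentum d) 1,
          F (r • (w : Momentum d)) ∂μ.toSphere := by
        simp only [Measure.volumeIoiPow, ENNReal.ofReal]
        rw [integral_withDensity_eq_integral_smul,
          integral_subtype_comap measurableSet_Ioi fun a => Real.toNNReal (a ^ (d - 1)) •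
            ∫ w : Metric.sphere (0 : Momentum d) 1, F (a • (w : Momentum d)) ∂μ.toSphere,
          setIntegral_congr_fun measurableSet_Ioi fun x hx => ?_]
        · simp only [NNReal.smul_def, smul_eq_mul]
          rw [Real.coe_toNNReal _ (pow_nonneg (le_of_lt hx) _)]
        · exact (measurable_subtype_coe.pow_const _).real_toNNReal
    _ = ∫ r in Set.Ioi (0 : ℝ), (Set.Ioo 0 ρ).indicator (fun r => r ^ (d - 1) *
          ∫ w : Metric.sphere (0 : Momentum d) 1, f (r • (w : Momentum d)) ∂μ.toSphere) r := by
        refine setIntegral_congr_fun measurableSet_Ioi fun r hr => ?_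
        have hr0 : (0 : ℝ) < r := hr
        by_cases h : r < ρ
        · rw [Set.indicator_of_mem (show r ∈ Set.Ioo 0 ρ from ⟨hr, h⟩)]
          congr 2
          funext w
          rw [hF, Set.indicator_of_mem]
          simp [norm_smul, abs_of_pos hr0, h]
        · rw [Set.indicator_of_notMem (fun hh => h hh.2)]
          have : ∀ w : Metric.sphere (0 : Momentum d) 1, F (r • (w : Momentum d)) = 0 := by
            intro w
            rw [hF, Set.indicator_of_notMem]
            simpa [norm_smul, abs_of_pos hr0] using h
          simp [this]
    _ = _ := by
        rw [setIntegral_indicator measurableSet_Ioo]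
        congr 2
        ext r
        simp only [Set.mem_inter_iff, Set.mem_Ioi, Set.mem_Ioo]
        tauto

/-! ### Spherical means of an even analytic function -/

/-- Averaging the Taylor series at `rw` and `-rw` removes the odd degrees, so the spherical mean is
a power series in `r²`. The summability along rays is kept for the later identification of the
leading coefficient. -/
theorem exists_sphere_series {d : ℕ} {G : Momentum d → ℝ} {p : FormalMultilinearSeries ℝ (Momentum d) ℝ}
    (hp : HasFPowerSeriesAt G p 0) (heven : ∀ y, G (-y) = G y) :
    ∃ ρ₀ > 0,
      (Summable fun j => |∫ w : Metric.sphere (0 : Momentum d) 1, p (2 * j) (fun _ => (w : Momentum d))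
        ∂(volume : Measure (Momentum d)).toSphere| * (ρ₀ ^ 2) ^ j) ∧
      (∀ y, ‖y‖ ≤ ρ₀ → Summable fun m => |p m fun _ => y|) ∧
      ∀ r, 0 < r → r ≤ ρ₀ → ∫ w : Metric.sphere (0 : Momentum d) 1, G (r • (w : Momentum d))
        ∂(volume : Measure (Momentum d)).toSphere =
        ∑' j, (∫ w : Metric.sphere (0 : Momentum d) 1, p (2 * j) (fun _ => (w : Momentum d))
        ∂(volume : Measure (Momentum d)).toSphere) * (r ^ 2) ^ j := by
  obtain ⟨R, hR⟩ := hp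
  obtain ⟨s, hs0, hsr⟩ := ENNReal.lt_iff_exists_nnreal_btwn.1 hR.r_pos
  have hs0' : (0 : ℝ) < s := by exact_mod_cast hs0
  have hsum := p.summable_norm_mul_pow (r := s) (hsr.trans_le hR.r_le)
  set σ := (volume : Measure (Momentum d)).toSphere with hσ
  have hpw : ∀ m (w : Metric.sphere (0 : Momentum d) 1), ‖p m fun _ => (w : Momentum d)‖ ≤ ‖p m‖ := by
    intro m w
    have := (p m).le_opNorm fun _ => (w : Momentum d)
    simpa using this
  have hcont : ∀ m, Continuous fun w : Metric.sphere (0 : Momentum d) 1 =>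
      p m fun _ => (w : Momentum d) := by
    intro m
    exact (p m).cont.comp (by fun_prop)
  have hint : ∀ m, Integrable (fun w : Metric.sphere (0 : Momentum d) 1 =>
      p m fun _ => (w : Momentum d)) σ := by
    intro m
    exact Integrable.of_bound (hcont m).aestronglyMeasurable ‖p m‖ (ae_of_all _ (hpw m))
  have hinj : Function.Injective fun j : ℕ => 2 * j := fun a b h => by simpa using h
  have heven_sum : Summable fun j => ‖p (2 * j)‖ * ((s : ℝ) ^ 2) ^ j := by
    have := hsum.comp_injective hinj
    refine this.congr fun j => ?_
    simp [pow_mul]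
  have hcj : ∀ j, |∫ w : Metric.sphere (0 : Momentum d) 1, p (2 * j) (fun _ => (w : Momentum d)) ∂σ|
      ≤ ‖p (2 * j)‖ * σ.real Set.univ := by
    intro j
    exact norm_integral_le_of_norm_le_const (ae_of_all _ (hpw (2 * j)))
  refine ⟨s, hs0', ?_, ?_, fun r hr hrs => ?_⟩
  · refine Summable.of_nonneg_of_le (fun j => by positivity) (fun j => ?_)
      (heven_sum.mul_right (σ.real Set.univ))
    calc _ ≤ ‖p (2 * j)‖ * σ.real Set.univ * ((s : ℝ) ^ 2) ^ j := by gcongr; exact hcj j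
      _ = _ := by ring
  · intro y hy
    refine Summable.of_nonneg_of_le (fun j => abs_nonneg _) (fun m => ?_) hsum
    have := (p m).le_opNorm fun _ => y
    simp only [Real.norm_eq_abs, Finset.prod_const, Finset.card_univ, Fintype.card_fin] at this
    refine this.trans ?_
    gcongr
  · have hG : ∀ w : Metric.sphere (0 : Momentum d) 1,
        HasSum (fun j => (p (2 * j) fun _ => (w : Momentum d)) * (r ^ 2) ^ j)
          (G (r • (w : Momentum d))) := by
      intro w
      have hmem : ∀ x : ℝ, |x| ≤ s → x • (w : Momentum d) ∈ Metric.eball (0 : Momentum d) R := by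
        intro x hx
        rw [Metric.mem_eball, edist_zero_right]
        refine lt_of_le_of_lt ?_ hsr
        rw [enorm_eq_nnnorm]
        have : ‖x • (w : Momentum d)‖ ≤ s := by simpa [norm_smul] using hx
        exact_mod_cast this
      have h1 := hR.hasSum (hmem r (by rwa [abs_of_pos hr]))
      have h2 := hR.hasSum (hmem (-r) (by rwa [abs_neg, abs_of_pos hr]))
      have hpow : ∀ (x : ℝ) (m : ℕ), (p m fun _ => x • (w : Momentum d)) =
          x ^ m * p m fun _ => (w : Momentum d) := by
        intro x m
        have := (p m).map_smul_univ (fun _ => x) fun _ => (w : Momentum d)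
        simpa using this
      simp only [zero_add, hpow] at h1 h2
      rw [neg_smul, heven] at h2
      have h3 := (h1.add h2).div_const 2
      rw [add_self_div_two] at h3
      refine ((hinj.hasSum_iff ?_).2 h3).congr_fun ?_ |> fun h => h
      · intro m hm
        have hodd : Odd m := by
          rw [← Nat.not_even_iff_odd]
          rintro ⟨k, hk⟩
          exact hm ⟨k, by simp; omega⟩
        rw [hodd.neg_pow]
        ring
      · intro j
        simp only [Function.comp_apply, pow_mul, neg_sq]
        ring
    have key := hasSum_integral_of_summable_integral_norm (μ := σ)
      (F := fun j (w : Metric.sphere (0 : Momentum d) 1) =>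
        (p (2 * j) fun _ => (w : Momentum d)) * (r ^ 2) ^ j)
      (fun j => (hint _).mul_const _) ?_
    · simp only [(hG _).tsum_eq, integral_mul_const] at key
      exact key.tsum_eq.symm
    · refine Summable.of_nonneg_of_le (fun j => integral_nonneg fun _ => norm_nonneg _) (fun j => ?_)
        (heven_sum.mul_right (σ.real Set.univ))
      have h1 := norm_integral_le_of_norm_le_const (μ := σ) (C := ‖p (2 * j)‖ * (r ^ 2) ^ j)
        (f := fun w : Metric.sphere (0 : Momentum d) 1 =>
          ‖(p (2 * j) fun _ => (w : Momentum d)) * (r ^ 2) ^ j‖) (ae_of_all _ fun w => ?_)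
      · refine (le_abs_self _).trans (h1.trans ?_)
        calc ‖p (2 * j)‖ * (r ^ 2) ^ j * σ.real Set.univ
            ≤ ‖p (2 * j)‖ * ((s : ℝ) ^ 2) ^ j * σ.real Set.univ := by gcongr
          _ = _ := rfl
      · rw [norm_norm, norm_mul, norm_pow, norm_pow, Real.norm_eq_abs r, sq_abs]
        gcongr
        exact hpw _ w

/-! ### Leading coefficients -/

/-- By induction, if all coefficients below `m < N` vanish, then `b m` is the limit of the series
divided by `r^m`, which is a convergent quotient times `r^(N-m)` and tends to zero. This reads off
leading coefficients without composing power series. -/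
theorem coeff_of_tendsto_div_pow {b : ℕ → ℝ} {t : ℝ} (ht : 0 < t)
    (hb : Summable fun m => |b m| * t ^ m) {N : ℕ} {l : ℝ}
    (hl : Tendsto (fun r => (∑' m, b m * r ^ m) / r ^ N) (𝓝[>] 0) (𝓝 l)) :
    (∀ m < N, b m = 0) ∧ b N = l := by
  have hcont : ∀ m, Tendsto (shiftedSeries b m) (𝓝[>] 0) (𝓝 (b m)) := by
    intro m
    have := (analyticAt_shiftedSeries ht hb m).continuousAt.tendsto
    rw [shiftedSeries_zero] at this
    exact this.mono_left nhdsWithin_le_nhds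
  have hev : ∀ᶠ r in 𝓝[>] (0 : ℝ), 0 < r ∧ |r| ≤ t := by
    filter_upwards [Ioo_mem_nhdsGT ht] with r hr
    exact ⟨hr.1, by rw [abs_of_pos hr.1]; exact hr.2.le⟩
  have hseries : ∀ r, (∑' m, b m * r ^ m) = shiftedSeries b 0 r := fun r => by simp [shiftedSeries]
  simp only [hseries] at hl
  have hzero : ∀ m < N, b m = 0 := by
    intro m
    induction m using Nat.strong_induction_on with
    | _ m ih =>
      intro hm
      have h1 : Tendsto (fun r => shiftedSeries b 0 r / r ^ N * r ^ (N - m)) (𝓝[>] 0)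
          (𝓝 (l * 0 ^ (N - m))) := by
        refine hl.mul ?_
        exact (((continuous_pow (N - m)).tendsto (0 : ℝ)).mono_left nhdsWithin_le_nhds)
      rw [zero_pow (by omega), mul_zero] at h1
      refine tendsto_nhds_unique (hcont m) (h1.congr' ?_)
      filter_upwards [hev] with r hr
      rw [shiftedSeries_of_vanishing ht hb m (fun j hj => ih j hj (hj.trans hm)) hr.2]
      have : r ^ N = r ^ m * r ^ (N - m) := by rw [← pow_add]; congr 1; omega
      rw [this]
      have h0 : r ≠ 0 := hr.1.ne'
      field_simp
  refine ⟨hzero, tendsto_nhds_unique (hcont N) (hl.congr' ?_)⟩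
  filter_upwards [hev] with r hr
  rw [shiftedSeries_of_vanishing ht hb N hzero hr.2]
  have h0 : r ≠ 0 := hr.1.ne'
  field_simp

/-- Only the degree-`N` term and an `O(r^(N+1))` remainder survive, and homogeneity moves `r^(-N)`
inside. The path `φ` need only be tangent to `w`, so both straight rays and their images under
`arcsinMap` are covered. -/
theorem tendsto_div_pow_of_hasFPowerSeriesAt {E : Type*} [NormedAddCommGroup E] [NormedSpace ℝ E]
    {g : E → ℝ} {P : FormalMultilinearSeries ℝ E ℝ} {x w : E} {N : ℕ} {φ : ℝ → E}
    (hP : HasFPowerSeriesAt g P x) (hPN : ∀ m < N, ∀ y, (P m fun _ => y) = 0)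
    (hφ : Tendsto (fun r : ℝ => r⁻¹ • φ r) (𝓝[>] 0) (𝓝 w)) :
    Tendsto (fun r => g (x + φ r) / r ^ N) (𝓝[>] 0) (𝓝 (P N fun _ => w)) := by
  have hpos : ∀ᶠ r in 𝓝[>] (0 : ℝ), 0 < r := self_mem_nhdsWithin
  have hid : Tendsto (fun r : ℝ => r) (𝓝[>] 0) (𝓝 0) := tendsto_id.mono_left nhdsWithin_le_nhds
  have hφ0 : Tendsto φ (𝓝[>] 0) (𝓝 0) := by
    have := hid.smul hφ
    rw [zero_smul] at this
    refine this.congr' ?_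
    filter_upwards [hpos] with r hr
    rw [smul_smul, mul_inv_cancel₀ hr.ne', one_smul]
  have hO := (hP.isBigO_sub_partialSum_pow (N + 1)).comp_tendsto hφ0
  have hpart : ∀ y, P.partialSum (N + 1) y = P N fun _ => y := by
    intro y
    rw [FormalMultilinearSeries.partialSum, Finset.sum_range_succ,
      Finset.sum_eq_zero fun m hm => hPN m (Finset.mem_range.1 hm) y, zero_add]
  have hφO : (fun r => ‖φ r‖ ^ (N + 1)) =O[𝓝[>] 0] fun r : ℝ => r ^ (N + 1) := by
    refine Asymptotics.IsBigO.pow ?_ _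
    have h1 : (fun r : ℝ => r⁻¹ • φ r) =O[𝓝[>] 0] fun _ => (1 : ℝ) := hφ.isBigO_one ℝ
    have h2 := (Asymptotics.isBigO_refl (fun r : ℝ => r) (𝓝[>] 0)).smul h1
    refine Asymptotics.IsBigO.norm_left ?_
    refine (h2.congr' ?_ ?_)
    · filter_upwards [hpos] with r hr
      rw [smul_smul, mul_inv_cancel₀ hr.ne', one_smul]
    · filter_upwards with r
      simp
  have hO2 := hO.trans hφO
  have hlo : Tendsto (fun r => (g (x + φ r) - P N fun _ => φ r) / r ^ N) (𝓝[>] 0) (𝓝 0) := by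
    have h3 : (fun r : ℝ => r ^ (N + 1)) =o[𝓝[>] 0] fun r : ℝ => r ^ N :=
      (Asymptotics.isLittleO_pow_pow (𝕜 := ℝ) (Nat.lt_succ_self N)).mono nhdsWithin_le_nhds
    have h4 := (hO2.trans_isLittleO h3).tendsto_div_nhds_zero
    simpa [Function.comp_def, hpart] using h4
  have hmain : Tendsto (fun r : ℝ => P N fun _ => r⁻¹ • φ r) (𝓝[>] 0) (𝓝 (P N fun _ => w)) := by
    have : Continuous fun y : E => P N fun _ => y := (P N).cont.comp (by fun_prop)
    exact (this.tendsto w).comp hφ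
  have := hlo.add hmain
  rw [zero_add] at this
  refine this.congr' ?_
  filter_upwards [hpos] with r hr
  have := (P N).map_smul_univ (fun _ => r⁻¹) fun _ => φ r
  simp only [Finset.prod_const, Finset.card_univ, Fintype.card_fin, smul_eq_mul] at this
  rw [this, inv_pow]
  have h0 : r ^ N ≠ 0 := (pow_pos hr N).ne'
  field_simp
  ring

end DiscreteBilaplacian
end

noncomputable section
namespace DiscreteBilaplacian

open Filter Topology

/-! ### The coordinates `y = 2 sin (q / 2)` -/

/-- The fundamental cube of the torus. -/
def cube (d : ℕ) : Set (Momentum d) := {p | ∀ i, p i ∈ Set.Ioc (-Real.pi) Real.pi}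

/-- The dispersion relation of the Laplacian, `∑ (1 - cos qᵢ)`. -/
def energy {d : ℕ} (q : Momentum d) : ℝ := ∑ i, (1 - Real.cos (q i))

/-- The inverse of the coordinates `yᵢ = 2 sin (qᵢ / 2)`. -/
def arcsinMap {d : ℕ} (y : Momentum d) : Momentum d :=
  WithLp.toLp 2 fun i => 2 * Real.arcsin (y i / 2)

/-- The Jacobian of `arcsinMap`. -/
def arcsinJacobian {d : ℕ} (y : Momentum d) : ℝ := ∏ i, 1 / Real.sqrt (1 - (y i / 2) ^ 2)

theorem measurableSet_cube (d : ℕ) : MeasurableSet (cube d) := by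
  have : cube d = ⋂ i, (fun p : Momentum d => p i) ⁻¹' Set.Ioc (-Real.pi) Real.pi := by
    ext p; simp [cube]
  rw [this]
  refine MeasurableSet.iInter fun i => ?_
  have : Measurable fun p : Momentum d => p i := by fun_prop
  exact this measurableSet_Ioc

theorem continuous_energy {d : ℕ} : Continuous (energy : Momentum d → ℝ) := by
  unfold energy
  fun_prop

theorem energy_eq_sin {d : ℕ} (q : Momentum d) :
    energy q = ∑ i, 2 * Real.sin (q i / 2) ^ 2 := by
  refine Finset.sum_congr rfl fun i _ => ?_
  have h := Real.cos_two_mul (q i / 2)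
  rw [mul_div_cancel₀ (q i) two_ne_zero] at h
  have := Real.sin_sq_add_cos_sq (q i / 2)
  linarith

theorem energy_nonneg {d : ℕ} (q : Momentum d) : 0 ≤ energy q :=
  Finset.sum_nonneg fun i _ => by linarith [Real.cos_le_one (q i)]

theorem energy_le {d : ℕ} (q : Momentum d) : energy q ≤ 2 * d := by
  have := Finset.sum_le_card_nsmul Finset.univ (fun i => 1 - Real.cos (q i)) 2
    fun i _ => by linarith [Real.neg_one_le_cos (q i)]
  simpa [energy, mul_comm] using this

theorem abs_coord_lt {d : ℕ} {y : Momentum d} {ρ : ℝ} (hρ : ρ ≤ 2) (hy : y ∈ Metric.ball 0 ρ)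
    (i : Fin d) : |y i / 2| < 1 := by
  have h1 : ‖y‖ < ρ := by simpa using hy
  have h2 := PiLp.norm_apply_le y i
  rw [abs_div, abs_two, div_lt_one two_pos]
  rw [Real.norm_eq_abs] at h2
  linarith

/-- By the half-angle formula these coordinates make the energy exactly quadratic, which replaces
the Morse lemma. -/
theorem energy_arcsinMap {d : ℕ} {y : Momentum d} (hy : ∀ i, |y i / 2| < 1) :
    energy (arcsinMap y) = ‖y‖ ^ 2 / 2 := by
  rw [energy_eq_sin, EuclideanSpace.norm_sq_eq, Finset.sum_div]
  refine Finset.sum_congr rfl fun i _ => ?_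
  have h := abs_lt.1 (hy i)
  simp only [arcsinMap]
  rw [mul_div_cancel_left₀ _ two_ne_zero, Real.sin_arcsin h.1.le h.2.le, Real.norm_eq_abs, sq_abs]
  ring

theorem arcsinMap_mem_cube {d : ℕ} {y : Momentum d} (hy : ∀ i, |y i / 2| < 1) :
    arcsinMap y ∈ cube d := by
  intro i
  have h := abs_lt.1 (hy i)
  simp only [arcsinMap]
  constructor
  · have := Real.neg_pi_div_two_lt_arcsin.2 h.1
    linarith
  · have := Real.arcsin_le_pi_div_two (y i / 2)
    linarith

/-- On the cube each half-angle lies in `(-π/2, π/2]`, where arcsine inverts sine, and `|y|² = 2E`.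
So a ball in the new coordinates is a full sublevel set of the energy in the torus. -/
theorem image_arcsinMap_ball {d : ℕ} {ρ : ℝ} (hρ0 : 0 < ρ) (hρ : ρ ≤ 2) :
    arcsinMap '' Metric.ball (0 : Momentum d) ρ = {q | q ∈ cube d ∧ energy q < ρ ^ 2 / 2} := by
  ext q
  constructor
  · rintro ⟨y, hy, rfl⟩
    have hy' := abs_coord_lt hρ hy
    refine ⟨arcsinMap_mem_cube hy', ?_⟩
    rw [energy_arcsinMap hy']
    have : ‖y‖ < ρ := by simpa using hy
    have := pow_lt_pow_left₀ this (norm_nonneg _) two_ne_zero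
    linarith
  · rintro ⟨hq, hE⟩
    refine ⟨WithLp.toLp 2 fun i => 2 * Real.sin (q i / 2), ?_, ?_⟩
    · have h1 : ‖(WithLp.toLp 2 fun i => 2 * Real.sin (q i / 2) : Momentum d)‖ ^ 2 = 2 * energy q := by
        rw [energy_eq_sin, EuclideanSpace.norm_sq_eq, Finset.mul_sum]
        refine Finset.sum_congr rfl fun i _ => ?_
        rw [Real.norm_eq_abs, sq_abs]
        ring
      rw [mem_ball_zero_iff]
      refine lt_of_pow_lt_pow_left₀ 2 hρ0.le ?_
      rw [h1]; linarith
    · ext i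
      have := hq i
      simp only [arcsinMap]
      rw [mul_div_cancel_left₀ _ two_ne_zero, Real.arcsin_sin (by linarith [this.1]) (by linarith [this.2])]
      ring

theorem injOn_arcsinMap {d : ℕ} {ρ : ℝ} (hρ : ρ ≤ 2) :
    Set.InjOn arcsinMap (Metric.ball (0 : Momentum d) ρ) := by
  intro x hx y hy h
  ext i
  have h1 : arcsinMap x i = arcsinMap y i := by rw [h]
  simp only [arcsinMap] at h1
  have hx' := abs_lt.1 (abs_coord_lt hρ hx i)
  have hy' := abs_lt.1 (abs_coord_lt hρ hy i)
  have h2 : Real.arcsin (x i / 2) = Real.arcsin (y i / 2) := by linarith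
  have := Real.injOn_arcsin ⟨hx'.1.le, hx'.2.le⟩ ⟨hy'.1.le, hy'.2.le⟩ h2
  linarith

/-- The derivative of `arcsinMap`, a diagonal map. -/
def arcsinDeriv {d : ℕ} (y : Momentum d) : Momentum d →L[ℝ] Momentum d :=
  LinearMap.toContinuousLinearMap
    (Matrix.toEuclideanLin (Matrix.diagonal fun i => 1 / Real.sqrt (1 - (y i / 2) ^ 2)))

theorem det_arcsinDeriv {d : ℕ} (y : Momentum d) : (arcsinDeriv y).det = arcsinJacobian y := by
  rw [arcsinDeriv, LinearMap.det_toContinuousLinearMap,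
    show Matrix.toEuclideanLin (𝕜 := ℝ) = Matrix.toLin (PiLp.basisFun 2 ℝ (Fin d))
      (PiLp.basisFun 2 ℝ (Fin d)) from Matrix.toLpLin_eq_toLin 2 2,
    LinearMap.det_toLin, Matrix.det_diagonal, arcsinJacobian]

theorem hasFDerivAt_arcsinMap {d : ℕ} {y : Momentum d} (hy : ∀ i, |y i / 2| < 1) :
    HasFDerivAt arcsinMap (arcsinDeriv y) y := by
  rw [← hasFDerivWithinAt_univ, hasFDerivWithinAt_euclidean]
  intro i
  rw [hasFDerivWithinAt_univ]
  have h := abs_lt.1 (hy i)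
  have h1 : HasFDerivAt (fun x : Momentum d => x i / 2)
      ((1 / 2 : ℝ) • (EuclideanSpace.proj i : Momentum d →L[ℝ] ℝ)) y := by
    have := ((EuclideanSpace.proj i : Momentum d →L[ℝ] ℝ).hasFDerivAt (x := y)).const_mul (1 / 2 : ℝ)
    refine this.congr_of_eventuallyEq (Eventually.of_forall fun x => ?_)
    simp
    ring
  have h2 := ((Real.hasDerivAt_arcsin h.1.ne' h.2.ne).comp_hasFDerivAt y h1).const_mul (2 : ℝ)
  refine h2.congr_fderiv ?_
  ext v
  simp [arcsinDeriv, Matrix.mulVec_diagonal]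
  ring

theorem setIntegral_energy_lt {d : ℕ} {ρ : ℝ} (hρ0 : 0 < ρ) (hρ : ρ ≤ 2) (Ψ : Momentum d → ℝ) :
    ∫ q in {q | q ∈ cube d ∧ energy q < ρ ^ 2 / 2}, Ψ q =
      ∫ y in Metric.ball 0 ρ, arcsinJacobian y * Ψ (arcsinMap y) := by
  rw [← image_arcsinMap_ball hρ0 hρ,
    integral_image_eq_integral_abs_det_fderiv_smul volume measurableSet_ball
      (fun y hy => (hasFDerivAt_arcsinMap (abs_coord_lt hρ hy)).hasFDerivWithinAt)
      (injOn_arcsinMap hρ)]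
  refine setIntegral_congr_fun measurableSet_ball fun y _ => ?_
  have h0 : 0 ≤ arcsinJacobian y := Finset.prod_nonneg fun i _ => by positivity
  simp only [det_arcsinDeriv, abs_of_nonneg h0, smul_eq_mul]

theorem continuousOn_arcsinJacobian {d : ℕ} {ρ : ℝ} (hρ : ρ < 2) :
    ContinuousOn (arcsinJacobian : Momentum d → ℝ) (Metric.closedBall 0 ρ) := by
  unfold arcsinJacobian
  refine continuousOn_finsetProd _ fun i _ => ?_
  refine ContinuousOn.div continuousOn_const (by fun_prop) fun y hy => ?_
  have hy' : y ∈ Metric.ball (0 : Momentum d) 2 := Metric.closedBall_subset_ball hρ hy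
  have := abs_coord_lt le_rfl hy' i
  refine (Real.sqrt_pos.2 ?_).ne'
  have := (sq_lt_one_iff_abs_lt_one _).2 this
  linarith

theorem continuous_arcsinMap {d : ℕ} : Continuous (arcsinMap : Momentum d → Momentum d) := by
  unfold arcsinMap
  refine (PiLp.continuous_toLp 2 _).comp (continuous_pi fun i => ?_)
  refine continuous_const.mul (Real.continuous_arcsin.comp ?_)
  fun_prop

theorem analyticAt_arcsinMap {d : ℕ} : AnalyticAt ℝ (arcsinMap : Momentum d → Momentum d) 0 := by
  have : ContDiffAt ℝ ⊤ (arcsinMap : Momentum d → Momentum d) 0 := by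
    rw [contDiffAt_euclidean]
    intro i
    have h1 : ContDiffAt ℝ ⊤ (fun x : Momentum d => x i / 2) 0 := by fun_prop
    have h2 : ContDiffAt ℝ ⊤ Real.arcsin ((fun x : Momentum d => x i / 2) 0) :=
      Real.contDiffAt_arcsin (by simp) (by simp)
    exact contDiffAt_const.mul (ContDiffAt.comp (g := Real.arcsin) 0 h2 h1)
  exact this.analyticAt

theorem analyticAt_arcsinJacobian {d : ℕ} : AnalyticAt ℝ (arcsinJacobian : Momentum d → ℝ) 0 := by
  have : ContDiffAt ℝ ⊤ (arcsinJacobian : Momentum d → ℝ) 0 := by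
    unfold arcsinJacobian
    refine contDiffAt_prod fun i _ => ?_
    have h1 : ContDiffAt ℝ ⊤ (fun x : Momentum d => 1 - (x i / 2) ^ 2) 0 := by fun_prop
    exact contDiffAt_const.div (h1.sqrt (by simp)) (by simp)
  exact this.analyticAt

theorem arcsinMap_neg {d : ℕ} (y : Momentum d) : arcsinMap (-y) = -arcsinMap y := by
  ext i
  simp [arcsinMap, neg_div, Real.arcsin_neg]

theorem arcsinMap_zero {d : ℕ} : arcsinMap (0 : Momentum d) = 0 := by
  ext i
  simp [arcsinMap]

theorem arcsinJacobian_neg {d : ℕ} (y : Momentum d) : arcsinJacobian (-y) = arcsinJacobian y := by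
  simp [arcsinJacobian, neg_div]

theorem arcsinJacobian_zero {d : ℕ} : arcsinJacobian (0 : Momentum d) = 1 := by
  simp [arcsinJacobian]

/-- The derivative of `arcsinMap` at the origin is the identity, so leading Taylor forms are
unchanged by the substitution. -/
theorem tendsto_arcsinMap_smul {d : ℕ} (w : Momentum d) :
    Tendsto (fun r : ℝ => r⁻¹ • arcsinMap (r • w)) (𝓝[>] 0) (𝓝 w) := by
  have h0 : HasFDerivAt arcsinMap (arcsinDeriv (0 : Momentum d)) 0 :=
    hasFDerivAt_arcsinMap (by simp)
  have h1 : HasDerivAt (fun r : ℝ => r • w) w 0 := by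
    simpa using (hasDerivAt_id (0 : ℝ)).smul_const w
  have h0' : HasFDerivAt arcsinMap (arcsinDeriv (0 : Momentum d)) ((0 : ℝ) • w) := by
    simpa using h0
  have h2 := h0'.comp_hasDerivAt (0 : ℝ) h1
  have h3 : arcsinDeriv (0 : Momentum d) w = w := by
    ext i
    simp [arcsinDeriv]
  rw [h3] at h2
  have := h2.tendsto_slope_zero_right
  simpa [arcsinMap_zero] using this

/-- The singular expansion of the integral near the maximum of the dispersion relation. -/
theorem exists_inner_expansion {d : ℕ} (hd : 1 ≤ d) {g : Momentum d → ℝ} {x : Momentum d}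
    {P : FormalMultilinearSeries ℝ (Momentum d) ℝ} (hP : HasFPowerSeriesAt g P x)
    (hg : Continuous g) (heven : ∀ q, g (x - q) = g (x + q)) {n e m : ℕ} (he : e = 0 ∨ e = 1)
    (hdm : d - 1 = e + 2 * m) (hPn : ∀ j < 2 * n, ∀ y, (P j fun _ => y) = 0) :
    ∃ ρ > 0, ρ < 2 ∧ ∃ A B : ℝ → ℝ, AnalyticAt ℝ A 0 ∧ AnalyticAt ℝ B 0 ∧
      B 0 = (-2) ^ (n + m) * (∫ w : Metric.sphere (0 : Momentum d) 1,
        P (2 * n) (fun _ => (w : Momentum d)) ∂(volume : Measure (Momentum d)).toSphere) *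
          (if e = 0 then (Real.sqrt 2)⁻¹ else 1) ∧
      ∀ᶠ κ in 𝓝[>] (0 : ℝ),
        ∫ q in {q | q ∈ cube d ∧ energy q < ρ ^ 2 / 2}, g (x + q) / (energy q + κ) =
          A κ + κ ^ (n + m) * B κ * singular e κ := by
  set σ := (volume : Measure (Momentum d)).toSphere with hσ
  -- `G` is the density in the new coordinates, Jacobian included.
  let G : Momentum d → ℝ := fun y => arcsinJacobian y * g (x + arcsinMap y)
  have hGan : AnalyticAt ℝ G 0 := by
    refine analyticAt_arcsinJacobian.mul ?_
    refine AnalyticAt.fun_comp (f := fun y : Momentum d => x + arcsinMap y) ?_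
      (analyticAt_const.add analyticAt_arcsinMap)
    rw [arcsinMap_zero, add_zero]
    exact hP.analyticAt
  obtain ⟨p, hp⟩ := hGan
  have hGeven : ∀ y, G (-y) = G y := by
    intro y
    simp only [G, arcsinMap_neg, arcsinJacobian_neg, ← sub_eq_add_neg, heven]
  obtain ⟨ρ₀, hρ₀, hsum, hray, hmean⟩ := exists_sphere_series hp hGeven
  set c : ℕ → ℝ := fun j => ∫ w : Metric.sphere (0 : Momentum d) 1,
    p (2 * j) (fun _ => (w : Momentum d)) ∂σ with hc
  -- Because the Jacobian is `1` at the origin and the map is tangent to the identity, `G` has the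
  -- same lowest-order form as `g`; only its values on rays are needed.
  have hlead : ∀ w : Metric.sphere (0 : Momentum d) 1,
      (∀ j < 2 * n, (p j fun _ => (w : Momentum d)) = 0) ∧
        (p (2 * n) fun _ => (w : Momentum d)) = P (2 * n) fun _ => (w : Momentum d) := by
    intro w
    have hpow : ∀ (r : ℝ) (j : ℕ), (p j fun _ => r • (w : Momentum d)) =
        (p j fun _ => (w : Momentum d)) * r ^ j := by
      intro r j
      have := (p j).map_smul_univ (fun _ => r) fun _ => (w : Momentum d)
      simpa [mul_comm] using this
    refine coeff_of_tendsto_div_pow hρ₀ ?_ ?_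
    · refine (hray (ρ₀ • (w : Momentum d)) (by simp [norm_smul, abs_of_pos hρ₀])).congr fun j => ?_
      rw [hpow, abs_mul, abs_of_pos (pow_pos hρ₀ j)]
    · have h1 := tendsto_div_pow_of_hasFPowerSeriesAt hP hPn (tendsto_arcsinMap_smul (w : Momentum d))
      have h2 : Tendsto (fun r : ℝ => arcsinJacobian (r • (w : Momentum d))) (𝓝[>] 0) (𝓝 1) := by
        have ha : ContinuousAt (arcsinJacobian : Momentum d → ℝ) ((0 : ℝ) • (w : Momentum d)) := by
          rw [zero_smul]; exact analyticAt_arcsinJacobian.continuousAt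
        have hb : ContinuousAt (fun r : ℝ => r • (w : Momentum d)) 0 := by fun_prop
        have := (ContinuousAt.comp (f := fun r : ℝ => r • (w : Momentum d)) ha hb).tendsto
        simp only [Function.comp_def, zero_smul, arcsinJacobian_zero] at this
        exact this.mono_left nhdsWithin_le_nhds
      have h3 := h2.mul h1
      rw [one_mul] at h3
      refine h3.congr' ?_
      obtain ⟨R, hR⟩ := hp
      have hev : ∀ᶠ r : ℝ in 𝓝[>] 0, r • (w : Momentum d) ∈ Metric.eball (0 : Momentum d) R := by
        have hb : ContinuousAt (fun r : ℝ => r • (w : Momentum d)) 0 := by fun_prop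
        refine (hb.eventually_mem ?_).filter_mono nhdsWithin_le_nhds
        simpa using Metric.eball_mem_nhds (0 : Momentum d) hR.r_pos
      filter_upwards [hev] with r hr
      have := (hR.hasSum hr).tsum_eq
      simp only [hpow, zero_add] at this
      rw [this]
      simp only [G]
      ring
  -- Any bound below `2` would do in place of `1`: it keeps every `|yᵢ/2|` away from the singularity
  -- of the arcsine.
  set ρ := min ρ₀ 1 with hρ
  have hρ0 : 0 < ρ := lt_min hρ₀ one_pos
  have hρ2 : ρ < 2 := (min_le_right _ _).trans_lt (by norm_num)
  have hρρ : ρ ≤ ρ₀ := min_le_left _ _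
  -- Since `r^(d-1) = r^e (r²)^m`, the factor `(r²)^m` is absorbed by shifting the coefficients by
  -- `m`. The first possibly nonzero index is then `n + m`.
  let c' : ℕ → ℝ := fun j => if j < m then 0 else c (j - m)
  have hc'add : ∀ j, c' (j + m) = c j := by intro j; simp [c']
  have hcsum : Summable fun j => |c j| * (ρ ^ 2) ^ j := by
    refine Summable.of_nonneg_of_le (fun j => by positivity) (fun j => ?_) hsum
    gcongr
  have hc'sum : Summable fun j => |c' j| * (ρ ^ 2) ^ j := by
    rw [← summable_nat_add_iff m]
    simp only [hc'add, pow_add, ← mul_assoc]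
    exact hcsum.mul_right _
  have hc'vanish : ∀ j < n + m, c' j = 0 := by
    intro j hj
    simp only [c']
    split_ifs with h
    · rfl
    · simp only [hc]
      rw [integral_eq_zero_of_ae]
      filter_upwards with w
      exact (hlead w).1 _ (by omega)
  have hc'n : c' (n + m) = ∫ w : Metric.sphere (0 : Momentum d) 1,
      P (2 * n) (fun _ => (w : Momentum d)) ∂σ := by
    rw [hc'add]
    exact integral_congr_ae (ae_of_all _ fun w => (hlead w).2)
  obtain ⟨A, B, hA, hB, hB0, hAB⟩ := exists_radial_expansion hρ0 hc'sum he hc'vanish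
  refine ⟨ρ, hρ0, hρ2, A, B, hA, hB, by rw [hB0, hc'n], ?_⟩
  filter_upwards [hAB, self_mem_nhdsWithin] with κ hκ hκ0
  have hκ0' : (0 : ℝ) < κ := hκ0
  rw [← hκ, setIntegral_energy_lt hρ0 hρ2.le]
  have h1 : ∫ y in Metric.ball 0 ρ, arcsinJacobian y * (g (x + arcsinMap y) / (energy (arcsinMap y) + κ))
      = ∫ y in Metric.ball 0 ρ, G y / (‖y‖ ^ 2 / 2 + κ) := by
    refine setIntegral_congr_fun measurableSet_ball fun y hy => ?_
    simp only [energy_arcsinMap (abs_coord_lt hρ2.le hy), G]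
    ring
  rw [h1, integral_ball_eq_polar hd]
  · refine setIntegral_congr_fun measurableSet_Ioo fun r hr => ?_
    have hr0 : 0 < r := hr.1
    simp only [norm_smul, Real.norm_eq_abs, abs_of_pos hr0, norm_eq_of_mem_sphere, mul_one]
    rw [integral_div, hmean r hr0 (hr.2.le.trans hρρ)]
    have h2 : (∑' j, c' j * (r ^ 2) ^ j) = (r ^ 2) ^ m * ∑' j, c j * (r ^ 2) ^ j := by
      rw [← tsum_mul_left, ← Summable.sum_add_tsum_nat_add m
        (f := fun j => c' j * (r ^ 2) ^ j), Finset.sum_eq_zero, zero_add]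
      · refine tsum_congr fun j => ?_
        rw [hc'add, pow_add]; ring
      · intro j hj
        simp [c', Finset.mem_range.1 hj]
      · refine Summable.of_norm_bounded hc'sum fun j => ?_
        rw [norm_mul, Real.norm_eq_abs, norm_pow, Real.norm_eq_abs, abs_of_nonneg (sq_nonneg r)]
        have := hr.2.le
        gcongr
    rw [h2, hdm, pow_add, pow_mul]
    ring
  · refine IntegrableOn.mono_set ?_ Metric.ball_subset_closedBall
    refine ContinuousOn.integrableOn_compact (isCompact_closedBall _ _) ?_
    refine ContinuousOn.div ?_ (by fun_prop) fun y _ => by positivity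
    refine (continuousOn_arcsinJacobian hρ2).mul ?_
    exact (hg.comp (continuous_const.add continuous_arcsinMap)).continuousOn

end DiscreteBilaplacian
end

noncomputable section
namespace DiscreteBilaplacian

open Filter Topology

/-! ### Translating the torus to its maximum point -/

/-- Translation by `π` on the circle `(-π, π]`. -/
def halfTurn (x : ℝ) : ℝ := if x ≤ 0 then x + Real.pi else x - Real.pi

theorem measurable_halfTurn : Measurable halfTurn :=
  Measurable.ite measurableSet_Iic (measurable_id.add_const _) (measurable_id.sub_const _)

/-- The map exchanges the two halves of the interval, each by a translation. -/
theorem measurePreserving_halfTurn :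
    MeasurePreserving halfTurn (volume.restrict (Set.Ioc (-Real.pi) Real.pi))
      (volume.restrict (Set.Ioc (-Real.pi) Real.pi)) := by
  refine ⟨measurable_halfTurn, ?_⟩
  ext A hA
  have hpi := Real.pi_pos
  rw [Measure.map_apply measurable_halfTurn hA, Measure.restrict_apply (measurable_halfTurn hA),
    Measure.restrict_apply hA]
  have h1 : halfTurn ⁻¹' A ∩ Set.Ioc (-Real.pi) Real.pi =
      (fun x => x + Real.pi) ⁻¹' (A ∩ Set.Ioc 0 Real.pi) ∪
        (fun x => x + -Real.pi) ⁻¹' (A ∩ Set.Ioc (-Real.pi) 0) := by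
    ext x
    simp only [halfTurn, Set.mem_inter_iff, Set.mem_preimage, Set.mem_Ioc, Set.mem_union,
      ← sub_eq_add_neg]
    constructor
    · rintro ⟨h, h1, h2⟩
      split_ifs at h with hx
      · exact Or.inl ⟨h, by linarith, by linarith⟩
      · exact Or.inr ⟨h, by linarith, by linarith⟩
    · rintro (⟨h, h1, h2⟩ | ⟨h, h1, h2⟩)
      · rw [if_pos (by linarith)]
        exact ⟨h, by linarith, by linarith⟩
      · rw [if_neg (by linarith)]
        exact ⟨h, by linarith, by linarith⟩
  have h2 : A ∩ Set.Ioc (-Real.pi) Real.pi =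
      A ∩ Set.Ioc 0 Real.pi ∪ A ∩ Set.Ioc (-Real.pi) 0 := by
    rw [← Set.inter_union_distrib_left, Set.union_comm, Set.Ioc_union_Ioc_eq_Ioc] <;> linarith
  have hd : Disjoint (A ∩ Set.Ioc 0 Real.pi) (A ∩ Set.Ioc (-Real.pi) 0) := by
    rw [Set.disjoint_left]
    rintro x ⟨_, h1⟩ ⟨_, h2⟩
    exact absurd h1.1 (not_lt.2 h2.2)
  have hm1 : MeasurableSet (A ∩ Set.Ioc (-Real.pi) 0) := hA.inter measurableSet_Ioc
  rw [h1, h2, measure_union hd hm1, measure_union ?_ (hm1.preimage (by fun_prop)),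
    measure_preimage_add_right, measure_preimage_add_right]
  rw [Set.disjoint_left]
  rintro x ⟨_, h1⟩ ⟨_, h2⟩
  have := h1.2
  have := h2.1
  linarith

/-- Translation by `(π, …, π)` on the torus. -/
def torusTurn {d : ℕ} (p : Momentum d) : Momentum d := WithLp.toLp 2 fun i => halfTurn (p i)

theorem torusMeasure_eq (d : ℕ) : torusMeasure d = volume.restrict (cube d) := rfl

theorem measurePreserving_torusTurn (d : ℕ) :
    MeasurePreserving (torusTurn : Momentum d → Momentum d) (torusMeasure d) (torusMeasure d) := by
  set I : Set ℝ := Set.Ioc (-Real.pi) Real.pi with hI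
  have hpre : (WithLp.ofLp : Momentum d → Fin d → ℝ) ⁻¹' (Set.univ.pi fun _ => I) = cube d := by
    ext p; simp [cube, I]
  have hms : MeasurableSet (Set.univ.pi fun _ : Fin d => I) :=
    MeasurableSet.univ_pi fun _ => measurableSet_Ioc
  have hrestr : (volume : Measure (Fin d → ℝ)).restrict (Set.univ.pi fun _ => I) =
      Measure.pi fun _ => volume.restrict I := by
    rw [volume_pi, Measure.restrict_pi_pi]
  have h1 : MeasurePreserving (WithLp.ofLp : Momentum d → Fin d → ℝ) (torusMeasure d)
      (Measure.pi fun _ => volume.restrict I) := by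
    have := (PiLp.volume_preserving_ofLp (Fin d)).restrict_preimage hms
    rwa [hpre, hrestr] at this
  have h3 : MeasurePreserving (WithLp.toLp 2 : (Fin d → ℝ) → Momentum d)
      (Measure.pi fun _ => volume.restrict I) (torusMeasure d) := by
    have := (PiLp.volume_preserving_toLp (Fin d)).restrict_preimage (measurableSet_cube d)
    have hpre' : (WithLp.toLp 2 : (Fin d → ℝ) → Momentum d) ⁻¹' cube d =
        Set.univ.pi fun _ => I := by
      ext p; simp [cube, I]
    rw [hpre', hrestr] at this
    exact this
  have h2 := measurePreserving_pi (fun _ : Fin d => volume.restrict I) (fun _ => volume.restrict I)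
    (f := fun _ => halfTurn) fun _ => measurePreserving_halfTurn
  exact h3.comp (h2.comp h1)

/-- The maximum `(π, …, π)` is a corner of the fundamental cube; this translation moves it to the
interior, so that a full neighbourhood is seen. -/
theorem integral_torus_eq {d : ℕ} {Φ : Momentum d → ℝ} (hΦ : Measurable Φ)
    (hper : ∀ p q : Momentum d, (∀ i, ∃ k : ℤ, p i = q i + k * (2 * Real.pi)) → Φ p = Φ q) :
    ∫ p, Φ p ∂(torusMeasure d) = ∫ q in cube d, Φ (piVec d + q) := by
  have mp := measurePreserving_torusTurn d
  have h := integral_map (μ := torusMeasure d) mp.measurable.aemeasurable hΦ.aestronglyMeasurable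
  rw [mp.map_eq] at h
  rw [h, torusMeasure_eq]
  refine integral_congr_ae (ae_of_all _ fun q => hper _ _ fun i => ?_)
  simp only [torusTurn, halfTurn, piVec, PiLp.add_apply]
  split_ifs
  · exact ⟨0, by simp [add_comm]⟩
  · exact ⟨-1, by push_cast; ring⟩

/-! ### The dispersion relation -/

theorem dispersion_le {d : ℕ} (p : Momentum d) : dispersion p ≤ 4 * (d : ℝ) ^ 2 := by
  have h1 := energy_le p
  have h2 := energy_nonneg p
  have h3 : dispersion p = energy p ^ 2 := rfl
  rw [h3]
  nlinarith

theorem continuous_dispersion {d : ℕ} : Continuous (dispersion : Momentum d → ℝ) := by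
  unfold dispersion
  fun_prop

/-- After translation the Laplacian symbol is `2d - E`, and `4d² - (2d - E)²` factors. Only the
factor `E` vanishes at the maximum, while `4d - E` stays at least `2d`. -/
theorem gap_pi_add {d : ℕ} (q : Momentum d) :
    4 * (d : ℝ) ^ 2 - dispersion (piVec d + q) = energy q * (4 * d - energy q) := by
  have h : ∑ i, (1 - Real.cos ((piVec d + q) i)) = 2 * d - energy q := by
    have : ∀ i, 1 - Real.cos ((piVec d + q) i) = 2 - (1 - Real.cos (q i)) := by
      intro i
      simp only [piVec, PiLp.add_apply]
      rw [add_comm, Real.cos_add_pi]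
      ring
    rw [Finset.sum_congr rfl fun i _ => this i, Finset.sum_sub_distrib]
    simp [energy, mul_comm]
  rw [dispersion, h]
  ring

theorem dispersion_periodic {d : ℕ} {p q : Momentum d}
    (h : ∀ i, ∃ k : ℤ, p i = q i + k * (2 * Real.pi)) : dispersion p = dispersion q := by
  unfold dispersion
  congr 1
  refine Finset.sum_congr rfl fun i _ => ?_
  obtain ⟨k, hk⟩ := h i
  rw [hk, Real.cos_add_int_mul_two_pi]

instance isFiniteMeasure_torusMeasure (d : ℕ) : IsFiniteMeasure (torusMeasure d) := by
  have h : cube d ⊆ Metric.closedBall 0 (Real.sqrt (∑ _i : Fin d, Real.pi ^ 2)) := by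
    intro p hp
    rw [mem_closedBall_zero_iff, EuclideanSpace.norm_eq]
    refine Real.sqrt_le_sqrt (Finset.sum_le_sum fun i _ => ?_)
    rw [Real.norm_eq_abs, sq_abs]
    exact sq_le_sq' (hp i).1.le (hp i).2
  refine ⟨?_⟩
  rw [torusMeasure_eq, Measure.restrict_apply_univ]
  exact (measure_mono h).trans_lt measure_closedBall_lt_top

/-! ### The resolvent integral -/

/-- The integral `∫ |v|² / (4d² - 𝔢 + x)`. -/
def resolventIntegral {d : ℕ} (vhat : Lattice d → ℝ) (x : ℝ) : ℝ :=
  ∫ p, ‖fourierV vhat p‖ ^ 2 / (4 * (d : ℝ) ^ 2 - dispersion p + x) ∂(torusMeasure d)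

/-- The model singularity changes under an analytic rescaling of its variable by a factor (inverse
square root) or by an analytic summand (logarithm). This is needed to pass from `κ` back to the
spectral parameter `x`. -/
theorem singular_mul {e : ℕ} (he : e = 0 ∨ e = 1) {c : ℝ → ℝ} (hc : AnalyticAt ℝ c 0) (hc0 : 0 < c 0) :
    ∃ a b : ℝ → ℝ, AnalyticAt ℝ a 0 ∧ AnalyticAt ℝ b 0 ∧
      a 0 = (if e = 0 then (Real.sqrt (c 0))⁻¹ else 1) ∧
      ∀ᶠ x in 𝓝[>] (0 : ℝ), singular e (x * c x) = a x * singular e x + b x := by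
  have hpos : ∀ᶠ x in 𝓝[>] (0 : ℝ), 0 < c x :=
    (hc.continuousAt.eventually (lt_mem_nhds hc0)).filter_mono nhdsWithin_le_nhds
  rcases he with rfl | rfl
  · refine ⟨fun x => (Real.sqrt (c x))⁻¹, fun _ => 0, ?_, analyticAt_const, by simp, ?_⟩
    · refine AnalyticAt.inv ?_ (Real.sqrt_pos.2 hc0).ne'
      have h1 : AnalyticAt ℝ (fun x => Real.exp (Real.log (c x) / 2)) 0 :=
        ((hc.log hc0).div_const).rexp'
      refine h1.congr ?_
      filter_upwards [hc.continuousAt.eventually (lt_mem_nhds hc0)] with x hx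
      rw [Real.exp_half, Real.exp_log hx]
    · filter_upwards [hpos, self_mem_nhdsWithin] with x hx hx0
      have hx0' : (0 : ℝ) < x := hx0
      simp only [singular, if_true]
      rw [Real.sqrt_mul hx0'.le]
      field_simp
      ring
  · refine ⟨fun _ => 1, fun x => -Real.log (c x), analyticAt_const, (hc.log hc0).neg, by simp, ?_⟩
    filter_upwards [hpos, self_mem_nhdsWithin] with x hx hx0
    have hx0' : (0 : ℝ) < x := hx0
    simp only [singular]
    rw [Real.log_mul hx0'.ne' hx.ne']
    simp
    ring

theorem analyticAt_sqrt_of_pos {f : ℝ → ℝ} {x : ℝ} (hf : AnalyticAt ℝ f x) (h0 : 0 < f x) :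
    AnalyticAt ℝ (fun x => Real.sqrt (f x)) x := by
  have h1 : AnalyticAt ℝ (fun x => Real.exp (Real.log (f x) / 2)) x :=
    ((hf.log h0).div_const).rexp'
  refine h1.congr ?_
  filter_upwards [hf.continuousAt.eventually (lt_mem_nhds h0)] with x hx
  rw [Real.exp_half, Real.exp_log hx]

/-- The singular part comes from a small sublevel set of `E`; the rest of the cube and the partial
fraction with `4d - E` are analytic in `κ`. The variable `κ` is then the root `k(x)` of `κ(4d + κ) =
x` with `k(0) = 0`. -/
theorem exists_resolvent_expansion_aux {d : ℕ} (hd : 1 ≤ d) {vhat : Lattice d → ℝ}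
    (hv : ExpDecay vhat) {P : FormalMultilinearSeries ℝ (Momentum d) ℝ}
    (hP : HasFPowerSeriesAt (fun p => ‖fourierV vhat p‖ ^ 2) P (piVec d))
    {n e m : ℕ} (he : e = 0 ∨ e = 1)
    (hdm : d - 1 = e + 2 * m) (hPn : ∀ j < 2 * n, ∀ y, (P j fun _ => y) = 0) :
    ∃ A B : ℝ → ℝ, AnalyticAt ℝ A 0 ∧ AnalyticAt ℝ B 0 ∧
      B 0 = (4 * (d : ℝ))⁻¹ * ((4 * (d : ℝ))⁻¹) ^ (n + m) *
        ((-2) ^ (n + m) * (∫ w : Metric.sphere (0 : Momentum d) 1,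
        P (2 * n) (fun _ => (w : Momentum d)) ∂(volume : Measure (Momentum d)).toSphere) *
          (if e = 0 then (Real.sqrt 2)⁻¹ else 1)) *
          (if e = 0 then (Real.sqrt (4 * (d : ℝ))⁻¹)⁻¹ else 1) ∧
      ∀ᶠ x in 𝓝[>] (0 : ℝ), resolventIntegral vhat x = A x + x ^ (n + m) * B x * singular e x := by
  have hd0 : (0 : ℝ) < d := by exact_mod_cast hd
  set g : Momentum d → ℝ := fun p => ‖fourierV vhat p‖ ^ 2 with hg
  have hgc : Continuous g := (continuous_fourierV hv).norm.pow 2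
  obtain ⟨K, hK⟩ := exists_norm_fourierV_le hv
  have heven : ∀ q, g (piVec d - q) = g (piVec d + q) := fun q => by
    simp only [hg, norm_fourierV_pi_neg]
  obtain ⟨ρ, hρ0, hρ2, A1, B1, hA1, hB1, hB10, hin⟩ :=
    exists_inner_expansion hd hP hgc heven he hdm hPn
  have hfin : IsFiniteMeasure (volume.restrict (cube d)) := isFiniteMeasure_torusMeasure d
  have hgsh : Continuous fun q => g (piVec d + q) := by fun_prop
  have hgint : IntegrableOn (fun q => g (piVec d + q)) (cube d) := by
    refine Integrable.of_bound hgsh.aestronglyMeasurable (K ^ 2) (ae_of_all _ fun q => ?_)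
    rw [Real.norm_eq_abs, abs_of_nonneg (sq_nonneg _)]
    exact pow_le_pow_left₀ (norm_nonneg _) (hK _) 2
  -- the part of the integral away from the maximum
  set O : Set (Momentum d) := {q | q ∈ cube d ∧ ¬ energy q < ρ ^ 2 / 2} with hO
  have hEm : MeasurableSet {q : Momentum d | energy q < ρ ^ 2 / 2} :=
    measurableSet_lt continuous_energy.measurable measurable_const
  have hOm : MeasurableSet O := (measurableSet_cube d).inter hEm.compl
  have hA2 : AnalyticAt ℝ (fun κ => ∫ q in O, g (piVec d + q) / (energy q + κ)) 0 := by
    refine analyticAt_integral_div_add (c := ρ ^ 2 / 2) (by positivity)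
      (hgint.mono_set fun q hq => hq.1) continuous_energy.aestronglyMeasurable ?_
    filter_upwards [ae_restrict_mem hOm] with q hq using not_lt.1 hq.2
  have hA3 : AnalyticAt ℝ (fun κ => ∫ q in cube d, g (piVec d + q) / ((4 * d - energy q) + κ)) 0 := by
    refine analyticAt_integral_div_add (c := 2 * d) (by positivity) hgint
      (continuous_const.sub continuous_energy).aestronglyMeasurable (ae_of_all _ fun q => ?_)
    linarith [energy_le q]
  set A4 : ℝ → ℝ := fun κ => A1 κ + (∫ q in O, g (piVec d + q) / (energy q + κ)) +
    ∫ q in cube d, g (piVec d + q) / ((4 * d - energy q) + κ) with hA4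
  have hA4an : AnalyticAt ℝ A4 0 := (hA1.add hA2).add hA3
  -- the change of spectral parameter
  set k : ℝ → ℝ := fun x => Real.sqrt (4 * (d : ℝ) ^ 2 + x) - 2 * d with hk
  have hsq0 : Real.sqrt (4 * (d : ℝ) ^ 2) = 2 * d := by
    rw [show 4 * (d : ℝ) ^ 2 = (2 * d) ^ 2 by ring, Real.sqrt_sq (by positivity)]
  have hk0 : k 0 = 0 := by simp [hk, hsq0]
  have hkan : AnalyticAt ℝ k 0 := by
    refine AnalyticAt.sub ?_ analyticAt_const
    exact analyticAt_sqrt_of_pos (by fun_prop) (by positivity)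
  have hcomp : ∀ {f : ℝ → ℝ}, AnalyticAt ℝ f 0 → AnalyticAt ℝ (fun x => f (k x)) 0 := by
    intro f hf
    exact AnalyticAt.fun_comp (f := k) (by rwa [hk0]) hkan
  have hkmul : ∀ x, 0 < x → 0 < k x ∧ k x * (4 * d + k x) = x := by
    intro x hx
    have h1 : Real.sqrt (4 * (d : ℝ) ^ 2 + x) ^ 2 = 4 * (d : ℝ) ^ 2 + x := Real.sq_sqrt (by positivity)
    refine ⟨?_, ?_⟩
    · have : 2 * (d : ℝ) < Real.sqrt (4 * (d : ℝ) ^ 2 + x) := by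
        rw [← hsq0]; exact Real.sqrt_lt_sqrt (by positivity) (by linarith)
      simp only [hk]; linarith
    · simp only [hk]; linarith [h1]
  -- From `k(4d + k) = x` one gets `k(x) = x c(x)` with `c(0) = 1/(4d)`, the form required by
  -- `singular_mul`.
  set c : ℝ → ℝ := fun x => (4 * d + k x)⁻¹ with hc
  have hc0 : c 0 = (4 * (d : ℝ))⁻¹ := by simp [hc, hk0]
  have hcan : AnalyticAt ℝ c 0 :=
    (analyticAt_const.add hkan).inv (by show 4 * (d : ℝ) + k 0 ≠ 0; rw [hk0]; positivity)
  obtain ⟨a, b, ha, hb, ha0, hab⟩ := singular_mul he hcan (by rw [hc0]; positivity)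
  set u : ℝ → ℝ := fun x => (4 * d + 2 * k x)⁻¹ with hu
  have huan : AnalyticAt ℝ u 0 :=
    (analyticAt_const.add (analyticAt_const.mul hkan)).inv
      (by show 4 * (d : ℝ) + 2 * k 0 ≠ 0; rw [hk0]; positivity)
  have hktend : Tendsto k (𝓝[>] 0) (𝓝[>] 0) := by
    refine tendsto_nhdsWithin_iff.2 ⟨?_, ?_⟩
    · have := hkan.continuousAt.tendsto
      rw [hk0] at this
      exact this.mono_left nhdsWithin_le_nhds
    · filter_upwards [self_mem_nhdsWithin] with x hx using (hkmul x hx).1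
  have hB1k := hcomp hB1
  have hA4k := hcomp hA4an
  -- The factor `u = 1/(4d + 2k)` comes from the partial fractions. Substituting `k = x c` turns
  -- `k^(n+m)` into `x^(n+m) c^(n+m)`, and the singularity into `a s + b`, whose analytic part `b`
  -- joins `A`.
  refine ⟨fun x => u x * (A4 (k x) + x ^ (n + m) * c x ^ (n + m) * B1 (k x) * b x),
    fun x => u x * c x ^ (n + m) * B1 (k x) * a x, 
    huan.mul (hA4k.add ((((analyticAt_id.pow _).mul (hcan.pow _)).mul hB1k).mul hb)),
    ((huan.mul (hcan.pow _)).mul hB1k).mul ha, ?_, ?_⟩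
  · have hu0 : u 0 = (4 * (d : ℝ))⁻¹ := by simp [hu, hk0]
    simp only [hu0, hc0, hk0, ha0, hB10]
  · filter_upwards [hktend.eventually hin, hab, self_mem_nhdsWithin] with x hx hs hx0
    obtain ⟨hkx, hkx2⟩ := hkmul x hx0
    have hx0' : (0 : ℝ) < x := hx0
    have hE2 : ∀ q : Momentum d, 0 < 4 * d - energy q + k x := fun q => by
      linarith [energy_le q]
    have hE1 : ∀ q : Momentum d, 0 < energy q + k x := fun q => by
      linarith [energy_nonneg q]
    have hgap : ∀ p : Momentum d, 0 < 4 * (d : ℝ) ^ 2 - dispersion p + x := fun p => by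
      linarith [dispersion_le p]
    have hi1 : IntegrableOn (fun q => g (piVec d + q) / (energy q + k x)) (cube d) := by
      refine Integrable.of_bound (C := K ^ 2 / k x) ?_ (ae_of_all _ fun q => ?_)
      · exact (hgsh.div (continuous_energy.add continuous_const) fun q => (hE1 q).ne').aestronglyMeasurable
      · rw [Real.norm_eq_abs, abs_div, abs_of_nonneg (sq_nonneg _), abs_of_pos (hE1 q)]
        have := pow_le_pow_left₀ (norm_nonneg _) (hK (piVec d + q)) 2
        gcongr
        linarith [energy_nonneg q]
    have hi2 : IntegrableOn (fun q => g (piVec d + q) / (4 * d - energy q + k x)) (cube d) := by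
      refine Integrable.of_bound (C := K ^ 2 / k x) ?_ (ae_of_all _ fun q => ?_)
      · exact (hgsh.div ((continuous_const.sub continuous_energy).add continuous_const)
          fun q => (hE2 q).ne').aestronglyMeasurable
      · rw [Real.norm_eq_abs, abs_div, abs_of_nonneg (sq_nonneg _), abs_of_pos (hE2 q)]
        have := pow_le_pow_left₀ (norm_nonneg _) (hK (piVec d + q)) 2
        gcongr
        linarith [energy_le q]
    have hsplit : ∫ q in cube d, g (piVec d + q) / (energy q + k x) =
        (∫ q in {q | q ∈ cube d ∧ energy q < ρ ^ 2 / 2}, g (piVec d + q) / (energy q + k x)) +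
          ∫ q in O, g (piVec d + q) / (energy q + k x) :=
      (integral_inter_add_sdiff hEm hi1).symm
    -- The denominator is `E(4d - E) + x = (E + k)(4d - E + k)`, and the two factors add up to the
    -- constant `4d + 2k`.
    have hmain : resolventIntegral vhat x = u x * ((∫ q in cube d, g (piVec d + q) / (energy q + k x)) +
        ∫ q in cube d, g (piVec d + q) / (4 * d - energy q + k x)) := by
      rw [← integral_add hi1 hi2, ← integral_const_mul, resolventIntegral, integral_torus_eq]
      · refine integral_congr_ae (ae_of_all _ fun q => ?_)
        simp only
        rw [gap_pi_add]
        have h1 := (hE1 q).ne'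
        have h2 := (hE2 q).ne'
        have h3 : energy q * (4 * d - energy q) + x = (energy q + k x) * (4 * d - energy q + k x) := by
          linear_combination -hkx2
        have h4 : (4 * (d : ℝ) + 2 * k x) ≠ 0 := by positivity
        rw [h3]
        simp only [hu, hg]
        field_simp
        ring
      · refine Continuous.measurable ?_
        exact hgc.div ((continuous_const.sub continuous_dispersion).add continuous_const)
          fun p => (hgap p).ne'
      · intro p q hpq
        rw [fourierV_periodic vhat hpq, dispersion_periodic hpq]
    have hkc : k x = x * c x := by
      rw [hc, ← div_eq_mul_inv, eq_div_iff (by positivity), hkx2]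
    rw [hmain, hsplit, hx]
    have hs' : singular e (k x) = a x * singular e x + b x := by rw [← hs, ← hkc]
    rw [hs']
    have hpw : k x ^ (n + m) = x ^ (n + m) * c x ^ (n + m) := by rw [← mul_pow, ← hkc]
    rw [hpw]
    simp only [hA4]
    ring

end DiscreteBilaplacian
end

noncomputable section
namespace DiscreteBilaplacian

open Filter Topology

/-! ### The leading form at the maximum -/

/-- A symmetric continuous multilinear map that vanishes on the diagonal is zero. -/
theorem eq_zero_of_symm_of_diag {E : Type*} [NormedAddCommGroup E] [NormedSpace ℝ E] {N : ℕ}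
    (D : ContinuousMultilinearMap ℝ (fun _ : Fin N => E) ℝ)
    (hsymm : ∀ (v : Fin N → E) (σ : Equiv.Perm (Fin N)), (D fun i => v (σ i)) = D v)
    (hdiag : ∀ y, (D fun _ => y) = 0) : D = 0 := by
  -- A formal series consisting of `D` alone represents the zero function. The `N`-th derivative of
  -- that function is the symmetrization `∑_σ D(v ∘ σ) = N! D(v)`, so `D = 0`.
  let q : FormalMultilinearSeries ℝ E ℝ := fun m => if h : m = N then h ▸ D else 0
  have hqN : q N = D := by simp [q]
  have hqm : ∀ m, m ≠ N → q m = 0 := fun m hm => by simp [q, hm]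
  have hq : HasFPowerSeriesOnBall (fun _ : E => (0 : ℝ)) q 0 ⊤ := by
    refine ⟨?_, by simp, fun {y} _ => ?_⟩
    · refine le_of_eq (q.radius_eq_top_of_forall_image_add_eq_zero (N + 1) fun m => ?_).symm
      exact hqm _ (by omega)
    · have : (fun m => q m fun _ => y) = fun _ => 0 := by
        funext m
        by_cases hm : m = N
        · subst hm; rw [hqN, hdiag]
        · rw [hqm m hm]; rfl
      rw [this]
      exact hasSum_zero
  ext v
  have h1 := hq.iteratedFDeriv_eq_sum analyticOn_const (n := N) v
  rw [hqN] at h1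
  simp only [hsymm, Finset.sum_const, Finset.card_univ, Fintype.card_perm, Fintype.card_fin] at h1
  have h2 : iteratedFDeriv ℝ N (fun _ : E => (0 : ℝ)) 0 v = 0 := by
    simp
  rw [h2, nsmul_eq_mul] at h1
  have : (N.factorial : ℝ) ≠ 0 := by exact_mod_cast N.factorial_ne_zero
  simpa [this] using h1.symm

section Leading

variable {d : ℕ} {vhat : Lattice d → ℝ} {P : FormalMultilinearSeries ℝ (Momentum d) ℝ}

theorem diffAtPi_diag (hP : HasFPowerSeriesAt (fun p => ‖fourierV vhat p‖ ^ 2) P (piVec d)) (j : ℕ)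
    (y : Momentum d) :
    (diffAtPi vhat j fun _ => y) = (j.factorial : ℝ) * P j fun _ => y := by
  obtain ⟨r, hr⟩ := hP
  rw [diffAtPi, ← hr.factorial_smul, nsmul_eq_mul]

theorem tendsto_smul_self (w : Momentum d) :
    Tendsto (fun r : ℝ => r⁻¹ • (r • w)) (𝓝[>] 0) (𝓝 w) := by
  refine tendsto_const_nhds.congr' ?_
  filter_upwards [self_mem_nhdsWithin] with r hr
  have hr' : r ≠ 0 := (show (0 : ℝ) < r from hr).ne'
  rw [smul_smul, inv_mul_cancel₀ hr', one_smul]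

/-- Even degrees vanish by the hypothesis. For an odd degree with all lower ones zero, the leading
limits along `y` and `-y` coincide because `|v|²` is even about the maximum, while an odd form
changes sign. -/
theorem coeff_vanish (hP : HasFPowerSeriesAt (fun p => ‖fourierV vhat p‖ ^ 2) P (piVec d)) {n : ℕ}
    (hn : HasVanishingOrder vhat n) : ∀ j < 2 * n, ∀ y, (P j fun _ => y) = 0 := by
  intro j
  induction j using Nat.strong_induction_on with
  | _ j ih =>
    intro hj y
    rcases Nat.even_or_odd' j with ⟨k, rfl | rfl⟩
    · have h1 := diffAtPi_diag hP (2 * k) y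
      rw [hn.1 k (by omega)] at h1
      have : ((2 * k).factorial : ℝ) ≠ 0 := by exact_mod_cast (2 * k).factorial_ne_zero
      simpa [this] using h1.symm
    · have hih : ∀ m < 2 * k + 1, ∀ y, (P m fun _ => y) = 0 := fun m hm => ih m hm (by omega)
      have h1 := tendsto_div_pow_of_hasFPowerSeriesAt hP hih (tendsto_smul_self y)
      have h2 := tendsto_div_pow_of_hasFPowerSeriesAt hP hih (tendsto_smul_self (-y))
      have h3 : (fun r : ℝ => ‖fourierV vhat (piVec d + r • -y)‖ ^ 2 / r ^ (2 * k + 1)) =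
          fun r : ℝ => ‖fourierV vhat (piVec d + r • y)‖ ^ 2 / r ^ (2 * k + 1) := by
        funext r
        rw [smul_neg, ← sub_eq_add_neg, norm_fourierV_pi_neg]
      rw [h3] at h2
      have h4 := tendsto_nhds_unique h1 h2
      have h5 : (P (2 * k + 1) fun _ => -y) = -P (2 * k + 1) fun _ => y := by
        have := (P (2 * k + 1)).map_smul_univ (fun _ => (-1 : ℝ)) fun _ => y
        simpa [pow_succ, pow_mul] using this
      rw [h5] at h4
      linarith

/-- The leading form is a limit of `|v|² / r^(2n) ≥ 0`. -/
theorem coeff_nonneg (hP : HasFPowerSeriesAt (fun p => ‖fourierV vhat p‖ ^ 2) P (piVec d)) {n : ℕ}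
    (hn : HasVanishingOrder vhat n) (y : Momentum d) : 0 ≤ P (2 * n) fun _ => y := by
  refine ge_of_tendsto (tendsto_div_pow_of_hasFPowerSeriesAt hP (coeff_vanish hP hn)
    (tendsto_smul_self y)) ?_
  filter_upwards [self_mem_nhdsWithin] with r hr
  have hr' : (0 : ℝ) < r := hr
  positivity

/-- The leading form is continuous and nonnegative on the sphere. If it vanished there, homogeneity
and polarization would make the whole differential zero. -/
theorem integral_diffAtPi_pos (hd : 1 ≤ d) (hv : ExpDecay vhat) {n : ℕ}
    (hn : HasVanishingOrder vhat n) :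
    0 < ∫ w : Metric.sphere (0 : Momentum d) 1,
      diffAtPi vhat (2 * n) (fun _ => (w : Momentum d)) ∂(volume : Measure (Momentum d)).toSphere := by
  have : Nonempty (Fin d) := ⟨⟨0, hd⟩⟩
  have hgan := analyticAt_normSq_fourierV hv (piVec d)
  obtain ⟨P, hP⟩ := hgan
  have hnn : ∀ y, 0 ≤ diffAtPi vhat (2 * n) fun _ => y := fun y => by
    rw [diffAtPi_diag hP]
    exact mul_nonneg (by positivity) (coeff_nonneg hP hn y)
  have hex : ∃ w : Metric.sphere (0 : Momentum d) 1,
      (diffAtPi vhat (2 * n) fun _ => (w : Momentum d)) ≠ 0 := by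
    by_contra! hcon
    refine hn.2 (eq_zero_of_symm_of_diag _ ?_ fun y => ?_)
    · intro v σ
      exact ContDiffAt.iteratedFDeriv_comp_perm hP.analyticAt.contDiffAt v σ
    · have hall : ∀ y : Momentum d, y ≠ 0 → (diffAtPi vhat (2 * n) fun _ => y) = 0 := by
        intro y hy
        have hy' : ‖y‖ ≠ 0 := norm_ne_zero_iff.2 hy
        have h1 := hcon ⟨‖y‖⁻¹ • y, by simp [norm_smul, hy']⟩
        have h2 := (diffAtPi vhat (2 * n)).map_smul_univ (fun _ => ‖y‖) fun _ => ‖y‖⁻¹ • y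
        simp only [smul_smul, mul_inv_cancel₀ hy', one_smul] at h2
        rw [h2, h1, smul_zero]
      -- At the origin continuity is used: homogeneity gives nothing there when `n = 0`.
      by_cases hy : y = 0
      · subst hy
        obtain ⟨z, hz⟩ := exists_ne (0 : Momentum d)
        have hc : Continuous fun y : Momentum d => diffAtPi vhat (2 * n) fun _ => y :=
          (diffAtPi vhat (2 * n)).cont.comp (by fun_prop)
        have h3 := ((hc.tendsto 0).mono_left (nhdsWithin_le_nhds (s := {0}ᶜ)))
        refine tendsto_nhds_unique h3 (tendsto_const_nhds.congr' ?_)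
        filter_upwards [self_mem_nhdsWithin] with y hy using (hall y hy).symm
      · exact hall y hy
  obtain ⟨w, hw⟩ := hex
  have hc : Continuous fun w : Metric.sphere (0 : Momentum d) 1 =>
      diffAtPi vhat (2 * n) fun _ => (w : Momentum d) :=
    (diffAtPi vhat (2 * n)).cont.comp (by fun_prop)
  exact hc.integral_pos_of_hasCompactSupport_nonneg_nonzero
    (HasCompactSupport.of_compactSpace _) (fun w => hnn w) hw

theorem Cv_pos (hd : 1 ≤ d) (hv : ExpDecay vhat) {n : ℕ} (hn : HasVanishingOrder vhat n) :
    0 < Cv vhat n := by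
  have hd0 : (0 : ℝ) < d := by exact_mod_cast hd
  have := integral_diffAtPi_pos hd hv hn
  unfold Cv
  positivity

end Leading

/-- The singular expansion of the resolvent integral at the top of the spectrum. -/
theorem exists_resolvent_expansion {d : ℕ} (hd : 1 ≤ d) {vhat : Lattice d → ℝ} (hv : ExpDecay vhat)
    {n : ℕ} (hn : HasVanishingOrder vhat n) {k e : ℕ} (he : e = 0 ∨ e = 1)
    (hk : 2 * n + d = 2 * k + 1 + e) (hkn : n ≤ k) :
    ∃ A B : ℝ → ℝ, AnalyticAt ℝ A 0 ∧ AnalyticAt ℝ B 0 ∧ B 0 = (-1) ^ k * Cv vhat n ∧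
      ∀ᶠ x in 𝓝[>] (0 : ℝ), resolventIntegral vhat x = A x + x ^ k * B x * singular e x := by
  obtain ⟨P, hP⟩ := analyticAt_normSq_fourierV hv (piVec d)
  obtain ⟨m, rfl⟩ := Nat.exists_eq_add_of_le hkn
  obtain ⟨A, B, hA, hB, hB0, h⟩ := exists_resolvent_expansion_aux hd hv hP (n := n) (m := m) he
    (by omega) (coeff_vanish hP hn)
  refine ⟨A, B, hA, hB, ?_, h⟩
  have hd0 : (0 : ℝ) < d := by exact_mod_cast hd
  have hfac : ((2 * n).factorial : ℝ) ≠ 0 := by exact_mod_cast (2 * n).factorial_ne_zero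
  rw [hB0, Cv]
  simp only [diffAtPi_diag hP, integral_const_mul]
  set I := ∫ w : Metric.sphere (0 : Momentum d) 1,
        P (2 * n) (fun _ => (w : Momentum d)) ∂(volume : Measure (Momentum d)).toSphere
  have hexp : 2 * n + d - 1 = 2 * (n + m) + e := by omega
  -- The exponent of `8d` in `C_v` is `N/2 = K + (1 + e)/2` with `K = n + m`; its integral part
  -- cancels against `2^(2K)` and leaves `(2d)^(-K)`. The same power arises from `(4d)^(-K) (-2)^K`,
  -- together with the sign `(-1)^K`.
  have hreal : (n : ℝ) + (d : ℝ) / 2 = (n + m : ℕ) + (1 + e : ℝ) / 2 := by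
    have : (2 * n + d : ℝ) = 2 * (n + m : ℕ) + 1 + e := by exact_mod_cast hk
    linarith
  rw [hexp, hreal, Real.rpow_add (by positivity), Real.rpow_natCast]
  set K := n + m
  have h8 : (8 * (d : ℝ)) ^ K = 4 ^ K * (2 * d) ^ K := by rw [← mul_pow]; ring
  have h4 : ((4 * (d : ℝ))⁻¹) ^ K * ((-2) ^ K) = (-1) ^ K * ((2 * (d : ℝ)) ^ K)⁻¹ := by
    rw [← mul_pow, ← inv_pow, ← mul_pow]
    congr 1
    field_simp
    norm_num
  have h2 : (2 : ℝ) ^ (2 * K) = 4 ^ K := by rw [pow_mul]; norm_num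
  rcases he with rfl | rfl
  · have hs : (8 * (d : ℝ)) ^ ((1 + (0 : ℕ) : ℝ) / 2) = Real.sqrt 2 * Real.sqrt (4 * d) := by
      rw [← Real.sqrt_mul (by norm_num), Real.sqrt_eq_rpow]
      norm_num
      ring_nf
    have hs4 : Real.sqrt (4 * (d : ℝ)) * Real.sqrt (4 * (d : ℝ)) = 4 * d :=
      Real.mul_self_sqrt (by positivity)
    have hsp : 0 < Real.sqrt (4 * (d : ℝ)) := Real.sqrt_pos.2 (by positivity)
    rw [hs, h8, add_zero, h2, if_pos rfl, if_pos rfl, Real.sqrt_inv, inv_inv]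
    calc (4 * (d : ℝ))⁻¹ * ((4 * (d : ℝ))⁻¹) ^ K * ((-2) ^ K * I * (Real.sqrt 2)⁻¹) *
          Real.sqrt (4 * (d : ℝ))
        = (((4 * (d : ℝ))⁻¹) ^ K * (-2) ^ K) * I * (Real.sqrt 2)⁻¹ *
          ((4 * (d : ℝ))⁻¹ * Real.sqrt (4 * (d : ℝ))) := by ring
      _ = (-1) ^ K * ((2 * (d : ℝ)) ^ K)⁻¹ * I * (Real.sqrt 2)⁻¹ * (Real.sqrt (4 * (d : ℝ)))⁻¹ := by
          rw [h4]
          congr 1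
          refine eq_inv_of_mul_eq_one_left ?_
          rw [mul_assoc, hs4, inv_mul_cancel₀ (by positivity)]
      _ = _ := by
          field_simp
  · have hs : (8 * (d : ℝ)) ^ ((1 + (1 : ℕ) : ℝ) / 2) = 8 * d := by norm_num
    rw [hs, h8, pow_succ, h2, if_neg one_ne_zero, if_neg one_ne_zero, mul_one, mul_one]
    calc (4 * (d : ℝ))⁻¹ * ((4 * (d : ℝ))⁻¹) ^ K * ((-2) ^ K * I)
        = (((4 * (d : ℝ))⁻¹) ^ K * (-2) ^ K) * I * (4 * (d : ℝ))⁻¹ := by ring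
      _ = (-1) ^ K * ((2 * (d : ℝ)) ^ K)⁻¹ * I * (4 * (d : ℝ))⁻¹ := by rw [h4]
      _ = _ := by
          field_simp
          ring

end DiscreteBilaplacian
end

noncomputable section
namespace DiscreteBilaplacian

open Filter Topology

/-! ### Fourier coefficients on the torus -/

theorem integral_Ioc_exp_int (k : ℤ) :
    ∫ t in Set.Ioc (-Real.pi) Real.pi, Complex.exp (Complex.I * ((k : ℝ) * t : ℝ)) =
      if k = 0 then ((2 * Real.pi : ℝ) : ℂ) else 0 := by
  have hpi := Real.pi_pos
  rw [← intervalIntegral.integral_of_le (by linarith)]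
  split_ifs with hk
  · subst hk
    simp
    ring
  · have hc : Complex.I * (k : ℂ) ≠ 0 := by
      simp [Complex.I_ne_zero, hk]
    have h1 : ∀ t : ℝ, Complex.exp (Complex.I * ((k : ℝ) * t : ℝ)) =
        Complex.exp (Complex.I * (k : ℂ) * t) := by
      intro t; push_cast; ring_nf
    simp only [h1]
    rw [integral_exp_mul_complex hc, div_eq_zero_iff]
    left
    rw [sub_eq_zero, Complex.exp_eq_exp_iff_exists_int]
    refine ⟨k, ?_⟩
    push_cast
    ring

theorem measurePreserving_ofLp_torus (d : ℕ) :
    MeasurePreserving (WithLp.ofLp : Momentum d → Fin d → ℝ) (torusMeasure d)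
      (Measure.pi fun _ => volume.restrict (Set.Ioc (-Real.pi) Real.pi)) := by
  set I : Set ℝ := Set.Ioc (-Real.pi) Real.pi with hI
  have hpre : (WithLp.ofLp : Momentum d → Fin d → ℝ) ⁻¹' (Set.univ.pi fun _ => I) = cube d := by
    ext p; simp [cube, I]
  have hms : MeasurableSet (Set.univ.pi fun _ : Fin d => I) :=
    MeasurableSet.univ_pi fun _ => measurableSet_Ioc
  have hrestr : (volume : Measure (Fin d → ℝ)).restrict (Set.univ.pi fun _ => I) =
      Measure.pi fun _ => volume.restrict I := by
    rw [volume_pi, Measure.restrict_pi_pi]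
  have := (PiLp.volume_preserving_ofLp (Fin d)).restrict_preimage hms
  rwa [hpre, hrestr] at this

theorem integral_exp_phaseForm {d : ℕ} (x : Lattice d) :
    ∫ p, Complex.exp (phaseForm x p) ∂(torusMeasure d) =
      if x = 0 then (((2 * Real.pi) ^ d : ℝ) : ℂ) else 0 := by
  have mp := measurePreserving_ofLp_torus d
  let f : Fin d → ℝ → ℂ := fun i t => Complex.exp (Complex.I * ((x i : ℝ) * t : ℝ))
  have h1 : ∀ p : Momentum d, Complex.exp (phaseForm x p) = ∏ i, f i (WithLp.ofLp p i) := by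
    intro p
    rw [phaseForm_apply, ← Complex.exp_sum]
    congr 1
    push_cast
    rw [Finset.mul_sum]
  have hemb : MeasurableEmbedding (WithLp.ofLp : Momentum d → Fin d → ℝ) :=
    (MeasurableEquiv.toLp 2 (Fin d → ℝ)).symm.measurableEmbedding
  simp only [h1]
  rw [mp.integral_comp hemb (fun y => ∏ i, f i (y i)),
    integral_fintype_prod_eq_prod (𝕜 := ℂ) (E := fun _ => ℝ)
      (μ := fun _ => volume.restrict (Set.Ioc (-Real.pi) Real.pi)) f]
  simp only [f, integral_Ioc_exp_int]
  split_ifs with hx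
  · subst hx
    simp
  · obtain ⟨i, hi⟩ := Function.ne_iff.1 hx
    refine Finset.prod_eq_zero (Finset.mem_univ i) ?_
    exact if_neg hi

/-- The normalization of the Fourier transform. -/
def fourierNorm (d : ℕ) : ℝ := (2 * Real.pi) ^ (-(d : ℝ) / 2)

theorem fourierNorm_pos (d : ℕ) : 0 < fourierNorm d := by
  unfold fourierNorm
  have := Real.pi_pos
  positivity

theorem fourierNorm_sq_mul (d : ℕ) : fourierNorm d * (fourierNorm d * (2 * Real.pi) ^ d) = 1 := by
  have hpi : 0 < 2 * Real.pi := by have := Real.pi_pos; positivity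
  unfold fourierNorm
  rw [← Real.rpow_natCast, ← Real.rpow_add hpi, ← Real.rpow_add hpi]
  ring_nf
  simp

theorem phaseForm_add {d : ℕ} (x y : Lattice d) (p : Momentum d) :
    phaseForm (x + y) p = phaseForm x p + phaseForm y p := by
  simp only [phaseForm_apply, Pi.add_apply, ← mul_add]
  congr 1
  rw [← Complex.ofReal_add, ← Finset.sum_add_distrib]
  congr 2
  funext i
  push_cast
  ring

theorem phaseForm_neg {d : ℕ} (x : Lattice d) (p : Momentum d) :
    phaseForm (-x) p = -phaseForm x p := by
  have := phaseForm_add x (-x) p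
  rw [add_neg_cancel] at this
  have h0 : phaseForm (0 : Lattice d) p = 0 := by simp [phaseForm_apply]
  rw [h0] at this
  exact (neg_eq_of_add_eq_zero_right this.symm).symm

theorem continuous_exp_phaseForm {d : ℕ} (x : Lattice d) :
    Continuous fun p => Complex.exp (phaseForm x p) :=
  Complex.continuous_exp.comp (phaseForm x).continuous

/-- The Fourier coefficients of a function on the torus. -/
def torusCoeff {d : ℕ} (f : Momentum d → ℂ) (x : Lattice d) : ℂ :=
  (fourierNorm d : ℂ) * ∫ p, Complex.exp (phaseForm (-x) p) * f p ∂(torusMeasure d)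

theorem integrable_exp_mul {d : ℕ} {f : Momentum d → ℂ} (hf : Integrable f (torusMeasure d))
    (x : Lattice d) : Integrable (fun p => Complex.exp (phaseForm x p) * f p) (torusMeasure d) :=
  hf.bdd_mul (c := 1) (continuous_exp_phaseForm x).aestronglyMeasurable
    (ae_of_all _ fun p => (norm_exp_phaseForm x p).le)

theorem conj_fourierV {d : ℕ} (vhat : Lattice d → ℝ) (p : Momentum d) :
    (starRingEnd ℂ) (fourierV vhat p) =
      (fourierNorm d : ℂ) * ∑' x, (vhat x : ℂ) * Complex.exp (phaseForm (-x) p) := by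
  rw [← fourierV_neg, fourierV_eq, fourierNorm]
  simp only [phaseForm_neg, map_neg]

/-- Parseval's identity against the generator. -/
theorem hasSum_torusCoeff {d : ℕ} {vhat : Lattice d → ℝ} (hv : ExpDecay vhat) {f : Momentum d → ℂ}
    (hf : Integrable f (torusMeasure d)) :
    HasSum (fun x => (vhat x : ℂ) * torusCoeff f x)
      (∫ p, (starRingEnd ℂ) (fourierV vhat p) * f p ∂(torusMeasure d)) := by
  have h := hasSum_integral_of_summable_integral_norm (μ := torusMeasure d)
    (F := fun (x : Lattice d) p => (vhat x : ℂ) * (Complex.exp (phaseForm (-x) p) * f p))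
    (fun x => (integrable_exp_mul hf _).const_mul _) ?_
  · have h2 := h.mul_left (fourierNorm d : ℂ)
    rw [← integral_const_mul] at h2
    have h3 : ∀ x, (fourierNorm d : ℂ) * ∫ p, (vhat x : ℂ) * (Complex.exp (phaseForm (-x) p) * f p)
        ∂(torusMeasure d) = (vhat x : ℂ) * torusCoeff f x := fun x => by
      rw [torusCoeff, integral_const_mul]
      ring
    have h4 : ∀ p, (fourierNorm d : ℂ) * ∑' x, (vhat x : ℂ) * (Complex.exp (phaseForm (-x) p) * f p) =
        (starRingEnd ℂ) (fourierV vhat p) * f p := fun p => by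
      rw [conj_fourierV, mul_assoc, ← tsum_mul_right]
      congr 1
      refine tsum_congr fun x => ?_
      ring
    simp only [h3, h4] at h2
    exact h2
  · refine (hv.summable_abs.mul_right (∫ p, ‖f p‖ ∂(torusMeasure d))).congr fun x => ?_
    simp only [norm_mul, norm_exp_phaseForm, one_mul, Complex.norm_real, Real.norm_eq_abs,
      integral_const_mul]

/-- Parseval's identity against `v` is applied to the single exponential `e^{iy·p}`, whose
coefficients are a delta, and the result is conjugated. -/
theorem torusCoeff_fourierV {d : ℕ} {vhat : Lattice d → ℝ} (hv : ExpDecay vhat) (y : Lattice d) :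
    torusCoeff (fourierV vhat) y = vhat y := by
  have hint : Integrable (fun p => Complex.exp (phaseForm y p)) (torusMeasure d) :=
    Integrable.of_bound (continuous_exp_phaseForm y).aestronglyMeasurable 1
      (ae_of_all _ fun p => (norm_exp_phaseForm y p).le)
  have h := hasSum_torusCoeff hv hint
  have hc : ∀ x, torusCoeff (fun p => Complex.exp (phaseForm y p)) x =
      if x = y then (fourierNorm d : ℂ) * (((2 * Real.pi) ^ d : ℝ) : ℂ) else 0 := by
    intro x
    simp only [torusCoeff, ← Complex.exp_add, ← phaseForm_add, integral_exp_phaseForm]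
    have : -x + y = 0 ↔ x = y := by rw [neg_add_eq_zero]
    simp only [this]
    split_ifs <;> simp
  have h2 := hasSum_single (f := fun x => (vhat x : ℂ) *
    torusCoeff (fun p => Complex.exp (phaseForm y p)) x) y (fun x hx => by simp [hc, hx])
  have h3 := h.unique h2
  simp only [hc, if_true] at h3
  have h4 : ∫ p, Complex.exp (phaseForm (-y) p) * fourierV vhat p ∂(torusMeasure d) =
      (starRingEnd ℂ) (∫ p, (starRingEnd ℂ) (fourierV vhat p) * Complex.exp (phaseForm y p)
        ∂(torusMeasure d)) := by
    rw [← integral_conj]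
    refine integral_congr_ae (ae_of_all _ fun p => ?_)
    simp only [map_mul, Complex.conj_conj]
    rw [mul_comm, ← Complex.exp_conj, phaseForm_neg, phaseForm_apply, map_mul, Complex.conj_I,
      Complex.conj_ofReal, neg_mul]
  rw [torusCoeff, h4, h3, map_mul, map_mul, Complex.conj_ofReal, Complex.conj_ofReal,
    Complex.conj_ofReal]
  have := fourierNorm_sq_mul d
  have h5 : (fourierNorm d : ℂ) * ((fourierNorm d : ℂ) * (((2 * Real.pi) ^ d : ℝ) : ℂ)) = 1 := by
    exact_mod_cast this
  rw [mul_left_comm, h5, mul_one]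

theorem not_ae_fourierV_eq_zero {d : ℕ} {vhat : Lattice d → ℝ} (hv : ExpDecay vhat)
    (hne : vhat ≠ 0) : IsNonzero (fourierV vhat) := by
  intro h
  refine hne (funext fun y => ?_)
  have h1 := torusCoeff_fourierV hv y
  rw [torusCoeff, integral_eq_zero_of_ae] at h1
  · simpa using h1.symm
  · filter_upwards [h] with p hp
    simp [hp]

/-- Bessel's inequality: the Fourier coefficients are square summable. -/
theorem memlp_torusCoeff {d : ℕ} {f : Momentum d → ℂ} (hf : MemLp f 2 (torusMeasure d)) :
    Memℓp (torusCoeff f) 2 := by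
  have he : ∀ x : Lattice d, MemLp (fun p => (fourierNorm d : ℂ) * Complex.exp (phaseForm x p)) 2
      (torusMeasure d) := fun x => by
    refine MemLp.of_bound (continuous_const.mul (continuous_exp_phaseForm x)).aestronglyMeasurable
      (fourierNorm d) (ae_of_all _ fun p => ?_)
    rw [norm_mul, norm_exp_phaseForm, mul_one, Complex.norm_real, Real.norm_eq_abs,
      abs_of_pos (fourierNorm_pos d)]
  let E : Lattice d → Lp ℂ 2 (torusMeasure d) := fun x => (he x).toLp _
  have hinner : ∀ (x : Lattice d) {g : Momentum d → ℂ} (hg : MemLp g 2 (torusMeasure d)),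
      inner ℂ (E x) (hg.toLp g) = torusCoeff g x := by
    intro x g hg
    rw [L2.inner_def, torusCoeff, ← integral_const_mul]
    refine integral_congr_ae ?_
    filter_upwards [(he x).coeFn_toLp, hg.coeFn_toLp] with p h1 h2
    simp only [E]
    rw [h1, h2, RCLike.inner_apply, map_mul, Complex.conj_ofReal, ← Complex.exp_conj, phaseForm_neg,
      phaseForm_apply, map_mul, Complex.conj_I, Complex.conj_ofReal, neg_mul]
    ring
  have hon : Orthonormal ℂ E := by
    rw [orthonormal_iff_ite]
    intro x y
    simp only [E]
    rw [hinner x (he y), torusCoeff]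
    have : ∀ p, Complex.exp (phaseForm (-x) p) * ((fourierNorm d : ℂ) * Complex.exp (phaseForm y p)) =
        (fourierNorm d : ℂ) * Complex.exp (phaseForm (-x + y) p) := by
      intro p
      rw [phaseForm_add, Complex.exp_add]
      ring
    simp only [this, integral_const_mul, integral_exp_phaseForm]
    have hxy : -x + y = 0 ↔ x = y := neg_add_eq_zero
    simp only [hxy]
    split_ifs
    · exact_mod_cast fourierNorm_sq_mul d
    · simp
  have hs := hon.inner_products_summable (hf.toLp f)
  have hE : ∀ x, inner ℂ (E x) (hf.toLp f) = torusCoeff f x := fun x => hinner x hf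
  simp only [hE] at hs
  refine memℓp_gen ?_
  simpa using hs

/-! ### The Laplacian on Fourier coefficients -/

/-- Shifts of the coefficients by `± eᵢ` multiply the function by `e^{∓ i pᵢ}`, and the two
exponentials combine to `2 cos pᵢ`. -/
theorem latticeLaplacian_torusCoeff {d : ℕ} {f : Momentum d → ℂ} (hf : Integrable f (torusMeasure d)) :
    latticeLaplacian (torusCoeff f) = torusCoeff fun p => (energy p : ℂ) * f p := by
  funext x
  have hshift : ∀ y, torusCoeff f (x + y) = (fourierNorm d : ℂ) *
      ∫ p, Complex.exp (phaseForm (-x) p) * (Complex.exp (-phaseForm y p) * f p)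
        ∂(torusMeasure d) := by
    intro y
    rw [torusCoeff]
    congr 1
    refine integral_congr_ae (ae_of_all _ fun p => ?_)
    simp only
    rw [neg_add, phaseForm_add, Complex.exp_add, phaseForm_neg y, mul_assoc]
  have hi : ∀ y : Lattice d, Integrable (fun p => Complex.exp (phaseForm (-x) p) *
      (Complex.exp (-phaseForm y p) * f p)) (torusMeasure d) := fun y => by
    have := integrable_exp_mul (integrable_exp_mul hf (-y)) (-x)
    simpa only [phaseForm_neg y] using this
  have hi0 := integrable_exp_mul hf (-x)
  have hsingle : ∀ (i : Fin d) (p : Momentum d), phaseForm (Pi.single i 1 : Lattice d) p =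
      (p i : ℂ) * Complex.I := by
    intro i p
    rw [phaseForm_apply, mul_comm]
    congr 2
    rw [Finset.sum_eq_single i]
    · simp
    · intro j _ hj
      simp [Pi.single_eq_of_ne hj]
    · simp
  have hterm : ∀ i : Fin d, (torusCoeff f x - torusCoeff f (x + Pi.single i 1)) +
      (torusCoeff f x - torusCoeff f (x - Pi.single i 1)) =
      (fourierNorm d : ℂ) * ∫ p, Complex.exp (phaseForm (-x) p) *
        (2 * ((1 - Real.cos (p i) : ℝ) : ℂ) * f p) ∂(torusMeasure d) := by
    intro i
    rw [sub_eq_add_neg x, hshift, hshift, torusCoeff, ← mul_sub, ← mul_sub, ← mul_add,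
      ← integral_sub hi0 (hi _), ← integral_sub hi0 (hi _)]
    have hadd := integral_add (hi0.sub (hi (Pi.single i 1))) (hi0.sub (hi (-Pi.single i 1)))
    simp only [Pi.sub_apply] at hadd
    rw [← hadd]
    congr 1
    refine integral_congr_ae (ae_of_all _ fun p => ?_)
    simp only [phaseForm_neg, hsingle, neg_neg]
    have := Complex.two_cos (p i : ℂ)
    push_cast
    rw [neg_mul] at this
    linear_combination (-(Complex.exp (-phaseForm x p) * f p)) * (-this)
  simp only [latticeLaplacian, hterm]
  rw [← Finset.mul_sum, ← integral_finsetSum, torusCoeff, mul_left_comm, ← integral_const_mul]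
  · congr 1
    refine integral_congr_ae (ae_of_all _ fun p => ?_)
    simp only [energy]
    push_cast
    rw [← Finset.mul_sum, ← Finset.sum_mul, ← Finset.mul_sum]
    ring
  · intro i _
    refine integrable_exp_mul ?_ _
    refine hf.bdd_mul (c := 4) ?_ (ae_of_all _ fun p => ?_)
    · exact Continuous.aestronglyMeasurable (by fun_prop)
    · rw [norm_mul, Complex.norm_real, Real.norm_eq_abs]
      have h1 := Real.cos_le_one (p i)
      have h2 := Real.neg_one_le_cos (p i)
      rw [abs_of_nonneg (by linarith)]
      simp
      linarith

theorem integrable_energy_mul {d : ℕ} {f : Momentum d → ℂ} (hf : Integrable f (torusMeasure d)) :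
    Integrable (fun p => (energy p : ℂ) * f p) (torusMeasure d) := by
  refine hf.bdd_mul (c := 2 * d) ?_ (ae_of_all _ fun p => ?_)
  · exact (Complex.continuous_ofReal.comp continuous_energy).aestronglyMeasurable
  · rw [Complex.norm_real, Real.norm_eq_abs, abs_of_nonneg (energy_nonneg p)]
    exact energy_le p

theorem bilaplacian_torusCoeff {d : ℕ} {f : Momentum d → ℂ} (hf : Integrable f (torusMeasure d)) :
    latticeLaplacian (latticeLaplacian (torusCoeff f)) =
      torusCoeff fun p => (dispersion p : ℂ) * f p := by
  rw [latticeLaplacian_torusCoeff hf, latticeLaplacian_torusCoeff (integrable_energy_mul hf)]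
  congr 1
  funext p
  have : dispersion p = energy p ^ 2 := rfl
  rw [this]
  push_cast
  ring

theorem norm_latticeLaplacian_le {d : ℕ} {f : Lattice d → ℂ} {M : ℝ} (hf : ∀ x, ‖f x‖ ≤ M)
    (x : Lattice d) : ‖latticeLaplacian f x‖ ≤ 2 * d * M := by
  have h1 : ‖∑ i, ((f x - f (x + Pi.single i 1)) + (f x - f (x - Pi.single i 1)))‖ ≤
      ∑ _i : Fin d, 4 * M := by
    refine norm_sum_le_of_le _ fun i _ => ?_
    have a := norm_add_le (f x - f (x + Pi.single i 1)) (f x - f (x - Pi.single i 1))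
    have b := norm_sub_le (f x) (f (x + Pi.single i 1))
    have c := norm_sub_le (f x) (f (x - Pi.single i 1))
    linarith [hf x, hf (x + Pi.single i 1), hf (x - Pi.single i 1)]
  simp only [Finset.sum_const, Finset.card_univ, Fintype.card_fin, nsmul_eq_mul] at h1
  rw [latticeLaplacian, norm_mul]
  norm_num
  linarith

/-- The lattice bilaplacian has no bounded eigenfunctions above `4d²`. -/
theorem eq_zero_of_bilaplacian_eq {d : ℕ} {f : Lattice d → ℂ} {M z : ℝ} (hf : ∀ x, ‖f x‖ ≤ M)
    (hz : 4 * (d : ℝ) ^ 2 < z) (h : ∀ x, latticeLaplacian (latticeLaplacian f) x = (z : ℂ) * f x) :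
    f = 0 := by
  have hbdd : BddAbove (Set.range fun x => ‖f x‖) := ⟨M, by rintro _ ⟨x, rfl⟩; exact hf x⟩
  set S := ⨆ x, ‖f x‖ with hS
  have hfS : ∀ x, ‖f x‖ ≤ S := le_ciSup hbdd
  have hz0 : 0 < z := lt_of_le_of_lt (by positivity) hz
  -- The Laplacian has supremum norm at most `2d`, so `z S ≤ 4d² S`, which forces `S = 0`.
  have h1 : ∀ x, z * ‖f x‖ ≤ 4 * (d : ℝ) ^ 2 * S := by
    intro x
    have a := norm_latticeLaplacian_le (norm_latticeLaplacian_le hfS) x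
    rw [h x, norm_mul, Complex.norm_real, Real.norm_eq_abs, abs_of_pos hz0] at a
    linarith
  have h2 : S ≤ 4 * (d : ℝ) ^ 2 * S / z := by
    refine ciSup_le fun x => ?_
    rw [le_div_iff₀ hz0, mul_comm]
    exact h1 x
  have hS0 : 0 ≤ S := (norm_nonneg _).trans (hfS 0)
  have h3 : S = 0 := by
    rw [le_div_iff₀ hz0] at h2
    nlinarith
  funext x
  have := hfS x
  rw [h3] at this
  simpa using this

end DiscreteBilaplacian
end

noncomputable section
namespace DiscreteBilaplacian

open Filter Topology

/-! ### The eigenvalue equation -/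

section Eigen

variable {d : ℕ} {vhat : Lattice d → ℝ}

theorem gap_nonneg (p : Momentum d) : 0 ≤ 4 * (d : ℝ) ^ 2 - dispersion p := by
  linarith [dispersion_le p]

theorem continuous_gap : Continuous fun p : Momentum d => 4 * (d : ℝ) ^ 2 - dispersion p :=
  continuous_const.sub continuous_dispersion

/-- The resolvent of the dispersion relation applied to the generator. -/
def resolventState (vhat : Lattice d → ℝ) (x : ℝ) (p : Momentum d) : ℂ :=
  fourierV vhat p / ((4 * (d : ℝ) ^ 2 - dispersion p + x : ℝ) : ℂ)

theorem memLp_resolventState (hv : ExpDecay vhat) {x : ℝ} (hx : 0 < x) :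
    MemLp (resolventState vhat x) 2 (torusMeasure d) := by
  obtain ⟨K, hK⟩ := exists_norm_fourierV_le hv
  have hpos : ∀ p : Momentum d, 0 < 4 * (d : ℝ) ^ 2 - dispersion p + x := fun p => by
    linarith [gap_nonneg p]
  refine MemLp.of_bound (C := K / x) ?_ (ae_of_all _ fun p => ?_)
  · refine Continuous.aestronglyMeasurable ?_
    refine (continuous_fourierV hv).div
      (Complex.continuous_ofReal.comp (continuous_gap.add continuous_const)) fun p => ?_
    exact Complex.ofReal_ne_zero.2 (hpos p).ne'
  · rw [resolventState, norm_div, Complex.norm_real, Real.norm_eq_abs, abs_of_pos (hpos p)]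
    have h1 := hK p
    have h2 : x ≤ 4 * (d : ℝ) ^ 2 - dispersion p + x := by linarith [gap_nonneg p]
    have h0 : 0 ≤ K := (norm_nonneg _).trans h1
    gcongr

theorem conj_mul_div_ofReal (p : Momentum d) (c : ℝ) :
    (starRingEnd ℂ) (fourierV vhat p) * (fourierV vhat p / (c : ℂ)) =
      ((‖fourierV vhat p‖ ^ 2 / c : ℝ) : ℂ) := by
  rw [← mul_div_assoc, Complex.conj_mul']
  push_cast
  rfl

theorem integral_conj_mul_resolventState (x : ℝ) :
    ∫ p, (starRingEnd ℂ) (fourierV vhat p) * resolventState vhat x p ∂(torusMeasure d) =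
      (resolventIntegral vhat x : ℂ) := by
  simp only [resolventState, conj_mul_div_ofReal, integral_complex_ofReal]
  rfl

theorem integrable_conj_mul (hv : ExpDecay vhat) {f : Momentum d → ℂ}
    (hf : Integrable f (torusMeasure d)) :
    Integrable (fun p => (starRingEnd ℂ) (fourierV vhat p) * f p) (torusMeasure d) := by
  obtain ⟨K, hK⟩ := exists_norm_fourierV_le hv
  refine hf.bdd_mul (c := K) ?_ (ae_of_all _ fun p => ?_)
  · exact (Complex.continuous_conj.comp (continuous_fourierV hv)).aestronglyMeasurable
  · rw [RCLike.norm_conj]; exact hK p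

/-- With `c = ∫ v̄ f`, the equation forces `f = -μ c` times the resolvent state. Pairing with `v̄`
gives `c = -μ c F(x)`, and `c ≠ 0` since otherwise `f` vanishes almost everywhere. Conversely the
resolvent state is an eigenfunction. -/
theorem isEigenvalue_iff (hv : ExpDecay vhat) (hne : vhat ≠ 0) {μ x : ℝ} (hx : 0 < x) :
    IsEigenvalue vhat μ (4 * (d : ℝ) ^ 2 + x) ↔ -μ * resolventIntegral vhat x = 1 := by
  have hpos : ∀ p : Momentum d, 0 < 4 * (d : ℝ) ^ 2 - dispersion p + x := fun p => by
    linarith [gap_nonneg p]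
  have hposC : ∀ p : Momentum d, ((4 * (d : ℝ) ^ 2 - dispersion p + x : ℝ) : ℂ) ≠ 0 := fun p =>
    Complex.ofReal_ne_zero.2 (hpos p).ne'
  constructor
  · rintro ⟨f, -, hf0, -, -, hsol⟩
    set c := ∫ q, (starRingEnd ℂ) (fourierV vhat q) * f q ∂(torusMeasure d) with hc
    have hf : ∀ᵐ p ∂(torusMeasure d), f p = -((μ : ℂ) * c) * resolventState vhat x p := by
      filter_upwards [hsol] with p hp
      rw [resolventState, mul_div_assoc', eq_div_iff (hposC p)]
      push_cast at hp ⊢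
      linear_combination -hp
    have hc2 : c = -((μ : ℂ) * c) * (resolventIntegral vhat x : ℂ) := by
      rw [← integral_conj_mul_resolventState, ← integral_const_mul]
      refine (integral_congr_ae ?_)
      filter_upwards [hf] with p hp
      rw [hp]
      ring
    have hc0 : c ≠ 0 := by
      intro h0
      refine hf0 ?_
      filter_upwards [hf] with p hp
      rw [hp, h0]
      simp
    have h1 : (1 : ℂ) = -(μ : ℂ) * (resolventIntegral vhat x : ℂ) := by
      refine mul_left_cancel₀ hc0 ?_
      linear_combination hc2
    exact_mod_cast h1.symm
  · intro h
    have hm := memLp_resolventState hv hx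
    refine ⟨resolventState vhat x, hm, ?_, hm.1,
      integrable_conj_mul hv (hm.integrable (by norm_num)), ae_of_all _ fun p => ?_⟩
    · intro h0
      refine not_ae_fourierV_eq_zero hv hne ?_
      filter_upwards [h0] with p hp
      rw [resolventState, div_eq_zero_iff] at hp
      exact hp.resolve_right (hposC p)
    · rw [integral_conj_mul_resolventState]
      have h' : -(μ : ℂ) * (resolventIntegral vhat x : ℂ) = 1 := by exact_mod_cast h
      have hr : resolventState vhat x p * ((4 * (d : ℝ) ^ 2 - dispersion p + x : ℝ) : ℂ) =
          fourierV vhat p := div_mul_cancel₀ _ (hposC p)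
      push_cast at hr ⊢
      linear_combination (fourierV vhat p) * h' - hr

/-- The Fourier coefficients `G` of the resolvent state solve the inhomogeneous equation with
right-hand side `-vhat`. For an eigenfunction `f`, the combination `f + μ c G` is a bounded solution
of the free equation above `4d²`, hence zero. Thus Bessel's inequality suffices and completeness of
the exponentials is not used. -/
theorem isLatticeEigenvalue_iff (hv : ExpDecay vhat) (hne : vhat ≠ 0) {μ x : ℝ} (hx : 0 < x) :
    IsLatticeEigenvalue vhat μ (4 * (d : ℝ) ^ 2 + x) ↔ -μ * resolventIntegral vhat x = 1 := by
  have hposC : ∀ p : Momentum d, ((4 * (d : ℝ) ^ 2 - dispersion p + x : ℝ) : ℂ) ≠ 0 := fun p =>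
    Complex.ofReal_ne_zero.2 (by linarith [gap_nonneg p] : 0 < 4 * (d : ℝ) ^ 2 - dispersion p + x).ne'
  have hm := memLp_resolventState hv hx
  have hi := hm.integrable (μ := torusMeasure d) (by norm_num : (1 : ENNReal) ≤ 2)
  set G : Lattice d → ℂ := torusCoeff (resolventState vhat x) with hG
  have hGℓ : Memℓp G 2 := memlp_torusCoeff hm
  have hGsum : HasSum (fun y => (vhat y : ℂ) * G y) (resolventIntegral vhat x : ℂ) := by
    have := hasSum_torusCoeff hv hi
    rwa [integral_conj_mul_resolventState] at this
  have hGeq : ∀ y, latticeLaplacian (latticeLaplacian G) y =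
      ((4 * (d : ℝ) ^ 2 + x : ℝ) : ℂ) * G y - vhat y := by
    intro y
    rw [hG, bilaplacian_torusCoeff hi, ← torusCoeff_fourierV hv y, torusCoeff, torusCoeff, torusCoeff,
      mul_left_comm, ← mul_sub]
    congr 1
    rw [← integral_const_mul, ← integral_sub]
    · refine integral_congr_ae (ae_of_all _ fun p => ?_)
      have hr : resolventState vhat x p * ((4 * (d : ℝ) ^ 2 - dispersion p + x : ℝ) : ℂ) =
          fourierV vhat p := div_mul_cancel₀ _ (hposC p)
      simp only
      rw [← hr]
      push_cast
      ring
    · exact (integrable_exp_mul hi _).const_mul _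
    · refine integrable_exp_mul ?_ _
      obtain ⟨K, hK⟩ := exists_norm_fourierV_le hv
      exact Integrable.of_bound (continuous_fourierV hv).aestronglyMeasurable K (ae_of_all _ hK)
  have hGne : G ≠ 0 := by
    intro h0
    refine hne (funext fun y => ?_)
    have := hGeq y
    rw [h0] at this
    have h1 : latticeLaplacian (latticeLaplacian (0 : Lattice d → ℂ)) y = 0 := by
      simp [latticeLaplacian]
    rw [h1] at this
    simpa using this.symm
  have hlap_add : ∀ (f g : Lattice d → ℂ) (a : ℂ), latticeLaplacian (f + a • g) =
      latticeLaplacian f + a • latticeLaplacian g := by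
    intro f g a
    funext y
    simp only [latticeLaplacian, Pi.add_apply, Pi.smul_apply, smul_eq_mul]
    rw [mul_left_comm a, ← mul_add]
    congr 1
    rw [Finset.mul_sum, ← Finset.sum_add_distrib]
    refine Finset.sum_congr rfl fun i _ => ?_
    ring
  constructor
  · rintro ⟨f, hfℓ, hf0, hf⟩
    set c := ∑' y, (vhat y : ℂ) * f y with hc
    have hb : ∀ {g : Lattice d → ℂ}, Memℓp g 2 → ∃ M, ∀ y, ‖g y‖ ≤ M := by
      intro g hg
      have := memℓp_infty_iff.1 (hg.of_exponent_ge le_top)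
      obtain ⟨M, hM⟩ := this
      exact ⟨M, fun y => hM ⟨y, rfl⟩⟩
    obtain ⟨M, hM⟩ := hb (hfℓ.add (hGℓ.const_smul ((μ : ℂ) * c)))
    have hzero := eq_zero_of_bilaplacian_eq (z := 4 * (d : ℝ) ^ 2 + x) hM (by linarith) (fun y => by
      rw [hlap_add, hlap_add]
      have h1 := hf y
      have h2 := hGeq y
      rw [latticeOp, ← hc] at h1
      simp only [Pi.add_apply, Pi.smul_apply, smul_eq_mul]
      linear_combination h1 + (μ : ℂ) * c * h2)
    have hfG : ∀ y, f y = -((μ : ℂ) * c) * G y := by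
      intro y
      have := congrFun hzero y
      simp only [Pi.add_apply, Pi.smul_apply, smul_eq_mul, Pi.zero_apply] at this
      linear_combination this
    have hc2 : c = -((μ : ℂ) * c) * (resolventIntegral vhat x : ℂ) := by
      rw [← hGsum.tsum_eq, ← tsum_mul_left]
      refine tsum_congr fun y => ?_
      rw [hfG y]
      ring
    have hc0 : c ≠ 0 := by
      intro h0
      refine hf0 (funext fun y => ?_)
      rw [hfG y, h0]
      simp
    have h1 : (1 : ℂ) = -(μ : ℂ) * (resolventIntegral vhat x : ℂ) := by
      refine mul_left_cancel₀ hc0 ?_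
      linear_combination hc2
    exact_mod_cast h1.symm
  · intro h
    refine ⟨G, hGℓ, hGne, fun y => ?_⟩
    have h' : -(μ : ℂ) * (resolventIntegral vhat x : ℂ) = 1 := by exact_mod_cast h
    rw [latticeOp, hGsum.tsum_eq, hGeq y]
    linear_combination (vhat y : ℂ) * h'

/-! ### Monotonicity of the resolvent integral -/

theorem integrable_resolvent (hv : ExpDecay vhat) {x : ℝ} (hx : 0 < x) :
    Integrable (fun p => ‖fourierV vhat p‖ ^ 2 / (4 * (d : ℝ) ^ 2 - dispersion p + x))
      (torusMeasure d) := by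
  obtain ⟨K, hK⟩ := exists_norm_fourierV_le hv
  have hpos : ∀ p : Momentum d, 0 < 4 * (d : ℝ) ^ 2 - dispersion p + x := fun p => by
    linarith [gap_nonneg p]
  refine Integrable.of_bound (C := K ^ 2 / x) ?_ (ae_of_all _ fun p => ?_)
  · refine Continuous.aestronglyMeasurable ?_
    exact ((continuous_fourierV hv).norm.pow 2).div (continuous_gap.add continuous_const)
      fun p => (hpos p).ne'
  · rw [Real.norm_eq_abs, abs_div, abs_of_nonneg (sq_nonneg _), abs_of_pos (hpos p)]
    have := pow_le_pow_left₀ (norm_nonneg _) (hK p) 2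
    gcongr
    linarith [gap_nonneg p]

theorem integral_pos_of_pos_mul (hv : ExpDecay vhat) (hne : vhat ≠ 0) {w : Momentum d → ℝ}
    (hw : ∀ p, 0 < w p)
    (hi : Integrable (fun p => ‖fourierV vhat p‖ ^ 2 * w p) (torusMeasure d)) :
    0 < ∫ p, ‖fourierV vhat p‖ ^ 2 * w p ∂(torusMeasure d) := by
  have hnn : ∀ p, 0 ≤ ‖fourierV vhat p‖ ^ 2 * w p := fun p =>
    mul_nonneg (sq_nonneg _) (hw p).le
  refine lt_of_le_of_ne (integral_nonneg hnn) fun h => ?_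
  have h0 := (integral_eq_zero_iff_of_nonneg hnn hi).1 h.symm
  refine not_ae_fourierV_eq_zero hv hne ?_
  filter_upwards [h0] with p hp
  have : ‖fourierV vhat p‖ ^ 2 = 0 := (mul_eq_zero.1 hp).resolve_right (hw p).ne'
  simpa using this

theorem resolventIntegral_pos (hv : ExpDecay vhat) (hne : vhat ≠ 0) {x : ℝ} (hx : 0 < x) :
    0 < resolventIntegral vhat x := by
  have hpos : ∀ p : Momentum d, 0 < 4 * (d : ℝ) ^ 2 - dispersion p + x := fun p => by
    linarith [gap_nonneg p]
  have hi := integrable_resolvent hv hx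
  simp only [resolventIntegral, div_eq_mul_inv] at hi ⊢
  exact integral_pos_of_pos_mul hv hne (fun p => inv_pos.2 (hpos p)) hi

theorem resolventIntegral_sub (hv : ExpDecay vhat) {x y : ℝ} (hx : 0 < x) (hy : 0 < y) :
    resolventIntegral vhat x - resolventIntegral vhat y = (y - x) *
      ∫ p, ‖fourierV vhat p‖ ^ 2 * ((4 * (d : ℝ) ^ 2 - dispersion p + x) *
        (4 * (d : ℝ) ^ 2 - dispersion p + y))⁻¹ ∂(torusMeasure d) := by
  rw [resolventIntegral, resolventIntegral,
    ← integral_sub (integrable_resolvent hv hx) (integrable_resolvent hv hy), ← integral_const_mul]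
  refine integral_congr_ae (ae_of_all _ fun p => ?_)
  have h1 : 4 * (d : ℝ) ^ 2 - dispersion p + x ≠ 0 := by linarith [gap_nonneg p]
  have h2 : 4 * (d : ℝ) ^ 2 - dispersion p + y ≠ 0 := by linarith [gap_nonneg p]
  simp only
  field_simp
  ring

theorem resolventIntegral_strictAntiOn (hv : ExpDecay vhat) (hne : vhat ≠ 0) :
    StrictAntiOn (resolventIntegral vhat) (Set.Ioi 0) := by
  intro x hx y hy hxy
  have hx' : (0 : ℝ) < x := hx
  have hy' : (0 : ℝ) < y := hy
  have h := resolventIntegral_sub hv hx' hy'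
  have hpos : ∀ p : Momentum d, 0 < ((4 * (d : ℝ) ^ 2 - dispersion p + x) *
      (4 * (d : ℝ) ^ 2 - dispersion p + y))⁻¹ := fun p => by
    have := gap_nonneg p
    positivity
  have hi : Integrable (fun p => ‖fourierV vhat p‖ ^ 2 * ((4 * (d : ℝ) ^ 2 - dispersion p + x) *
      (4 * (d : ℝ) ^ 2 - dispersion p + y))⁻¹) (torusMeasure d) := by
    refine (((integrable_resolvent hv hx').sub (integrable_resolvent hv hy')).const_mul
      (y - x)⁻¹).congr (ae_of_all _ fun p => ?_)
    have h1 : 4 * (d : ℝ) ^ 2 - dispersion p + x ≠ 0 := by linarith [gap_nonneg p]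
    have h2 : 4 * (d : ℝ) ^ 2 - dispersion p + y ≠ 0 := by linarith [gap_nonneg p]
    have h3 : y - x ≠ 0 := by linarith
    simp only [Pi.sub_apply]
    field_simp
    ring
  have := mul_pos (sub_pos.2 hxy) (integral_pos_of_pos_mul hv hne hpos hi)
  linarith

theorem continuousOn_resolventIntegral (hv : ExpDecay vhat) :
    ContinuousOn (resolventIntegral vhat) (Set.Ioi 0) := by
  intro x hx
  have hx' : (0 : ℝ) < x := hx
  refine ContinuousAt.continuousWithinAt ?_
  obtain ⟨K, hK⟩ := exists_norm_fourierV_le hv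
  refine continuousAt_of_dominated (bound := fun _ => K ^ 2 / (x / 2)) ?_ ?_ (integrable_const _) ?_
  · filter_upwards [lt_mem_nhds hx'] with y hy using (integrable_resolvent hv hy).1
  · filter_upwards [lt_mem_nhds (half_lt_self hx')] with y hy
    refine ae_of_all _ fun p => ?_
    have h1 : x / 2 ≤ 4 * (d : ℝ) ^ 2 - dispersion p + y := by linarith [gap_nonneg p]
    have h2 : 0 < x / 2 := by positivity
    rw [Real.norm_eq_abs, abs_div, abs_of_nonneg (sq_nonneg _), abs_of_pos (h2.trans_le h1)]
    have := pow_le_pow_left₀ (norm_nonneg _) (hK p) 2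
    gcongr
  · refine ae_of_all _ fun p => ?_
    refine ContinuousAt.div continuousAt_const (by fun_prop) ?_
    linarith [gap_nonneg p]

theorem tendsto_resolventIntegral_atTop (hv : ExpDecay vhat) :
    Tendsto (resolventIntegral vhat) atTop (𝓝 0) := by
  obtain ⟨K, hK⟩ := exists_norm_fourierV_le hv
  have h1 : Tendsto (fun x : ℝ => (torusMeasure d).real Set.univ * K ^ 2 / x) atTop (𝓝 0) :=
    tendsto_const_nhds.div_atTop tendsto_id
  refine squeeze_zero_norm' ?_ h1
  filter_upwards [eventually_gt_atTop 0] with x hx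
  have := norm_integral_le_of_norm_le_const (μ := torusMeasure d) (C := K ^ 2 / x)
    (f := fun p => ‖fourierV vhat p‖ ^ 2 / (4 * (d : ℝ) ^ 2 - dispersion p + x))
    (ae_of_all _ fun p => ?_)
  · refine this.trans (le_of_eq ?_)
    ring
  · have h1 : x ≤ 4 * (d : ℝ) ^ 2 - dispersion p + x := by linarith [gap_nonneg p]
    rw [Real.norm_eq_abs, abs_div, abs_of_nonneg (sq_nonneg _), abs_of_pos (hx.trans_le h1)]
    have := pow_le_pow_left₀ (norm_nonneg _) (hK p) 2
    gcongr

/-! ### Thresholds as limits of the resolvent integral -/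

/-- The gap vanishes only if every cosine is `-1`, and the half-open cube contains a single such
point. -/
theorem ae_gap_pos (hd : 1 ≤ d) : ∀ᵐ p ∂(torusMeasure d), 0 < 4 * (d : ℝ) ^ 2 - dispersion p := by
  have : Nonempty (Fin d) := ⟨⟨0, hd⟩⟩
  have hd0 : (0 : ℝ) < d := by exact_mod_cast hd
  rw [torusMeasure_eq]
  have h1 : ∀ᵐ p ∂(volume : Measure (Momentum d)).restrict (cube d), p ≠ piVec d := by
    refine ae_restrict_of_ae ?_
    rw [ae_iff]
    simp
  filter_upwards [h1, ae_restrict_mem (measurableSet_cube d)] with p hp hc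
  refine lt_of_le_of_ne (gap_nonneg p) fun h0 => hp ?_
  have hE : energy p = 2 * d := by
    have h2 : dispersion p = energy p ^ 2 := rfl
    rw [h2] at h0
    have h3 := energy_nonneg p
    have h4 : (energy p - 2 * d) * (energy p + 2 * d) = 0 := by linarith
    rcases mul_eq_zero.1 h4 with h5 | h5
    · linarith
    · linarith
  have hsum : ∑ i, (1 + Real.cos (p i)) = 0 := by
    have : ∑ i, (1 + Real.cos (p i)) = ∑ i : Fin d, (2 : ℝ) - energy p := by
      rw [energy, ← Finset.sum_sub_distrib]
      refine Finset.sum_congr rfl fun i _ => ?_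
      ring
    rw [this, hE]
    simp [mul_comm]
  have hcos : ∀ i, 1 + Real.cos (p i) = 0 := fun i =>
    (Finset.sum_eq_zero_iff_of_nonneg fun i _ => by linarith [Real.neg_one_le_cos (p i)]).1 hsum i
      (Finset.mem_univ i)
  ext i
  have h2 : Real.cos (p i) = -1 := by linarith [hcos i]
  have h3 := hc i
  have hpi := Real.pi_pos
  rcases le_or_gt 0 (p i) with h4 | h4
  · exact Real.injOn_cos ⟨h4, h3.2⟩ ⟨hpi.le, le_rfl⟩ (by rw [h2]; simp [piVec])
  · exfalso
    have h5 : Real.cos (-(p i)) = Real.cos Real.pi := by rw [Real.cos_neg, h2, Real.cos_pi]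
    have := Real.injOn_cos ⟨by linarith, by linarith [h3.1]⟩ ⟨hpi.le, le_rfl⟩ h5
    linarith [h3.1]

/-- The sequence `1 / (k + 1)` used for monotone limits. -/
theorem tendsto_one_div_nhdsGT : Tendsto (fun k : ℕ => 1 / ((k : ℝ) + 1)) atTop (𝓝[>] 0) :=
  tendsto_nhdsWithin_iff.2 ⟨tendsto_one_div_add_atTop_nhds_zero_nat,
    Eventually.of_forall fun k => by simp only [Set.mem_Ioi]; positivity⟩

/-- Monotone convergence as the shift `1/(k+1)` decreases to zero. The weight `w = 1` produces the
threshold integral, and `w` equal to the gap produces `Ĉ_v`. -/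
theorem tendsto_lintegral_gap (hd : 1 ≤ d) (hv : ExpDecay vhat) {w : Momentum d → ℝ}
    (hw : Measurable w) (hw0 : ∀ p, 0 ≤ w p) :
    Tendsto (fun k : ℕ => ∫⁻ p, ENNReal.ofReal (‖fourierV vhat p‖ ^ 2 /
        (w p * (4 * (d : ℝ) ^ 2 - dispersion p + 1 / ((k : ℝ) + 1)))) ∂(torusMeasure d)) atTop
      (𝓝 (∫⁻ p, ENNReal.ofReal (‖fourierV vhat p‖ ^ 2 /
        (w p * (4 * (d : ℝ) ^ 2 - dispersion p))) ∂(torusMeasure d))) := by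
  refine lintegral_tendsto_of_tendsto_of_monotone (fun k => ?_) ?_ ?_
  · refine Measurable.aemeasurable ?_
    have h1 := (continuous_fourierV hv).measurable
    have h2 := (continuous_gap (d := d)).measurable
    exact (((h1.norm.pow_const 2).div (hw.mul (h2.add_const _)))).ennreal_ofReal
  · refine ae_of_all _ fun p => fun k l hkl => ?_
    refine ENNReal.ofReal_le_ofReal ?_
    -- Where the weight vanishes, division by zero makes every integrand `0`, so monotonicity is
    -- trivial there.
    rcases (hw0 p).eq_or_lt with h0 | h0
    · simp [← h0]
    · have := gap_nonneg p
      have h3 : 1 / ((l : ℝ) + 1) ≤ 1 / ((k : ℝ) + 1) := by gcongr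
      gcongr
  · filter_upwards [ae_gap_pos hd] with p hp
    refine (ENNReal.continuous_ofReal.tendsto _).comp ?_
    rcases (hw0 p).eq_or_lt with h0 | h0
    · simp [← h0]
    · refine Tendsto.div tendsto_const_nhds ?_ (by positivity)
      refine tendsto_const_nhds.mul ?_
      have := (tendsto_one_div_add_atTop_nhds_zero_nat (𝕜 := ℝ)).const_add
        (4 * (d : ℝ) ^ 2 - dispersion p)
      simpa using this

theorem ofReal_resolventIntegral (hv : ExpDecay vhat) {x : ℝ} (hx : 0 < x) :
    ∫⁻ p, ENNReal.ofReal (‖fourierV vhat p‖ ^ 2 / (4 * (d : ℝ) ^ 2 - dispersion p + x))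
      ∂(torusMeasure d) = ENNReal.ofReal (resolventIntegral vhat x) := by
  rw [resolventIntegral, ofReal_integral_eq_lintegral_ofReal (integrable_resolvent hv hx)]
  refine ae_of_all _ fun p => ?_
  have := gap_nonneg p
  simp only [Pi.zero_apply]
  positivity

/-- The threshold integral `∫ |v|² / (4d² - 𝔢)`. -/
def thresholdIntegral (vhat : Lattice d → ℝ) : ENNReal :=
  ∫⁻ q, ENNReal.ofReal (‖fourierV vhat q‖ ^ 2 / (4 * (d : ℝ) ^ 2 - dispersion q)) ∂(torusMeasure d)

theorem tendsto_ofReal_resolventIntegral (hd : 1 ≤ d) (hv : ExpDecay vhat) :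
    Tendsto (fun k : ℕ => ENNReal.ofReal (resolventIntegral vhat (1 / ((k : ℝ) + 1)))) atTop
      (𝓝 (thresholdIntegral vhat)) := by
  have h := tendsto_lintegral_gap hd hv (w := fun _ => 1) measurable_const fun _ => zero_le_one
  simp only [one_mul] at h
  refine h.congr fun k => ?_
  exact ofReal_resolventIntegral hv (by positivity)

theorem thresholdIntegral_eq_top (hd : 1 ≤ d) (hv : ExpDecay vhat)
    (h : Tendsto (resolventIntegral vhat) (𝓝[>] 0) atTop) : thresholdIntegral vhat = ⊤ :=
  tendsto_nhds_unique (tendsto_ofReal_resolventIntegral hd hv)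
    (ENNReal.tendsto_ofReal_nhds_top.2 (h.comp tendsto_one_div_nhdsGT))

theorem thresholdIntegral_eq_ofReal (hd : 1 ≤ d) (hv : ExpDecay vhat) {L : ℝ}
    (h : Tendsto (resolventIntegral vhat) (𝓝[>] 0) (𝓝 L)) :
    thresholdIntegral vhat = ENNReal.ofReal L :=
  tendsto_nhds_unique (tendsto_ofReal_resolventIntegral hd hv)
    ((ENNReal.continuous_ofReal.tendsto L).comp (h.comp tendsto_one_div_nhdsGT))

theorem measurable_threshold_integrand (hv : ExpDecay vhat) :
    Measurable fun p => ‖fourierV vhat p‖ ^ 2 / (4 * (d : ℝ) ^ 2 - dispersion p) :=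
  ((continuous_fourierV hv).measurable.norm.pow_const 2).div (continuous_gap (d := d)).measurable

theorem threshold_integrand_nonneg (p : Momentum d) :
    0 ≤ ‖fourierV vhat p‖ ^ 2 / (4 * (d : ℝ) ^ 2 - dispersion p) :=
  div_nonneg (sq_nonneg _) (gap_nonneg p)

theorem integrable_threshold_iff (hv : ExpDecay vhat) :
    Integrable (fun p => ‖fourierV vhat p‖ ^ 2 / (4 * (d : ℝ) ^ 2 - dispersion p)) (torusMeasure d) ↔
      thresholdIntegral vhat < ⊤ := by
  rw [thresholdIntegral, Integrable,
    and_iff_right (measurable_threshold_integrand hv).aestronglyMeasurable,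
    hasFiniteIntegral_iff_ofReal (ae_of_all _ threshold_integrand_nonneg)]

theorem integral_threshold (hv : ExpDecay vhat) {L : ℝ} (hL : 0 ≤ L)
    (h : thresholdIntegral vhat = ENNReal.ofReal L) :
    ∫ p, ‖fourierV vhat p‖ ^ 2 / (4 * (d : ℝ) ^ 2 - dispersion p) ∂(torusMeasure d) = L := by
  rw [integral_eq_lintegral_of_nonneg_ae (ae_of_all _ threshold_integrand_nonneg)
    (measurable_threshold_integrand hv).aestronglyMeasurable]
  rw [thresholdIntegral] at h
  rw [h, ENNReal.toReal_ofReal hL]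

/-- With `g` the gap, `(1/g - 1/(g + x))/x = 1/(g(g + x))` increases to `1/g²` as `x` decreases to
`0`. Thus `Ĉ_v` is minus the right derivative at `0` of the resolvent integral, possibly infinite.
-/
theorem tendsto_CvHat (hd : 1 ≤ d) (hv : ExpDecay vhat) {L : ℝ} (hL : 0 ≤ L)
    (h : thresholdIntegral vhat = ENNReal.ofReal L) :
    Tendsto (fun k : ℕ => ENNReal.ofReal ((L - resolventIntegral vhat (1 / ((k : ℝ) + 1))) /
      (1 / ((k : ℝ) + 1)))) atTop (𝓝 (CvHat vhat)) := by
  have hint := (integrable_threshold_iff hv).2 (by rw [h]; exact ENNReal.ofReal_lt_top)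
  have h1 := tendsto_lintegral_gap hd hv (w := fun p => 4 * (d : ℝ) ^ 2 - dispersion p)
    (continuous_gap (d := d)).measurable gap_nonneg
  have h2 : ∀ p : Momentum d, (4 * (d : ℝ) ^ 2 - dispersion p) * (4 * (d : ℝ) ^ 2 - dispersion p) =
      (4 * (d : ℝ) ^ 2 - dispersion p) ^ 2 := fun p => (sq _).symm
  simp only [h2] at h1
  refine h1.congr fun k => ?_
  set x : ℝ := 1 / ((k : ℝ) + 1) with hx
  have hx0 : 0 < x := by positivity
  have h3 : ∀ᵐ p ∂(torusMeasure d), (‖fourierV vhat p‖ ^ 2 / (4 * (d : ℝ) ^ 2 - dispersion p) -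
      ‖fourierV vhat p‖ ^ 2 / (4 * (d : ℝ) ^ 2 - dispersion p + x)) / x = ‖fourierV vhat p‖ ^ 2 /
        ((4 * (d : ℝ) ^ 2 - dispersion p) * (4 * (d : ℝ) ^ 2 - dispersion p + x)) := by
    filter_upwards [ae_gap_pos hd] with p hp
    have : 4 * (d : ℝ) ^ 2 - dispersion p + x ≠ 0 := by positivity
    have := hp.ne'
    field_simp
    ring
  have h4 : (L - resolventIntegral vhat x) / x = ∫ p, (‖fourierV vhat p‖ ^ 2 /
      (4 * (d : ℝ) ^ 2 - dispersion p) - ‖fourierV vhat p‖ ^ 2 /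
        (4 * (d : ℝ) ^ 2 - dispersion p + x)) / x ∂(torusMeasure d) := by
    rw [integral_div, integral_sub hint (integrable_resolvent hv hx0), integral_threshold hv hL h]
    rfl
  rw [h4, integral_congr_ae h3, ofReal_integral_eq_lintegral_ofReal]
  · exact ((hint.sub (integrable_resolvent hv hx0)).div_const x).congr h3
  · refine ae_of_all _ fun p => ?_
    have := gap_nonneg p
    simp only [Pi.zero_apply]
    positivity

theorem CvHat_eq_top (hd : 1 ≤ d) (hv : ExpDecay vhat) {L : ℝ} (hL : 0 ≤ L)
    (h : thresholdIntegral vhat = ENNReal.ofReal L)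
    (ht : Tendsto (fun x => (L - resolventIntegral vhat x) / x) (𝓝[>] 0) atTop) :
    CvHat vhat = ⊤ :=
  tendsto_nhds_unique (tendsto_CvHat hd hv hL h)
    (ENNReal.tendsto_ofReal_nhds_top.2 (ht.comp tendsto_one_div_nhdsGT))

theorem CvHat_eq_ofReal (hd : 1 ≤ d) (hv : ExpDecay vhat) {L M : ℝ} (hL : 0 ≤ L)
    (h : thresholdIntegral vhat = ENNReal.ofReal L)
    (ht : Tendsto (fun x => (L - resolventIntegral vhat x) / x) (𝓝[>] 0) (𝓝 M)) :
    CvHat vhat = ENNReal.ofReal M :=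
  tendsto_nhds_unique (tendsto_CvHat hd hv hL h)
    ((ENNReal.continuous_ofReal.tendsto M).comp (ht.comp tendsto_one_div_nhdsGT))

theorem CvHat_pos (hd : 1 ≤ d) (hv : ExpDecay vhat) (hne : vhat ≠ 0) : 0 < CvHat vhat := by
  rw [pos_iff_ne_zero]
  intro h0
  have hm : Measurable fun p => ENNReal.ofReal (‖fourierV vhat p‖ ^ 2 /
      (4 * (d : ℝ) ^ 2 - dispersion p) ^ 2) :=
    (((continuous_fourierV hv).measurable.norm.pow_const 2).div
      ((continuous_gap (d := d)).measurable.pow_const 2)).ennreal_ofReal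
  rw [CvHat, lintegral_eq_zero_iff hm] at h0
  refine not_ae_fourierV_eq_zero hv hne ?_
  filter_upwards [h0, ae_gap_pos hd] with p hp hg
  by_contra hv0
  have : 0 < ‖fourierV vhat p‖ ^ 2 / (4 * (d : ℝ) ^ 2 - dispersion p) ^ 2 := by
    have := norm_pos_iff.2 hv0
    positivity
  simp only [Pi.zero_apply, ENNReal.ofReal_eq_zero] at hp
  linarith

/-! ### The threshold state -/

theorem aestronglyMeasurable_thresholdState (hv : ExpDecay vhat) :
    AEStronglyMeasurable (thresholdState vhat) (torusMeasure d) := by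
  refine Measurable.aestronglyMeasurable ?_
  exact (continuous_fourierV hv).measurable.div
    (Complex.measurable_ofReal.comp (continuous_gap (d := d)).measurable)

theorem conj_mul_thresholdState (p : Momentum d) :
    (starRingEnd ℂ) (fourierV vhat p) * thresholdState vhat p =
      ((‖fourierV vhat p‖ ^ 2 / (4 * (d : ℝ) ^ 2 - dispersion p) : ℝ) : ℂ) :=
  conj_mul_div_ofReal p _

theorem integrable_conj_mul_thresholdState_iff (hv : ExpDecay vhat) :
    Integrable (fun p => (starRingEnd ℂ) (fourierV vhat p) * thresholdState vhat p)
      (torusMeasure d) ↔ thresholdIntegral vhat < ⊤ := by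
  rw [← integrable_threshold_iff hv]
  simp only [conj_mul_thresholdState]
  exact ⟨fun h => h.re.congr (ae_of_all _ fun p => Complex.ofReal_re _), fun h => h.ofReal⟩

theorem memLp_thresholdState_iff (hv : ExpDecay vhat) :
    MemLp (thresholdState vhat) 2 (torusMeasure d) ↔ CvHat vhat < ⊤ := by
  have hm := aestronglyMeasurable_thresholdState hv
  rw [memLp_two_iff_integrable_sq_norm hm]
  have h1 : ∀ p, ‖thresholdState vhat p‖ ^ 2 =
      ‖fourierV vhat p‖ ^ 2 / (4 * (d : ℝ) ^ 2 - dispersion p) ^ 2 := by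
    intro p
    rw [thresholdState, norm_div, div_pow, Complex.norm_real, Real.norm_eq_abs, sq_abs]
  simp only [h1]
  have hm2 : Measurable fun p => ‖fourierV vhat p‖ ^ 2 / (4 * (d : ℝ) ^ 2 - dispersion p) ^ 2 :=
    ((continuous_fourierV hv).measurable.norm.pow_const 2).div
      ((continuous_gap (d := d)).measurable.pow_const 2)
  rw [CvHat, Integrable, and_iff_right hm2.aestronglyMeasurable,
    hasFiniteIntegral_iff_ofReal (ae_of_all _ fun p => by positivity)]

theorem isNonzero_thresholdState (hd : 1 ≤ d) (hv : ExpDecay vhat) (hne : vhat ≠ 0) :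
    IsNonzero (thresholdState vhat) := by
  intro h
  refine not_ae_fourierV_eq_zero hv hne ?_
  filter_upwards [h, ae_gap_pos hd] with p hp hg
  rw [thresholdState, div_eq_zero_iff] at hp
  exact hp.resolve_right (Complex.ofReal_ne_zero.2 hg.ne')

theorem muTop_eq (vhat : Lattice d → ℝ) : muTop vhat = ((thresholdIntegral vhat)⁻¹).toReal := rfl

theorem muTop_eq_inv {L : ℝ} (hL : 0 < L) (h : thresholdIntegral vhat = ENNReal.ofReal L) :
    muTop vhat = L⁻¹ := by
  rw [muTop_eq, h, ENNReal.toReal_inv, ENNReal.toReal_ofReal hL.le]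

theorem muTop_eq_zero (h : thresholdIntegral vhat = ⊤) : muTop vhat = 0 := by
  rw [muTop_eq, h]
  simp

/-- Almost everywhere `(4d² - 𝔢) f = v`, and `∫ v̄ f = L = 1/μ^o`, so the rank-one term equals
exactly `v`. -/
theorem isSolution_thresholdState (hd : 1 ≤ d) (hv : ExpDecay vhat) {L : ℝ} (hL : 0 < L)
    (h : thresholdIntegral vhat = ENNReal.ofReal L) :
    IsSolution vhat (-muTop vhat) (4 * (d : ℝ) ^ 2) (thresholdState vhat) := by
  refine ⟨aestronglyMeasurable_thresholdState hv,
    (integrable_conj_mul_thresholdState_iff hv).2 (by rw [h]; exact ENNReal.ofReal_lt_top), ?_⟩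
  have hi : ∫ q, (starRingEnd ℂ) (fourierV vhat q) * thresholdState vhat q ∂(torusMeasure d) = L := by
    simp only [conj_mul_thresholdState, integral_complex_ofReal]
    rw [integral_threshold hv hL.le h]
  filter_upwards [ae_gap_pos hd] with p hp
  rw [hi, muTop_eq_inv hL h]
  have hr : thresholdState vhat p * ((4 * (d : ℝ) ^ 2 - dispersion p : ℝ) : ℂ) = fourierV vhat p :=
    div_mul_cancel₀ _ (Complex.ofReal_ne_zero.2 hp.ne')
  have hLC : (L : ℂ) ≠ 0 := Complex.ofReal_ne_zero.2 hL.ne'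
  have h2 : ((-L⁻¹ : ℝ) : ℂ) * (fourierV vhat p * (L : ℂ)) = -fourierV vhat p := by
    push_cast
    field_simp
  rw [h2, ← hr]
  push_cast
  ring

end Eigen

end DiscreteBilaplacian
end

/-! ### Limits at the threshold and existence of the eigenvalue. -/

noncomputable section

namespace DiscreteBilaplacian

open Filter Topology

variable {d : ℕ} {vhat : Lattice d → ℝ}

theorem tendsto_singular {e : ℕ} (he : e = 0 ∨ e = 1) :
    Tendsto (singular e) (𝓝[>] 0) atTop := by
  rcases he with rfl | rfl
  · have h : Tendsto (fun x : ℝ => √x) (𝓝[>] 0) (𝓝[>] 0) := by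
      refine tendsto_nhdsWithin_iff.2 ⟨?_, ?_⟩
      · have := (Real.continuous_sqrt.tendsto 0).mono_left (nhdsWithin_le_nhds (s := Set.Ioi 0))
        simpa using this
      · filter_upwards [self_mem_nhdsWithin] with x hx using Real.sqrt_pos.2 hx
    have := (tendsto_inv_nhdsGT_zero.comp h).const_mul_atTop Real.pi_pos
    refine this.congr fun x => ?_
    simp [singular, div_eq_mul_inv]
  · exact (tendsto_neg_atBot_atTop.comp Real.tendsto_log_nhdsGT_zero).congr fun x => by
      simp [singular]

theorem tendsto_self_mul_singular {e : ℕ} (he : e = 0 ∨ e = 1) :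
    Tendsto (fun x => x * singular e x) (𝓝[>] 0) (𝓝 0) := by
  rcases he with rfl | rfl
  · have h : Tendsto (fun x : ℝ => Real.pi * √x) (𝓝[>] 0) (𝓝 0) := by
      have := ((Real.continuous_sqrt.const_mul Real.pi).tendsto 0).mono_left
        (nhdsWithin_le_nhds (s := Set.Ioi 0))
      simpa using this
    refine h.congr' ?_
    filter_upwards [self_mem_nhdsWithin] with x hx
    have hx' : (0 : ℝ) < x := hx
    have := Real.sqrt_pos.2 hx'
    simp only [singular, if_true]
    rw [← mul_div_assoc, eq_div_iff this.ne', mul_assoc, Real.mul_self_sqrt hx'.le, mul_comm]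
  · have h := (tendsto_log_mul_rpow_nhdsGT_zero (r := 1) one_pos).neg
    rw [neg_zero] at h
    refine h.congr fun x => ?_
    simp only [singular, Real.rpow_one, one_ne_zero, if_false]
    ring

theorem tendsto_pow_mul_singular {e k : ℕ} (he : e = 0 ∨ e = 1) (hk : 1 ≤ k) :
    Tendsto (fun x => x ^ k * singular e x) (𝓝[>] 0) (𝓝 0) := by
  obtain ⟨j, rfl⟩ := Nat.exists_eq_add_of_le' hk
  have h1 : Tendsto (fun x : ℝ => x ^ j) (𝓝[>] 0) (𝓝 (0 ^ j)) :=
    ((continuous_pow j).tendsto 0).mono_left nhdsWithin_le_nhds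
  have := h1.mul (tendsto_self_mul_singular he)
  rw [mul_zero] at this
  refine this.congr fun x => ?_
  ring

theorem analyticAt_dslope {A : ℝ → ℝ} (hA : AnalyticAt ℝ A 0) : AnalyticAt ℝ (dslope A 0) 0 := by
  obtain ⟨p, hp⟩ := hA
  exact ⟨_, hp.has_fpower_series_dslope_fslope⟩

theorem eq_add_mul_dslope (A : ℝ → ℝ) (x : ℝ) : A x = A 0 + x * dslope A 0 x := by
  have := sub_smul_dslope A 0 x
  simp only [sub_zero, smul_eq_mul] at this
  linarith

theorem tendsto_nhdsGT_of_analyticAt {A : ℝ → ℝ} (hA : AnalyticAt ℝ A 0) :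
    Tendsto A (𝓝[>] 0) (𝓝 (A 0)) :=
  hA.continuousAt.tendsto.mono_left nhdsWithin_le_nhds

section Limits

variable {F A B : ℝ → ℝ} {e k : ℕ}

theorem tendsto_atTop_of_expansion (he : e = 0 ∨ e = 1) (hA : AnalyticAt ℝ A 0)
    (hB : AnalyticAt ℝ B 0) (hB0 : 0 < B 0)
    (h : ∀ᶠ x in 𝓝[>] 0, F x = A x + x ^ 0 * B x * singular e x) :
    Tendsto F (𝓝[>] 0) atTop := by
  have h1 := (tendsto_nhdsGT_of_analyticAt hA).add_atTop
    ((tendsto_nhdsGT_of_analyticAt hB).pos_mul_atTop hB0 (tendsto_singular he))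
  refine h1.congr' ?_
  filter_upwards [h] with x hx
  rw [hx, pow_zero, one_mul]

theorem tendsto_of_expansion (he : e = 0 ∨ e = 1) (hk : 1 ≤ k) (hA : AnalyticAt ℝ A 0)
    (hB : AnalyticAt ℝ B 0)
    (h : ∀ᶠ x in 𝓝[>] 0, F x = A x + x ^ k * B x * singular e x) :
    Tendsto F (𝓝[>] 0) (𝓝 (A 0)) := by
  have h1 := (tendsto_nhdsGT_of_analyticAt hA).add
    ((tendsto_nhdsGT_of_analyticAt hB).mul (tendsto_pow_mul_singular he hk))
  rw [mul_zero, add_zero] at h1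
  refine h1.congr' ?_
  filter_upwards [h] with x hx
  rw [hx]
  ring

/-- One power of `x` cancels, so the size of `x^k s(x)` decides whether the difference quotient
diverges (`k = 0`) or tends to `-A'(0)` (`k ≥ 1`). -/
theorem sub_div_eventuallyEq_of_expansion
    (h : ∀ᶠ x in 𝓝[>] 0, F x = A x + x ^ (k + 1) * B x * singular e x) :
    (fun x => -dslope A 0 x + -B x * (x ^ k * singular e x)) =ᶠ[𝓝[>] 0]
      fun x => (A 0 - F x) / x := by
  filter_upwards [h, self_mem_nhdsWithin] with x hx hx0
  have hx0' : (0 : ℝ) < x := hx0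
  rw [hx, eq_add_mul_dslope A x]
  field_simp
  ring

theorem tendsto_sub_div_atTop_of_expansion (he : e = 0 ∨ e = 1) (hA : AnalyticAt ℝ A 0)
    (hB : AnalyticAt ℝ B 0) (hB0 : B 0 < 0)
    (h : ∀ᶠ x in 𝓝[>] 0, F x = A x + x ^ 1 * B x * singular e x) :
    Tendsto (fun x => (A 0 - F x) / x) (𝓝[>] 0) atTop := by
  refine Tendsto.congr' (sub_div_eventuallyEq_of_expansion (k := 0) h) ?_
  refine (tendsto_nhdsGT_of_analyticAt (analyticAt_dslope hA)).neg.add_atTop ?_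
  refine (tendsto_nhdsGT_of_analyticAt hB).neg.pos_mul_atTop (neg_pos.2 hB0) ?_
  simpa using tendsto_singular he

theorem tendsto_sub_div_of_expansion (he : e = 0 ∨ e = 1) (hk : 2 ≤ k) (hA : AnalyticAt ℝ A 0)
    (hB : AnalyticAt ℝ B 0)
    (h : ∀ᶠ x in 𝓝[>] 0, F x = A x + x ^ k * B x * singular e x) :
    Tendsto (fun x => (A 0 - F x) / x) (𝓝[>] 0) (𝓝 (-dslope A 0 0)) := by
  obtain ⟨j, rfl⟩ := Nat.exists_eq_add_of_le' (show 1 ≤ k by omega)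
  refine Tendsto.congr' (sub_div_eventuallyEq_of_expansion h) ?_
  have h1 := (tendsto_nhdsGT_of_analyticAt (analyticAt_dslope hA)).neg.add
    ((tendsto_nhdsGT_of_analyticAt hB).neg.mul (tendsto_pow_mul_singular he (show 1 ≤ j by omega)))
  rwa [mul_zero, add_zero] at h1

end Limits

theorem pos_of_tendsto_resolventIntegral (hv : ExpDecay vhat) (hne : vhat ≠ 0) {L : ℝ}
    (h : Tendsto (resolventIntegral vhat) (𝓝[>] 0) (𝓝 L)) : 0 < L := by
  have h1 : resolventIntegral vhat 1 ≤ L := by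
    refine ge_of_tendsto h ?_
    filter_upwards [Ioo_mem_nhdsGT (zero_lt_one' ℝ)] with x hx
    exact (resolventIntegral_strictAntiOn hv hne hx.1 (Set.mem_Ioi.2 one_pos) hx.2).le
  exact (resolventIntegral_pos hv hne one_pos).trans_le h1

theorem exists_resolventIntegral_eq (hv : ExpDecay vhat) {c : ℝ} (hc : 0 < c)
    (h : ∀ᶠ x in 𝓝[>] 0, c < resolventIntegral vhat x) :
    ∃ x, 0 < x ∧ resolventIntegral vhat x = c := by
  obtain ⟨a, ha, ha0⟩ := (h.and self_mem_nhdsWithin).exists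
  have ha0 : (0 : ℝ) < a := ha0
  obtain ⟨b, hb, hab⟩ := (((tendsto_resolventIntegral_atTop hv).eventually_lt_const hc).and
    (eventually_ge_atTop a)).exists
  obtain ⟨x, hx, hxc⟩ := intermediate_value_Icc' hab
    ((continuousOn_resolventIntegral hv).mono fun y hy => ha0.trans_le hy.1) ⟨hb.le, ha.le⟩
  exact ⟨x, ha0.trans_le hx.1, hxc⟩

/-- The last hypothesis says that the limit at `0+` is at least `1/μ^o`, written as a product so
that `μ^o = 0` (infinite limit) is included. Existence is the intermediate value theorem and
uniqueness is strict monotonicity. -/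
theorem exists_isTopEigenvalueFunction (hv : ExpDecay vhat) (hne : vhat ≠ 0)
    (h0 : 0 ≤ muTop vhat)
    (h : ∀ c, 0 < c → c * muTop vhat < 1 → ∀ᶠ x in 𝓝[>] 0, c < resolventIntegral vhat x) :
    ∃ e, IsTopEigenvalueFunction vhat e ∧
      ∀ μ < -muTop vhat, ∀ x, 0 < x → -μ * resolventIntegral vhat x = 1 →
        e μ = 4 * (d : ℝ) ^ 2 + x := by
  have hex : ∀ μ : ℝ, ∃ x, μ < -muTop vhat → 0 < x ∧ -μ * resolventIntegral vhat x = 1 := by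
    intro μ
    by_cases hμ : μ < -muTop vhat
    · have hμ0 : 0 < -μ := by linarith
      obtain ⟨x, hx, hxc⟩ := exists_resolventIntegral_eq hv (inv_pos.2 hμ0) (h _ (inv_pos.2 hμ0) (by
        rw [inv_mul_lt_iff₀ hμ0]; linarith))
      exact ⟨x, fun _ => ⟨hx, by rw [hxc, mul_inv_cancel₀ hμ0.ne']⟩⟩
    · exact ⟨0, fun hμ' => absurd hμ' hμ⟩
  choose x hx using hex
  have huniq : ∀ μ < -muTop vhat, ∀ y, 0 < y → (-μ * resolventIntegral vhat y = 1 ↔ y = x μ) := by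
    intro μ hμ y hy
    refine ⟨fun hy1 => ?_, fun h => h ▸ (hx μ hμ).2⟩
    refine (resolventIntegral_strictAntiOn hv hne).injOn hy (hx μ hμ).1 ?_
    have hμ0 : -μ ≠ 0 := by
      have : 0 < -μ := by linarith
      exact this.ne'
    exact mul_left_cancel₀ hμ0 (hy1.trans (hx μ hμ).2.symm)
  refine ⟨fun μ => 4 * (d : ℝ) ^ 2 + x μ, fun μ hμ => ⟨by linarith [(hx μ hμ).1], fun z hz => ?_⟩,
    fun μ hμ y hy h1 => by rw [(huniq μ hμ y hy).1 h1]⟩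
  obtain ⟨y, rfl⟩ : ∃ y, z = 4 * (d : ℝ) ^ 2 + y := ⟨z - 4 * (d : ℝ) ^ 2, by ring⟩
  have hy : 0 < y := by linarith
  rw [isEigenvalue_iff hv hne hy, isLatticeEigenvalue_iff hv hne hy, huniq μ hμ y hy, add_right_inj]
  exact ⟨Iff.rfl, Iff.rfl⟩

end DiscreteBilaplacian

end

/-! ### Analytic implicit functions and series without their leading term. -/

noncomputable section

namespace DiscreteBilaplacian

open Filter Topology

/-- For a scalar unknown, invertibility of the partial derivative means `c ≠ 0`. The smoothness
exponent `⊤` stands for analyticity, so the implicit function for this class is itself analytic. -/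
theorem exists_analyticAt_implicit {E : Type*} [NormedAddCommGroup E] [NormedSpace ℝ E]
    [CompleteSpace E] {Φ : E × ℝ → ℝ} {u₀ c : ℝ} (hΦ : AnalyticAt ℝ Φ (0, u₀))
    (h0 : Φ (0, u₀) = 0) (hc : c ≠ 0) (hderiv : HasDerivAt (fun u => Φ (0, u)) c u₀) :
    ∃ ψ : E → ℝ, AnalyticAt ℝ ψ 0 ∧ ψ 0 = u₀ ∧ ∀ᶠ p in 𝓝 0, Φ (p, ψ p) = 0 := by
  have hcd : ContDiffAt ℝ ⊤ Φ (0, u₀) := hΦ.contDiffAt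
  have hinv : (fderiv ℝ Φ (0, u₀) ∘L .inr ℝ E ℝ).IsInvertible := by
    have h1 : HasFDerivAt (fun u => Φ (0, u)) (fderiv ℝ Φ (0, u₀) ∘L .inr ℝ E ℝ) u₀ :=
      hΦ.differentiableAt.hasFDerivAt.comp u₀ (hasFDerivAt_prodMk_right 0 u₀)
    have h2 : fderiv ℝ Φ (0, u₀) ∘L .inr ℝ E ℝ =
        (ContinuousLinearEquiv.unitsEquivAut ℝ (Units.mk0 c hc) : ℝ →L[ℝ] ℝ) := by
      rw [h1.unique hderiv.hasFDerivAt]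
      ext
      simp
    rw [h2]
    exact ContinuousLinearMap.isInvertible_equiv
  refine ⟨hcd.implicitFunction (by simp) hinv, ?_, hcd.implicitFunction_apply_self _ _, ?_⟩
  · exact (hcd.contDiffAt_implicitFunction (by simp) hinv).analyticAt
  · have := hcd.eventually_apply_implicitFunction (by simp) hinv
    rwa [h0] at this

theorem exists_hasSum_shifted_of_analyticAt {ψ : ℝ → ℝ} (hψ : AnalyticAt ℝ ψ 0) :
    ∃ C : ℕ → ℝ, ∃ δ > 0, ∀ s, |s| < δ →
      HasSum (fun k => C (k + 1) * s ^ ((k + 1) + 1)) (s * ψ s - ψ 0 * s) := by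
  obtain ⟨C, hC0, δ, hδ, hC⟩ := exists_hasSum_of_analyticAt hψ
  refine ⟨C, δ, hδ, fun s hs => ?_⟩
  have h := (hC s hs).mul_left s
  rw [← hasSum_nat_add_iff' 1] at h
  convert! h using 1
  · funext k
    ring
  · simp [hC0, mul_comm]

theorem exists_hasSum_triple_shifted_of_analyticAt {ψ : ℝ × ℝ × ℝ → ℝ} (hψ : AnalyticAt ℝ ψ 0) :
    ∃ C : ℕ → ℕ → ℕ → ℝ, ∃ δ > 0, ∀ x y z, |x| < δ → |y| < δ → |z| < δ →
      HasSum (fun k : {k : ℕ × ℕ × ℕ // 1 ≤ k.1 + k.2.1 + k.2.2} =>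
        C k.1.1 k.1.2.1 k.1.2.2 * x ^ k.1.1 * y ^ k.1.2.1 * z ^ k.1.2.2) (ψ (x, y, z) - ψ 0) := by
  obtain ⟨C, hC0, δ, hδ, hC⟩ := exists_hasSum_triple_of_analyticAt hψ
  refine ⟨C, δ, hδ, fun x y z hx hy hz => ?_⟩
  have h := hC x y z hx hy hz
  set g : ℕ × ℕ × ℕ → ℝ := fun k => C k.1 k.2.1 k.2.2 * x ^ k.1 * y ^ k.2.1 * z ^ k.2.2 with hg
  have h2 := h.sub (hasSum_ite_eq ((0, 0, 0) : ℕ × ℕ × ℕ) (ψ 0))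
  have h3 : HasSum ((fun k => g k - if k = (0, 0, 0) then ψ 0 else 0) ∘
      (Subtype.val : {k : ℕ × ℕ × ℕ // 1 ≤ k.1 + k.2.1 + k.2.2} → _)) (ψ (x, y, z) - ψ 0) := by
    refine (Subtype.val_injective.hasSum_iff fun k hk => ?_).2 h2
    have hk0 : k = (0, 0, 0) := by
      rw [Subtype.range_coe_subtype, Set.mem_ofPred_eq] at hk
      obtain ⟨a, b, c⟩ := k
      simp only [Prod.mk.injEq] at hk ⊢
      omega
    simp [hk0, hg, hC0]
  refine HasSum.congr_fun h3 fun k => ?_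
  have hk0 : (k : ℕ × ℕ × ℕ) ≠ (0, 0, 0) := by
    intro hk
    have := k.2
    simp [hk] at this
  simp [hg, hk0]

/-- Setting the third variable to zero kills all terms with a positive third exponent; the cases
with two small parameters are thus served by functions of three. -/
theorem exists_hasSum_pair_shifted_of_analyticAt {ψ : ℝ × ℝ × ℝ → ℝ} (hψ : AnalyticAt ℝ ψ 0) :
    ∃ C : ℕ → ℕ → ℝ, ∃ δ > 0, ∀ x y, |x| < δ → |y| < δ →
      HasSum (fun k : {k : ℕ × ℕ // 1 ≤ k.1 + k.2} => C k.1.1 k.1.2 * x ^ k.1.1 * y ^ k.1.2)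
        (ψ (x, y, 0) - ψ 0) := by
  obtain ⟨C, δ, hδ, hC⟩ := exists_hasSum_triple_shifted_of_analyticAt hψ
  refine ⟨fun a b => C a b 0, δ, hδ, fun x y hx hy => ?_⟩
  have h := hC x y 0 hx hy (by simpa using hδ)
  let i : {k : ℕ × ℕ // 1 ≤ k.1 + k.2} → {k : ℕ × ℕ × ℕ // 1 ≤ k.1 + k.2.1 + k.2.2} :=
    fun k => ⟨(k.1.1, k.1.2, 0), by simpa using k.2⟩
  have hi : Function.Injective i := by
    intro k l hkl
    simp only [i, Subtype.mk.injEq, Prod.mk.injEq, and_true] at hkl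
    exact Subtype.ext (Prod.ext hkl.1 hkl.2)
  have h1 := (hi.hasSum_iff fun k hk => ?_).2 h
  · refine HasSum.congr_fun h1 fun k => ?_
    simp [i]
  · have hk0 : k.1.2.2 ≠ 0 := by
      intro h0
      refine hk ⟨⟨(k.1.1, k.1.2.1), by simpa [h0] using k.2⟩, Subtype.ext ?_⟩
      simp only [i]
      rw [← h0]
    simp [hk0]

theorem exists_forall_of_eventually_nhdsGT {p : ℝ → Prop} (h : ∀ᶠ x in 𝓝[>] 0, p x) :
    ∃ δ > 0, ∀ x, 0 < x → x < δ → p x := by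
  obtain ⟨δ, hδ, h⟩ := mem_nhdsGT_iff_exists_Ioo_subset.1 h
  exact ⟨δ, hδ, fun x h0 h1 => h ⟨h0, h1⟩⟩

theorem exists_forall_of_eventually_nhdsLT {p : ℝ → Prop} (h : ∀ᶠ x in 𝓝[<] 0, p x) :
    ∃ δ > 0, ∀ x, -δ < x → x < 0 → p x := by
  obtain ⟨δ, hδ, h⟩ := mem_nhdsLT_iff_exists_Ioo_subset.1 h
  exact ⟨-δ, neg_pos.2 hδ, fun x h0 h1 => h ⟨by simpa using h0, h1⟩⟩

theorem AnalyticAt.comp_zero {E : Type*} [NormedAddCommGroup E] [NormedSpace ℝ E] {A : ℝ → ℝ}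
    (hA : AnalyticAt ℝ A 0) {g : E → ℝ} {p : E} (hg : AnalyticAt ℝ g p) (h : g p = 0) :
    AnalyticAt ℝ (fun q => A (g q)) p := by
  refine AnalyticAt.fun_comp ?_ hg
  rwa [h]

end DiscreteBilaplacian

end

/-! ### Roots of the eigenvalue equation for half-integer power singularities. -/

noncomputable section

namespace DiscreteBilaplacian

open Filter Topology

attribute [fun_prop] analyticAt_fst analyticAt_snd

section OddDimension

variable {F A B : ℝ → ℝ}

theorem tendsto_sq_mul_nhdsGT {l : Filter ℝ} {ε : ℝ → ℝ} (h : Tendsto ε l (𝓝 0))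
    (hpos : ∀ᶠ s in l, 0 < ε s) : Tendsto (fun s => ε s ^ 2) l (𝓝[>] 0) := by
  refine tendsto_nhdsWithin_iff.2 ⟨by simpa using h.pow 2, ?_⟩
  filter_upwards [hpos] with s hs using pow_pos hs 2

/-- Put `x = (μ u)²` with `√x = μ u > 0`. Multiplying `-μ F(x) = 1` by `u` gives the analytic
equation `u + μ u A(x) + π B(x) = 0`, whose root at `μ = 0` is `-π B(0)`. -/
theorem exists_root_of_inv_sqrt_singularity (hA : AnalyticAt ℝ A 0) (hB : AnalyticAt ℝ B 0)
    (hB0 : 0 < B 0) (hF : ∀ᶠ x in 𝓝[>] 0, F x = A x + x ^ 0 * B x * singular 0 x) :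
    ∃ ψ : ℝ → ℝ, AnalyticAt ℝ ψ 0 ∧ ψ 0 = -(Real.pi * B 0) ∧
      ∀ᶠ μ in 𝓝[<] 0, 0 < μ * ψ μ ∧ -μ * F ((μ * ψ μ) ^ 2) = 1 := by
  set u₀ := -(Real.pi * B 0) with hu
  have hu0 : u₀ < 0 := by rw [hu, neg_lt_zero]; positivity
  have hA' : AnalyticAt ℝ (fun q : ℝ × ℝ => A ((q.1 * q.2) ^ 2)) (0, u₀) :=
    AnalyticAt.comp_zero hA (by fun_prop) (by simp)
  have hB' : AnalyticAt ℝ (fun q : ℝ × ℝ => B ((q.1 * q.2) ^ 2)) (0, u₀) :=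
    AnalyticAt.comp_zero hB (by fun_prop) (by simp)
  obtain ⟨ψ, hψ, hψ0, h⟩ := exists_analyticAt_implicit (u₀ := u₀) (c := 1)
    (Φ := fun q : ℝ × ℝ => q.2 + q.1 * q.2 * A ((q.1 * q.2) ^ 2) + Real.pi * B ((q.1 * q.2) ^ 2))
    ((analyticAt_snd.add ((analyticAt_fst.mul analyticAt_snd).mul hA')).add
      (analyticAt_const.mul hB')) (by simp [hu]) one_ne_zero
    (by simpa using (hasDerivAt_id u₀).add_const (Real.pi * B 0))
  refine ⟨ψ, hψ, hψ0, ?_⟩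
  have hle : 𝓝[<] (0 : ℝ) ≤ 𝓝 0 := nhdsWithin_le_nhds
  have hneg : ∀ᶠ μ in 𝓝[<] (0 : ℝ), ψ μ < 0 :=
    hle (hψ.continuousAt.eventually_lt_const (by rwa [hψ0]))
  have hpos : ∀ᶠ μ in 𝓝[<] (0 : ℝ), 0 < μ * ψ μ := by
    filter_upwards [hneg, self_mem_nhdsWithin] with μ h1 h2 using mul_pos_of_neg_of_neg h2 h1
  have hlim : Tendsto (fun μ => μ * ψ μ) (𝓝[<] 0) (𝓝 0) := by
    have : Tendsto (fun μ => μ * ψ μ) (𝓝 0) (𝓝 (0 * ψ 0)) := tendsto_id.mul hψ.continuousAt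
    rw [zero_mul] at this
    exact this.mono_left hle
  filter_upwards [hpos, hle h, (tendsto_sq_mul_nhdsGT hlim hpos).eventually hF] with μ h1 h2 h3
  refine ⟨h1, ?_⟩
  have h4 : ψ μ ≠ 0 := by rintro h0; simp [h0] at h1
  have h5 : μ ≠ 0 := by rintro h0; simp [h0] at h1
  rw [h3]
  simp only [singular, if_true, Real.sqrt_sq h1.le]
  rw [mul_pow] at h2
  field_simp
  linear_combination -h2

/-- The equation `(m + τ) F = 1` is used in the form `1/m - F = τ / (m(m + τ))`. When `F(0+) = 1/m`
the zero-order terms have already cancelled, and `τ` can be divided out. -/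
theorem inv_sub_div_mul_add {m τ : ℝ} (hm : 0 < m) (hτ : 0 < τ) {y : ℝ}
    (h : m⁻¹ - y = τ * (m * (m + τ))⁻¹) : (m + τ) * y = 1 := by
  have : m + τ ≠ 0 := by positivity
  have hy : y = m⁻¹ - τ * (m * (m + τ))⁻¹ := by linarith
  rw [hy]
  field_simp
  ring

/-- With `x = (τ u)²` the term `√x` is of order `τ`. Division by `τ` leaves `-π B u + O(τ) = 1/(m(m
+ τ))`, which is linear in `u` at `τ = 0`. -/
theorem exists_root_of_sqrt_singularity (hA : AnalyticAt ℝ A 0) (hB : AnalyticAt ℝ B 0)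
    (hB0 : B 0 < 0) {m : ℝ} (hm : 0 < m) (hA0 : A 0 = m⁻¹)
    (hF : ∀ᶠ x in 𝓝[>] 0, F x = A x + x ^ 1 * B x * singular 0 x) :
    ∃ ψ : ℝ → ℝ, AnalyticAt ℝ ψ 0 ∧ ψ 0 = (Real.pi * -B 0 * m ^ 2)⁻¹ ∧
      ∀ᶠ τ in 𝓝[>] 0, 0 < τ * ψ τ ∧ (m + τ) * F ((τ * ψ τ) ^ 2) = 1 := by
  set u₀ := (Real.pi * -B 0 * m ^ 2)⁻¹ with hu
  have hb : 0 < -B 0 := neg_pos.2 hB0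
  have hu0 : 0 < u₀ := by positivity
  have hA' : AnalyticAt ℝ (fun q : ℝ × ℝ => dslope A 0 ((q.1 * q.2) ^ 2)) (0, u₀) :=
    AnalyticAt.comp_zero (analyticAt_dslope hA) (by fun_prop) (by simp)
  have hB' : AnalyticAt ℝ (fun q : ℝ × ℝ => B ((q.1 * q.2) ^ 2)) (0, u₀) :=
    AnalyticAt.comp_zero hB (by fun_prop) (by simp)
  have hR : AnalyticAt ℝ (fun q : ℝ × ℝ => (m * (m + q.1))⁻¹) (0, u₀) :=
    AnalyticAt.fun_inv (by fun_prop) (by simp [hm.ne'])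
  obtain ⟨ψ, hψ, hψ0, h⟩ := exists_analyticAt_implicit (u₀ := u₀) (c := Real.pi * -B 0)
    (Φ := fun q : ℝ × ℝ => -(q.1 * q.2 ^ 2) * dslope A 0 ((q.1 * q.2) ^ 2)
      - Real.pi * q.2 * B ((q.1 * q.2) ^ 2) - (m * (m + q.1))⁻¹)
    (((AnalyticAt.mul (by fun_prop) hA').sub (AnalyticAt.mul (by fun_prop) hB')).sub hR)
    (by
      simp only [zero_mul, neg_zero, zero_sub, add_zero, ne_eq, OfNat.ofNat_ne_zero,
        not_false_eq_true, zero_pow, hu]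
      have := hB0.ne
      field_simp
      ring) (by positivity)
    (by
      have := ((hasDerivAt_id u₀).const_mul (Real.pi * -B 0)).sub_const ((m * m)⁻¹)
      simp only [mul_one] at this
      refine this.congr_of_eventuallyEq (Eventually.of_forall fun u => ?_)
      simp only [zero_mul, neg_zero, zero_sub, add_zero, ne_eq, OfNat.ofNat_ne_zero,
        not_false_eq_true, zero_pow, id]
      ring)
  refine ⟨ψ, hψ, hψ0, ?_⟩
  have hle : 𝓝[>] (0 : ℝ) ≤ 𝓝 0 := nhdsWithin_le_nhds
  have hpos' : ∀ᶠ τ in 𝓝[>] (0 : ℝ), 0 < ψ τ :=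
    hle (hψ.continuousAt.eventually_const_lt (by rwa [hψ0]))
  have hpos : ∀ᶠ τ in 𝓝[>] (0 : ℝ), 0 < τ * ψ τ := by
    filter_upwards [hpos', self_mem_nhdsWithin] with μ h1 h2 using mul_pos h2 h1
  have hlim : Tendsto (fun τ => τ * ψ τ) (𝓝[>] 0) (𝓝 0) := by
    have : Tendsto (fun τ => τ * ψ τ) (𝓝 0) (𝓝 (0 * ψ 0)) := tendsto_id.mul hψ.continuousAt
    rw [zero_mul] at this
    exact this.mono_left hle
  filter_upwards [hpos, hpos', self_mem_nhdsWithin, hle h,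
    (tendsto_sq_mul_nhdsGT hlim hpos).eventually hF] with τ h1 h4 h5 h2 h3
  refine ⟨h1, inv_sub_div_mul_add hm h5 ?_⟩
  have h5 : (0 : ℝ) < τ := h5
  rw [h3, eq_add_mul_dslope A ((τ * ψ τ) ^ 2), hA0]
  simp only [singular, if_true, Real.sqrt_sq h1.le]
  have h6 : (m * (m + τ))⁻¹ = -(τ * ψ τ ^ 2) * dslope A 0 ((τ * ψ τ) ^ 2)
      - Real.pi * ψ τ * B ((τ * ψ τ) ^ 2) := by linarith
  rw [h6]
  field_simp
  ring

/-- Now the linear term of `A` dominates. With `s = √τ` and `x = (s u)²`, division by `s²` leaves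
`-A'(0) u² = 1/m²` at `s = 0`, so the root is a square root and the derivative `-2 A'(0) u₀` is
nonzero. Because `k ≥ 2`, the singular term keeps the positive power `s^(2j+1)` with `j = k - 2`. -/
theorem exists_root_of_half_odd_singularity {k : ℕ} (hk : 2 ≤ k) (hA : AnalyticAt ℝ A 0)
    (hB : AnalyticAt ℝ B 0) (hA1 : dslope A 0 0 < 0) {m : ℝ} (hm : 0 < m) (hA0 : A 0 = m⁻¹)
    (hF : ∀ᶠ x in 𝓝[>] 0, F x = A x + x ^ k * B x * singular 0 x) :
    ∃ ψ : ℝ → ℝ, AnalyticAt ℝ ψ 0 ∧ ψ 0 = (√(-dslope A 0 0 * m ^ 2))⁻¹ ∧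
      ∀ᶠ s in 𝓝[>] 0, 0 < s * ψ s ∧ (m + s ^ 2) * F ((s * ψ s) ^ 2) = 1 := by
  obtain ⟨j, rfl⟩ := Nat.exists_eq_add_of_le' hk
  set u₀ := (√(-dslope A 0 0 * m ^ 2))⁻¹ with hu
  have hb : 0 < -dslope A 0 0 := neg_pos.2 hA1
  have hu0 : 0 < u₀ := by positivity
  have hu2 : u₀ ^ 2 = (-dslope A 0 0 * m ^ 2)⁻¹ := by
    rw [hu, inv_pow, Real.sq_sqrt (by positivity)]
  have hA' : AnalyticAt ℝ (fun q : ℝ × ℝ => dslope A 0 ((q.1 * q.2) ^ 2)) (0, u₀) :=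
    AnalyticAt.comp_zero (analyticAt_dslope hA) (by fun_prop) (by simp)
  have hB' : AnalyticAt ℝ (fun q : ℝ × ℝ => B ((q.1 * q.2) ^ 2)) (0, u₀) :=
    AnalyticAt.comp_zero hB (by fun_prop) (by simp)
  have hR : AnalyticAt ℝ (fun q : ℝ × ℝ => (m * (m + q.1 ^ 2))⁻¹) (0, u₀) :=
    AnalyticAt.fun_inv (by fun_prop) (by simp [hm.ne'])
  obtain ⟨ψ, hψ, hψ0, h⟩ := exists_analyticAt_implicit (u₀ := u₀)
    (c := -dslope A 0 0 * (2 * u₀))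
    (Φ := fun q : ℝ × ℝ => -q.2 ^ 2 * dslope A 0 ((q.1 * q.2) ^ 2)
      - Real.pi * q.1 ^ (2 * j + 1) * q.2 ^ (2 * j + 3) * B ((q.1 * q.2) ^ 2)
      - (m * (m + q.1 ^ 2))⁻¹)
    (((AnalyticAt.mul (by fun_prop) hA').sub (AnalyticAt.mul (by fun_prop) hB')).sub hR)
    (by
      simp only [zero_mul, add_zero, ne_eq, OfNat.ofNat_ne_zero,
        not_false_eq_true, zero_pow, Nat.succ_ne_zero, mul_zero, sub_zero]
      rw [hu2]
      have := hA1.ne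
      field_simp
      ring) (by positivity)
    (by
      have := ((hasDerivAt_pow 2 u₀).const_mul (-dslope A 0 0)).sub_const ((m * m)⁻¹)
      simp only [Nat.cast_ofNat, Nat.add_one_sub_one, pow_one] at this
      refine this.congr_of_eventuallyEq (Eventually.of_forall fun u => ?_)
      simp only [zero_mul, add_zero, ne_eq, OfNat.ofNat_ne_zero,
        not_false_eq_true, zero_pow, Nat.succ_ne_zero, mul_zero, sub_zero]
      ring)
  refine ⟨ψ, hψ, hψ0, ?_⟩
  have hle : 𝓝[>] (0 : ℝ) ≤ 𝓝 0 := nhdsWithin_le_nhds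
  have hpos' : ∀ᶠ τ in 𝓝[>] (0 : ℝ), 0 < ψ τ :=
    hle (hψ.continuousAt.eventually_const_lt (by rwa [hψ0]))
  have hpos : ∀ᶠ τ in 𝓝[>] (0 : ℝ), 0 < τ * ψ τ := by
    filter_upwards [hpos', self_mem_nhdsWithin] with μ h1 h2 using mul_pos h2 h1
  have hlim : Tendsto (fun τ => τ * ψ τ) (𝓝[>] 0) (𝓝 0) := by
    have : Tendsto (fun τ => τ * ψ τ) (𝓝 0) (𝓝 (0 * ψ 0)) := tendsto_id.mul hψ.continuousAt
    rw [zero_mul] at this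
    exact this.mono_left hle
  filter_upwards [hpos, hpos', self_mem_nhdsWithin, hle h,
    (tendsto_sq_mul_nhdsGT hlim hpos).eventually hF] with τ h1 h4 h5 h2 h3
  have h5 : (0 : ℝ) < τ := h5
  refine ⟨h1, inv_sub_div_mul_add hm (pow_pos h5 2) ?_⟩
  rw [h3, eq_add_mul_dslope A ((τ * ψ τ) ^ 2), hA0]
  simp only [singular, if_true, Real.sqrt_sq h1.le]
  have h6 : (m * (m + τ ^ 2))⁻¹ = -ψ τ ^ 2 * dslope A 0 ((τ * ψ τ) ^ 2)
      - Real.pi * τ ^ (2 * j + 1) * ψ τ ^ (2 * j + 3) * B ((τ * ψ τ) ^ 2) := by linarith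
  rw [h6]
  field_simp
  ring

end OddDimension

end DiscreteBilaplacian

end

/-! ### Roots of the eigenvalue equation for logarithmic singularities. -/

noncomputable section

namespace DiscreteBilaplacian

open Filter Topology

section EvenDimension

variable {F A B : ℝ → ℝ}

theorem tendsto_exp_div_nhdsLT {b : ℝ} (hb : 0 < b) :
    Tendsto (fun μ : ℝ => -(1 / μ) * Real.exp (1 / (b * μ))) (𝓝[<] 0) (𝓝 0) := by
  have h1 : Tendsto (fun μ : ℝ => -(1 / (b * μ))) (𝓝[<] 0) atTop := by
    have := (tendsto_neg_atBot_atTop.comp tendsto_inv_nhdsLT_zero).const_mul_atTop (inv_pos.2 hb)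
    refine this.congr fun μ => ?_
    simp only [Function.comp, one_div, mul_inv]
    ring
  have h2 := ((Real.tendsto_pow_mul_exp_neg_atTop_nhds_zero 1).comp h1).const_mul b
  rw [mul_zero] at h2
  refine h2.congr' ?_
  filter_upwards [self_mem_nhdsWithin] with μ hμ
  have hμ0 : μ ≠ 0 := (show μ < 0 from hμ).ne
  simp only [Function.comp, pow_one, neg_neg]
  field_simp

/-- Put `x = e^{1/(bμ)} u`, so `log x = 1/(bμ) + log u`, and write `B = b + x B₁`. In `-μ F = 1` the
constant terms cancel. Division by `-μ` leaves `A - (x/μ) B₁/b - B log u = 0`, which is analytic in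
`u`, `μ` and `w = -μ⁻¹ e^{1/(bμ)}`, since `x = -μ w u`. At the origin the root is `e^{A(0)/b}`. -/
theorem exists_root_of_log_singularity (hA : AnalyticAt ℝ A 0) (hB : AnalyticAt ℝ B 0)
    (hB0 : 0 < B 0) (hF : ∀ᶠ x in 𝓝[>] 0, F x = A x + x ^ 0 * B x * singular 1 x) :
    ∃ ψ : ℝ × ℝ × ℝ → ℝ, AnalyticAt ℝ ψ 0 ∧ 0 < ψ 0 ∧
      ∀ᶠ μ in 𝓝[<] 0,
        0 < Real.exp (1 / (B 0 * μ)) * ψ (μ, -(1 / μ) * Real.exp (1 / (B 0 * μ)), 0) ∧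
        -μ * F (Real.exp (1 / (B 0 * μ)) *
          ψ (μ, -(1 / μ) * Real.exp (1 / (B 0 * μ)), 0)) = 1 := by
  set b := B 0 with hb
  set u₀ := Real.exp (A 0 / b) with hu
  have hu0 : 0 < u₀ := Real.exp_pos _
  have hA' : AnalyticAt ℝ (fun q : (ℝ × ℝ × ℝ) × ℝ => A (-q.1.1 * q.1.2.1 * q.2)) (0, u₀) :=
    AnalyticAt.comp_zero hA (by fun_prop) (by simp)
  have hB' : AnalyticAt ℝ (fun q : (ℝ × ℝ × ℝ) × ℝ => B (-q.1.1 * q.1.2.1 * q.2)) (0, u₀) :=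
    AnalyticAt.comp_zero hB (by fun_prop) (by simp)
  have hB1 : AnalyticAt ℝ (fun q : (ℝ × ℝ × ℝ) × ℝ => dslope B 0 (-q.1.1 * q.1.2.1 * q.2))
      (0, u₀) := AnalyticAt.comp_zero (analyticAt_dslope hB) (by fun_prop) (by simp)
  have hlog : AnalyticAt ℝ (fun q : (ℝ × ℝ × ℝ) × ℝ => Real.log q.2) (0, u₀) :=
    AnalyticAt.fun_comp (g := Real.log) (analyticAt_log hu0) analyticAt_snd
  obtain ⟨ψ, hψ, hψ0, h⟩ := exists_analyticAt_implicit (u₀ := u₀) (c := -(b * u₀⁻¹))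
    (Φ := fun q : (ℝ × ℝ × ℝ) × ℝ => A (-q.1.1 * q.1.2.1 * q.2)
      + q.1.2.1 * q.2 * b⁻¹ * dslope B 0 (-q.1.1 * q.1.2.1 * q.2)
      - B (-q.1.1 * q.1.2.1 * q.2) * Real.log q.2)
    ((hA'.add (AnalyticAt.mul (by fun_prop) hB1)).sub (hB'.mul hlog))
    (by
      simp only [Prod.fst_zero, Prod.snd_zero, neg_zero, zero_mul, add_zero, ← hb, hu, Real.log_exp]
      field_simp
      ring) (neg_ne_zero.2 (by positivity))
    (by
      have := ((Real.hasDerivAt_log hu0.ne').const_mul b).const_sub (A 0)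
      refine this.congr_of_eventuallyEq (Eventually.of_forall fun u => ?_)
      simp [← hb])
  refine ⟨ψ, hψ, by rwa [hψ0], ?_⟩
  have hp : Tendsto (fun μ : ℝ => ((μ, -(1 / μ) * Real.exp (1 / (b * μ)), 0) : ℝ × ℝ × ℝ))
      (𝓝[<] 0) (𝓝 0) :=
    (tendsto_id.mono_left nhdsWithin_le_nhds).prodMk_nhds
      ((tendsto_exp_div_nhdsLT hB0).prodMk_nhds tendsto_const_nhds)
  have hψp := hψ.continuousAt.tendsto.comp hp
  have hpos' := hψp.eventually_const_lt (u := 0) (by rwa [hψ0])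
  have hlim : Tendsto (fun μ => Real.exp (1 / (b * μ)) *
      ψ (μ, -(1 / μ) * Real.exp (1 / (b * μ)), 0)) (𝓝[<] 0) (𝓝[>] 0) := by
    refine tendsto_nhdsWithin_iff.2 ⟨?_, ?_⟩
    · have h1 := ((tendsto_id.mono_left nhdsWithin_le_nhds).neg.mul
        (tendsto_exp_div_nhdsLT hB0)).mul hψp
      simp only [neg_zero, zero_mul] at h1
      refine h1.congr' ?_
      filter_upwards [self_mem_nhdsWithin] with μ hμ
      have hμ0 : μ ≠ 0 := (show μ < 0 from hμ).ne
      simp only [id, Function.comp]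
      field_simp
    · filter_upwards [hpos'] with μ h1 using mul_pos (Real.exp_pos _) h1
  filter_upwards [hp.eventually h, hpos', self_mem_nhdsWithin, hlim.eventually hF] with μ h1 h2 h3 h4
  have hμ0 : μ ≠ 0 := (show μ < 0 from h3).ne
  simp only [Function.comp] at h2
  refine ⟨mul_pos (Real.exp_pos _) h2, ?_⟩
  rw [h4]
  have hx : -μ * (-(1 / μ) * Real.exp (1 / (b * μ))) = Real.exp (1 / (b * μ)) := by field_simp
  rw [hx] at h1
  set u := ψ (μ, -(1 / μ) * Real.exp (1 / (b * μ)), 0) with hu'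
  have hBx := eq_add_mul_dslope B (Real.exp (1 / (b * μ)) * u)
  simp only [singular, one_ne_zero, if_false, pow_zero, one_mul]
  rw [Real.log_mul (Real.exp_pos _).ne' h2.ne', Real.log_exp]
  rw [← hb] at hBx
  generalize dslope B 0 (Real.exp (1 / (b * μ)) * u) = w at *
  generalize B (Real.exp (1 / (b * μ)) * u) = y at *
  generalize A (Real.exp (1 / (b * μ)) * u) = z at *
  generalize Real.exp (1 / (b * μ)) = E at *
  generalize Real.log u = ℓ at *
  have hz : z = y * ℓ + 1 / μ * E * u * b⁻¹ * w := by linear_combination h1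
  rw [hz, hBx]
  field_simp
  ring

theorem tendsto_neg_inv_log : Tendsto (fun τ : ℝ => -(1 / Real.log τ)) (𝓝[>] 0) (𝓝[>] 0) := by
  have h1 : Tendsto (fun τ : ℝ => -Real.log τ) (𝓝[>] 0) atTop :=
    tendsto_neg_atBot_atTop.comp Real.tendsto_log_nhdsGT_zero
  refine (tendsto_inv_atTop_nhdsGT_zero.comp h1).congr fun τ => ?_
  simp only [Function.comp, one_div, inv_neg]

/-- In terms of `σ = -1/log τ` this is `η = -σ log σ`, which shows that `η` tends to zero with `σ`.
The real logarithm depends only on the absolute value, so no sign condition enters. -/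
theorem log_log_inv_div (τ : ℝ) : -(Real.log (Real.log τ⁻¹) / Real.log τ) =
    -(Real.log (-(1 / Real.log τ)) * -(1 / Real.log τ)) := by
  rw [Real.log_inv, Real.log_neg_eq_log, Real.log_neg_eq_log, one_div, Real.log_inv]
  ring

theorem tendsto_neg_log_log_inv_div :
    Tendsto (fun τ : ℝ => -(Real.log (Real.log τ⁻¹) / Real.log τ)) (𝓝[>] 0) (𝓝 0) := by
  have h := (tendsto_log_mul_rpow_nhdsGT_zero (r := 1) one_pos).neg.comp tendsto_neg_inv_log
  rw [neg_zero] at h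
  refine h.congr fun τ => ?_
  rw [log_log_inv_div]
  simp only [Function.comp, Real.rpow_one]

/-- With `x = τ σ u` one has `σ log x = -1 - η + σ log u`, because `σ log τ = -1` and `σ log σ =
-η`. After division by `τ` the equation is therefore analytic in `(τ, σ, η, u)` and reduces to
`-B(0) u = 1/m²` at the origin. -/
theorem exists_root_of_self_mul_log_singularity (hA : AnalyticAt ℝ A 0) (hB : AnalyticAt ℝ B 0)
    (hB0 : B 0 < 0) {m : ℝ} (hm : 0 < m) (hA0 : A 0 = m⁻¹)
    (hF : ∀ᶠ x in 𝓝[>] 0, F x = A x + x ^ 1 * B x * singular 1 x) :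
    ∃ ψ : ℝ × ℝ × ℝ → ℝ, AnalyticAt ℝ ψ 0 ∧ ψ 0 = (-B 0 * m ^ 2)⁻¹ ∧
      ∀ᶠ τ in 𝓝[>] 0, ∀ σ η, σ = -(1 / Real.log τ) →
        η = -(Real.log (Real.log τ⁻¹) / Real.log τ) →
        0 < τ * σ * ψ (τ, σ, η) ∧ (m + τ) * F (τ * σ * ψ (τ, σ, η)) = 1 := by
  set u₀ := (-B 0 * m ^ 2)⁻¹ with hu
  have hb : 0 < -B 0 := neg_pos.2 hB0
  have hu0 : 0 < u₀ := by positivity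
  have hA' : AnalyticAt ℝ (fun q : (ℝ × ℝ × ℝ) × ℝ => dslope A 0 (q.1.1 * q.1.2.1 * q.2))
      (0, u₀) := AnalyticAt.comp_zero (analyticAt_dslope hA) (by fun_prop) (by simp)
  have hB' : AnalyticAt ℝ (fun q : (ℝ × ℝ × ℝ) × ℝ => B (q.1.1 * q.1.2.1 * q.2)) (0, u₀) :=
    AnalyticAt.comp_zero hB (by fun_prop) (by simp)
  have hlog : AnalyticAt ℝ (fun q : (ℝ × ℝ × ℝ) × ℝ => Real.log q.2) (0, u₀) :=
    AnalyticAt.fun_comp (g := Real.log) (analyticAt_log hu0) analyticAt_snd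
  have hR : AnalyticAt ℝ (fun q : (ℝ × ℝ × ℝ) × ℝ => (m * (m + q.1.1))⁻¹) (0, u₀) :=
    AnalyticAt.fun_inv (by fun_prop) (by simp [hm.ne'])
  obtain ⟨ψ, hψ, hψ0, h⟩ := exists_analyticAt_implicit (u₀ := u₀) (c := -B 0)
    (Φ := fun q : (ℝ × ℝ × ℝ) × ℝ => q.2 * (-q.1.2.1 * dslope A 0 (q.1.1 * q.1.2.1 * q.2)
      + B (q.1.1 * q.1.2.1 * q.2) * (-1 - q.1.2.2 + q.1.2.1 * Real.log q.2)) - (m * (m + q.1.1))⁻¹)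
    ((analyticAt_snd.mul ((AnalyticAt.mul (by fun_prop) hA').add
      (hB'.mul (AnalyticAt.add (by fun_prop) (AnalyticAt.mul (by fun_prop) hlog))))).sub hR)
    (by
      simp only [Prod.fst_zero, Prod.snd_zero, neg_zero, zero_mul, add_zero, zero_add, sub_zero, hu]
      have := hB0.ne
      field_simp
      ring) hb.ne'
    (by
      have := ((hasDerivAt_id u₀).const_mul (-B 0)).sub_const ((m * m)⁻¹)
      rw [mul_one] at this
      refine this.congr_of_eventuallyEq (Eventually.of_forall fun u => ?_)
      simp only [Prod.fst_zero, Prod.snd_zero, neg_zero, zero_mul, add_zero, zero_add, sub_zero, id]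
      ring)
  refine ⟨ψ, hψ, hψ0, ?_⟩
  have hσ := tendsto_neg_inv_log
  have hp : Tendsto (fun τ : ℝ => ((τ, -(1 / Real.log τ),
      -(Real.log (Real.log τ⁻¹) / Real.log τ)) : ℝ × ℝ × ℝ)) (𝓝[>] 0) (𝓝 0) :=
    (tendsto_id.mono_left nhdsWithin_le_nhds).prodMk_nhds
      ((hσ.mono_right nhdsWithin_le_nhds).prodMk_nhds tendsto_neg_log_log_inv_div)
  have hψp := hψ.continuousAt.tendsto.comp hp
  have hpos' := hψp.eventually_const_lt (u := 0) (by rwa [hψ0])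
  have hσ0 : ∀ᶠ τ : ℝ in 𝓝[>] 0, 0 < -(1 / Real.log τ) := hσ.eventually self_mem_nhdsWithin
  have hlim : Tendsto (fun τ => τ * -(1 / Real.log τ) * ψ (τ, -(1 / Real.log τ),
      -(Real.log (Real.log τ⁻¹) / Real.log τ))) (𝓝[>] 0) (𝓝[>] 0) := by
    refine tendsto_nhdsWithin_iff.2 ⟨?_, ?_⟩
    · have h1 := ((tendsto_id.mono_left nhdsWithin_le_nhds).mul
        (hσ.mono_right nhdsWithin_le_nhds)).mul hψp
      simpa only [zero_mul, id, Function.comp] using h1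
    · filter_upwards [hpos', hσ0, self_mem_nhdsWithin] with τ h1 h2 h3
        using mul_pos (mul_pos h3 h2) h1
  filter_upwards [hp.eventually h, hpos', hσ0, self_mem_nhdsWithin, hlim.eventually hF]
    with τ h1 h2 h3 h4 h5 σ η hσ hη
  have h4 : 0 < τ := h4
  simp only [Function.comp] at h2
  rw [← hσ, ← hη] at h1 h2 h5
  rw [← hσ] at h3
  refine ⟨by positivity, inv_sub_div_mul_add hm h4 ?_⟩
  have hη' : η = -(Real.log σ * σ) := by rw [hη, hσ, log_log_inv_div]
  have hτ : σ * Real.log τ = -1 := by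
    have : Real.log τ ≠ 0 := by rintro h0; simp [h0] at hσ; simp [hσ] at h3
    rw [hσ]
    field_simp
  rw [h5, eq_add_mul_dslope A, hA0]
  simp only [singular, one_ne_zero, if_false]
  rw [Real.log_mul (by positivity) h2.ne', Real.log_mul h4.ne' h3.ne']
  generalize dslope A 0 (τ * σ * ψ (τ, σ, η)) = a at *
  generalize B (τ * σ * ψ (τ, σ, η)) = y at *
  have h6 : (m * (m + τ))⁻¹ = ψ (τ, σ, η) *
      (-σ * a + y * (-1 - η + σ * Real.log (ψ (τ, σ, η)))) := by linarith
  rw [h6]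
  linear_combination τ * ψ (τ, σ, η) * y * hη' + τ * ψ (τ, σ, η) * y * hτ

theorem tendsto_neg_self_mul_log :
    Tendsto (fun τ : ℝ => -(τ * Real.log τ)) (𝓝[>] 0) (𝓝 0) := by
  refine (tendsto_self_mul_singular (e := 1) (Or.inr rfl)).congr fun τ => ?_
  simp [singular]

/-- With `x = τ u` and `θ = -τ log τ`, one spare power of `τ` in `x^k log x` combines with the
logarithm to `-θ + τ log u`. This vanishes at the origin even for `k = 2`, leaving `-A'(0) u =
1/m²`. -/
theorem exists_root_of_pow_mul_log_singularity {k : ℕ} (hk : 2 ≤ k) (hA : AnalyticAt ℝ A 0)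
    (hB : AnalyticAt ℝ B 0) (hA1 : dslope A 0 0 < 0) {m : ℝ} (hm : 0 < m) (hA0 : A 0 = m⁻¹)
    (hF : ∀ᶠ x in 𝓝[>] 0, F x = A x + x ^ k * B x * singular 1 x) :
    ∃ ψ : ℝ × ℝ × ℝ → ℝ, AnalyticAt ℝ ψ 0 ∧ ψ 0 = (-dslope A 0 0 * m ^ 2)⁻¹ ∧
      ∀ᶠ τ in 𝓝[>] 0, 0 < τ * ψ (τ, -(τ * Real.log τ), 0) ∧
        (m + τ) * F (τ * ψ (τ, -(τ * Real.log τ), 0)) = 1 := by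
  obtain ⟨j, rfl⟩ := Nat.exists_eq_add_of_le' hk
  set u₀ := (-dslope A 0 0 * m ^ 2)⁻¹ with hu
  have hb : 0 < -dslope A 0 0 := neg_pos.2 hA1
  have hu0 : 0 < u₀ := by positivity
  have hA' : AnalyticAt ℝ (fun q : (ℝ × ℝ × ℝ) × ℝ => dslope A 0 (q.1.1 * q.2))
      (0, u₀) := AnalyticAt.comp_zero (analyticAt_dslope hA) (by fun_prop) (by simp)
  have hB' : AnalyticAt ℝ (fun q : (ℝ × ℝ × ℝ) × ℝ => B (q.1.1 * q.2)) (0, u₀) :=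
    AnalyticAt.comp_zero hB (by fun_prop) (by simp)
  have hlog : AnalyticAt ℝ (fun q : (ℝ × ℝ × ℝ) × ℝ => Real.log q.2) (0, u₀) :=
    AnalyticAt.fun_comp (g := Real.log) (analyticAt_log hu0) analyticAt_snd
  have hR : AnalyticAt ℝ (fun q : (ℝ × ℝ × ℝ) × ℝ => (m * (m + q.1.1))⁻¹) (0, u₀) :=
    AnalyticAt.fun_inv (by fun_prop) (by simp [hm.ne'])
  obtain ⟨ψ, hψ, hψ0, h⟩ := exists_analyticAt_implicit (u₀ := u₀) (c := -dslope A 0 0)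
    (Φ := fun q : (ℝ × ℝ × ℝ) × ℝ => -q.2 * dslope A 0 (q.1.1 * q.2)
      + q.1.1 ^ j * q.2 ^ (j + 2) * B (q.1.1 * q.2) * (-q.1.2.1 + q.1.1 * Real.log q.2)
      - (m * (m + q.1.1))⁻¹)
    (((AnalyticAt.mul (by fun_prop) hA').add ((AnalyticAt.mul (by fun_prop) hB').mul
      (AnalyticAt.add (by fun_prop) (AnalyticAt.mul (by fun_prop) hlog)))).sub hR)
    (by
      simp only [Prod.fst_zero, Prod.snd_zero, neg_zero, zero_mul, add_zero, mul_zero, hu]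
      have := hA1.ne
      field_simp
      ring) hb.ne'
    (by
      have := ((hasDerivAt_id u₀).const_mul (-dslope A 0 0)).sub_const ((m * m)⁻¹)
      rw [mul_one] at this
      refine this.congr_of_eventuallyEq (Eventually.of_forall fun u => ?_)
      simp only [Prod.fst_zero, Prod.snd_zero, neg_zero, zero_mul, add_zero, mul_zero, id]
      ring)
  refine ⟨ψ, hψ, hψ0, ?_⟩
  have hp : Tendsto (fun τ : ℝ => ((τ, -(τ * Real.log τ), 0) : ℝ × ℝ × ℝ)) (𝓝[>] 0) (𝓝 0) :=
    (tendsto_id.mono_left nhdsWithin_le_nhds).prodMk_nhds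
      (tendsto_neg_self_mul_log.prodMk_nhds tendsto_const_nhds)
  have hψp := hψ.continuousAt.tendsto.comp hp
  have hpos' := hψp.eventually_const_lt (u := 0) (by rwa [hψ0])
  have hlim : Tendsto (fun τ => τ * ψ (τ, -(τ * Real.log τ), 0)) (𝓝[>] 0) (𝓝[>] 0) := by
    refine tendsto_nhdsWithin_iff.2 ⟨?_, ?_⟩
    · have h1 := (tendsto_id.mono_left nhdsWithin_le_nhds).mul hψp
      simpa only [zero_mul, id, Function.comp] using h1
    · filter_upwards [hpos', self_mem_nhdsWithin] with τ h1 h3 using mul_pos h3 h1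
  filter_upwards [hp.eventually h, hpos', self_mem_nhdsWithin, hlim.eventually hF]
    with τ h1 h2 h4 h5
  have h4 : 0 < τ := h4
  simp only [Function.comp] at h2
  refine ⟨by positivity, inv_sub_div_mul_add hm h4 ?_⟩
  rw [h5, eq_add_mul_dslope A, hA0]
  simp only [singular, one_ne_zero, if_false]
  rw [Real.log_mul h4.ne' h2.ne']
  set u := ψ (τ, -(τ * Real.log τ), 0)
  generalize dslope A 0 (τ * u) = a at *
  generalize B (τ * u) = y at *
  have h6 : (m * (m + τ))⁻¹ = -u * a
      + τ ^ j * u ^ (j + 2) * y * (- -(τ * Real.log τ) + τ * Real.log u) := by linarith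
  rw [h6]
  ring

end EvenDimension

end DiscreteBilaplacian

end

/-! ### Threshold constants and convergent series for the eigenvalue. -/

noncomputable section

namespace DiscreteBilaplacian

open Filter Topology

variable {d : ℕ} {vhat : Lattice d → ℝ}

section Threshold

variable {A B : ℝ → ℝ} {e k : ℕ}

theorem thresholdIntegral_of_expansion (hd : 1 ≤ d) (hv : ExpDecay vhat) (hne : vhat ≠ 0)
    (he : e = 0 ∨ e = 1) (hk : 1 ≤ k) (hA : AnalyticAt ℝ A 0) (hB : AnalyticAt ℝ B 0)
    (h : ∀ᶠ x in 𝓝[>] 0, resolventIntegral vhat x = A x + x ^ k * B x * singular e x) :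
    0 < A 0 ∧ thresholdIntegral vhat = ENNReal.ofReal (A 0) ∧ muTop vhat = (A 0)⁻¹ := by
  have ht := tendsto_of_expansion he hk hA hB h
  have hL := pos_of_tendsto_resolventIntegral hv hne ht
  have hI := thresholdIntegral_eq_ofReal hd hv ht
  exact ⟨hL, hI, muTop_eq_inv hL hI⟩

/-- The difference quotient converges to `-A'(0)`, which is therefore `Ĉ_v`. Positivity of `Ĉ_v`
supplies the condition `A'(0) < 0` needed by the implicit function theorem. -/
theorem CvHat_of_expansion (hd : 1 ≤ d) (hv : ExpDecay vhat) (hne : vhat ≠ 0)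
    (he : e = 0 ∨ e = 1) (hk : 2 ≤ k) (hA : AnalyticAt ℝ A 0) (hB : AnalyticAt ℝ B 0)
    (h : ∀ᶠ x in 𝓝[>] 0, resolventIntegral vhat x = A x + x ^ k * B x * singular e x) :
    dslope A 0 0 < 0 ∧ CvHat vhat = ENNReal.ofReal (-dslope A 0 0) := by
  obtain ⟨hL, hI, -⟩ := thresholdIntegral_of_expansion hd hv hne he (by omega) hA hB h
  have h1 := CvHat_eq_ofReal hd hv hL.le hI (tendsto_sub_div_of_expansion he hk hA hB h)
  have h2 := CvHat_pos hd hv hne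
  rw [h1, ENNReal.ofReal_pos] at h2
  exact ⟨neg_pos.1 h2, h1⟩

theorem eventually_lt_resolventIntegral_of_expansion (hd : 1 ≤ d) (hv : ExpDecay vhat)
    (hne : vhat ≠ 0) (he : e = 0 ∨ e = 1) (hA : AnalyticAt ℝ A 0) (hB : AnalyticAt ℝ B 0)
    (hB0 : k = 0 → 0 < B 0)
    (h : ∀ᶠ x in 𝓝[>] 0, resolventIntegral vhat x = A x + x ^ k * B x * singular e x)
    {c : ℝ} (hc : c * muTop vhat < 1) : ∀ᶠ x in 𝓝[>] 0, c < resolventIntegral vhat x := by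
  rcases Nat.eq_zero_or_pos k with rfl | hk
  · exact (tendsto_atTop_of_expansion he hA hB (hB0 rfl) h).eventually_gt_atTop c
  · obtain ⟨hL, -, hm⟩ := thresholdIntegral_of_expansion hd hv hne he hk hA hB h
    rw [hm, mul_inv_lt_iff₀ hL, one_mul] at hc
    exact (tendsto_of_expansion he hk hA hB h).eventually_const_lt hc

end Threshold

section Series

variable {F A B ev : ℝ → ℝ} {b m : ℝ} {k : ℕ}

/-- Here `ev` is the eigenvalue measured from `4d²`; the bound is written `-0` to match `-μ^o` after
`μ^o = 0` is substituted. -/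
theorem exists_series_of_inv_sqrt_singularity (hA : AnalyticAt ℝ A 0) (hB : AnalyticAt ℝ B 0)
    (hb : 0 < b) (hB0 : B 0 = b) (hF : ∀ᶠ x in 𝓝[>] 0, F x = A x + x ^ 0 * B x * singular 0 x)
    (hev : ∀ μ x, μ < -0 → 0 < x → -μ * F x = 1 → ev μ = x) :
    ∃ C : ℕ → ℝ, ∃ δ > 0, ∀ μ : ℝ, -δ < μ → μ < 0 →
      HasSum (fun k : ℕ => C (k + 1) * μ ^ ((k + 1) + 1)) (√(ev μ) - (-(Real.pi * b) * μ)) := by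
  subst hB0
  obtain ⟨ψ, hψ, hψ0, hroot⟩ := exists_root_of_inv_sqrt_singularity hA hB hb hF
  obtain ⟨C, δ, hδ, hsum⟩ := exists_hasSum_shifted_of_analyticAt hψ
  obtain ⟨δ', hδ', hroot⟩ := exists_forall_of_eventually_nhdsLT hroot
  refine ⟨C, min δ δ', lt_min hδ hδ', fun μ h1 h2 => ?_⟩
  have h3 : -δ < μ := by linarith [min_le_left δ δ']
  obtain ⟨h4, h5⟩ := hroot μ (by linarith [min_le_right δ δ']) h2
  rw [hev μ _ (by simpa using h2) (pow_pos h4 2) h5, Real.sqrt_sq h4.le, ← hψ0]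
  exact hsum μ (abs_lt.2 ⟨h3, by linarith⟩)

theorem exists_series_of_sqrt_singularity (hA : AnalyticAt ℝ A 0) (hB : AnalyticAt ℝ B 0)
    (hb : 0 < b) (hB0 : B 0 = -b) (hm : 0 < m) (hA0 : A 0 = m⁻¹)
    (hF : ∀ᶠ x in 𝓝[>] 0, F x = A x + x ^ 1 * B x * singular 0 x)
    (hev : ∀ μ x, μ < -m → 0 < x → -μ * F x = 1 → ev μ = x) :
    ∃ C : ℕ → ℝ, ∃ δ > 0, ∀ μ τ : ℝ, τ = -(μ + m) → 0 < τ → τ < δ →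
      HasSum (fun k : ℕ => C (k + 1) * τ ^ ((k + 1) + 1))
        (√(ev μ) - (Real.pi * b * m ^ 2)⁻¹ * τ) := by
  obtain ⟨ψ, hψ, hψ0, hroot⟩ :=
    exists_root_of_sqrt_singularity hA hB (by rw [hB0]; exact neg_lt_zero.2 hb) hm hA0 hF
  obtain ⟨C, δ, hδ, hsum⟩ := exists_hasSum_shifted_of_analyticAt hψ
  obtain ⟨δ', hδ', hroot⟩ := exists_forall_of_eventually_nhdsGT hroot
  refine ⟨C, min δ δ', lt_min hδ hδ', fun μ τ hτ h1 h2 => ?_⟩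
  obtain ⟨h4, h5⟩ := hroot τ h1 (h2.trans_le (min_le_right _ _))
  rw [hev μ _ (by linarith) (pow_pos h4 2) (by rw [← h5, hτ]; ring), Real.sqrt_sq h4.le]
  rw [hB0, neg_neg] at hψ0
  rw [← hψ0]
  exact hsum τ (by rw [abs_of_pos h1]; exact h2.trans_le (min_le_left _ _))

theorem exists_series_of_half_odd_singularity (hk : 2 ≤ k) (hA : AnalyticAt ℝ A 0)
    (hB : AnalyticAt ℝ B 0) (hA1 : dslope A 0 0 < 0) (hm : 0 < m) (hA0 : A 0 = m⁻¹)
    (hF : ∀ᶠ x in 𝓝[>] 0, F x = A x + x ^ k * B x * singular 0 x)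
    (hev : ∀ μ x, μ < -m → 0 < x → -μ * F x = 1 → ev μ = x) :
    ∃ C : ℕ → ℝ, ∃ δ > 0, ∀ μ τ : ℝ, τ = -(μ + m) → 0 < τ → τ < δ →
      HasSum (fun k : ℕ => C (k + 1) * √τ ^ ((k + 1) + 1))
        (√(ev μ) - (√(-dslope A 0 0 * m ^ 2))⁻¹ * √τ) := by
  obtain ⟨ψ, hψ, hψ0, hroot⟩ := exists_root_of_half_odd_singularity hk hA hB hA1 hm hA0 hF
  obtain ⟨C, δ, hδ, hsum⟩ := exists_hasSum_shifted_of_analyticAt hψ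
  obtain ⟨δ', hδ', hroot⟩ := exists_forall_of_eventually_nhdsGT hroot
  have hδδ := lt_min hδ hδ'
  -- The series is in `√τ`, so the admissible range of `τ` is the square of its radius.
  refine ⟨C, min δ δ' ^ 2, pow_pos hδδ 2, fun μ τ hτ h1 h2 => ?_⟩
  have h3 : 0 < √τ := Real.sqrt_pos.2 h1
  have h2' : √τ < min δ δ' := (Real.sqrt_lt' hδδ).2 h2
  obtain ⟨h4, h5⟩ := hroot _ h3 (h2'.trans_le (min_le_right _ _))
  rw [Real.sq_sqrt h1.le] at h5
  rw [hev μ _ (by linarith) (pow_pos h4 2) (by rw [← h5, hτ]; ring), Real.sqrt_sq h4.le, ← hψ0]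
  exact hsum _ (by rw [abs_of_pos h3]; exact h2'.trans_le (min_le_left _ _))

theorem exists_series_of_log_singularity (hA : AnalyticAt ℝ A 0) (hB : AnalyticAt ℝ B 0)
    (hb : 0 < b) (hB0 : B 0 = b) (hF : ∀ᶠ x in 𝓝[>] 0, F x = A x + x ^ 0 * B x * singular 1 x)
    (hev : ∀ μ x, μ < -0 → 0 < x → -μ * F x = 1 → ev μ = x) :
    ∃ c > 0, ∃ C : ℕ → ℕ → ℝ, ∃ δ > 0, ∀ μ : ℝ, -δ < μ → μ < 0 →
      HasSum (fun k : {k : ℕ × ℕ // 1 ≤ k.1 + k.2} => C k.1.1 k.1.2 * μ ^ (k.1.1 + 1)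
          * (-(1 / μ) * Real.exp (1 / (b * μ))) ^ (k.1.2 + 1))
        (ev μ - c * Real.exp (1 / (b * μ))) := by
  subst hB0
  obtain ⟨ψ, hψ, hψ0, hroot⟩ := exists_root_of_log_singularity hA hB hb hF
  obtain ⟨C, δ, hδ, hsum⟩ := exists_hasSum_pair_shifted_of_analyticAt hψ
  have hsmall := (tendsto_exp_div_nhdsLT hb).abs
  rw [abs_zero] at hsmall
  obtain ⟨δ', hδ', hroot⟩ := exists_forall_of_eventually_nhdsLT
    (hroot.and (hsmall.eventually_lt_const hδ))
  -- The prefactor is `e^{1/(bμ)} = -μ w` with `w = -μ⁻¹ e^{1/(bμ)}`. It raises both exponents by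
  -- one and reverses the sign of the coefficients.
  refine ⟨ψ 0, hψ0, fun i j => -C i j, min δ δ', lt_min hδ hδ', fun μ h1 h2 => ?_⟩
  have h3 : -δ < μ := by linarith [min_le_left δ δ']
  obtain ⟨⟨h4, h5⟩, h6⟩ := hroot μ (by linarith [min_le_right δ δ']) h2
  rw [hev μ _ (by simpa using h2) h4 h5]
  have h7 := (hsum μ _ (abs_lt.2 ⟨h3, by linarith⟩) h6).mul_left
    (-(μ * (-(1 / μ) * Real.exp (1 / (B 0 * μ)))))
  have h8 : -(μ * (-(1 / μ) * Real.exp (1 / (B 0 * μ)))) = Real.exp (1 / (B 0 * μ)) := by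
    have := h2.ne
    field_simp
  convert! h7 using 1
  · funext i
    ring
  · rw [h8]
    ring

theorem exists_series_of_self_mul_log_singularity (hA : AnalyticAt ℝ A 0) (hB : AnalyticAt ℝ B 0)
    (hb : 0 < b) (hB0 : B 0 = -b) (hm : 0 < m) (hA0 : A 0 = m⁻¹)
    (hF : ∀ᶠ x in 𝓝[>] 0, F x = A x + x ^ 1 * B x * singular 1 x)
    (hev : ∀ μ x, μ < -m → 0 < x → -μ * F x = 1 → ev μ = x) :
    ∃ C : ℕ → ℕ → ℕ → ℝ, ∃ δ > 0, ∀ μ τ σ η : ℝ, τ = -(μ + m) → 0 < τ → τ < δ →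
      σ = -(1 / Real.log τ) → η = -(Real.log (Real.log τ⁻¹) / Real.log τ) →
      HasSum (fun k : {k : ℕ × ℕ × ℕ // 1 ≤ k.1 + k.2.1 + k.2.2} =>
          C k.1.1 k.1.2.1 k.1.2.2 * τ ^ (k.1.1 + 1) * σ ^ (k.1.2.1 + 1) * η ^ k.1.2.2)
        (ev μ - (b * m ^ 2)⁻¹ * (τ * σ)) := by
  obtain ⟨ψ, hψ, hψ0, hroot⟩ :=
    exists_root_of_self_mul_log_singularity hA hB (by rw [hB0]; exact neg_lt_zero.2 hb) hm hA0 hF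
  obtain ⟨C, δ, hδ, hsum⟩ := exists_hasSum_triple_shifted_of_analyticAt hψ
  have hσs := (tendsto_neg_inv_log.mono_right nhdsWithin_le_nhds).abs
  have hηs := tendsto_neg_log_log_inv_div.abs
  rw [abs_zero] at hσs hηs
  obtain ⟨δ', hδ', hroot⟩ := exists_forall_of_eventually_nhdsGT
    (hroot.and ((hσs.eventually_lt_const hδ).and (hηs.eventually_lt_const hδ)))
  refine ⟨C, min δ δ', lt_min hδ hδ', fun μ τ σ η hτ h1 h2 hσ hη => ?_⟩
  obtain ⟨h3, hσδ, hηδ⟩ := hroot τ h1 (h2.trans_le (min_le_right _ _))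
  obtain ⟨h4, h5⟩ := h3 σ η hσ hη
  rw [hev μ _ (by linarith) h4 (by rw [← h5, hτ]; ring)]
  rw [hB0, neg_neg] at hψ0
  rw [← hψ0]
  have := (hsum τ σ η (by rw [abs_of_pos h1]; exact h2.trans_le (min_le_left _ _))
    (hσ ▸ hσδ) (hη ▸ hηδ)).mul_left (τ * σ)
  convert! this using 1
  · funext i
    ring
  · ring

theorem exists_series_of_pow_mul_log_singularity (hk : 2 ≤ k) (hA : AnalyticAt ℝ A 0)
    (hB : AnalyticAt ℝ B 0) (hA1 : dslope A 0 0 < 0) (hm : 0 < m) (hA0 : A 0 = m⁻¹)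
    (hF : ∀ᶠ x in 𝓝[>] 0, F x = A x + x ^ k * B x * singular 1 x)
    (hev : ∀ μ x, μ < -m → 0 < x → -μ * F x = 1 → ev μ = x) :
    ∃ C : ℕ → ℕ → ℝ, ∃ δ > 0, ∀ μ τ : ℝ, τ = -(μ + m) → 0 < τ → τ < δ →
      HasSum (fun k : {k : ℕ × ℕ // 1 ≤ k.1 + k.2} =>
          C k.1.1 k.1.2 * τ ^ (k.1.1 + 1) * (-(τ * Real.log τ)) ^ k.1.2)
        (ev μ - (-dslope A 0 0 * m ^ 2)⁻¹ * τ) := by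
  obtain ⟨ψ, hψ, hψ0, hroot⟩ := exists_root_of_pow_mul_log_singularity hk hA hB hA1 hm hA0 hF
  obtain ⟨C, δ, hδ, hsum⟩ := exists_hasSum_pair_shifted_of_analyticAt hψ
  have hθs := tendsto_neg_self_mul_log.abs
  rw [abs_zero] at hθs
  obtain ⟨δ', hδ', hroot⟩ := exists_forall_of_eventually_nhdsGT
    (hroot.and (hθs.eventually_lt_const hδ))
  refine ⟨C, min δ δ', lt_min hδ hδ', fun μ τ hτ h1 h2 => ?_⟩
  obtain ⟨⟨h4, h5⟩, h6⟩ := hroot τ h1 (h2.trans_le (min_le_right _ _))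
  rw [hev μ _ (by linarith) h4 (by rw [← h5, hτ]; ring), ← hψ0]
  have := (hsum τ _ (by rw [abs_of_pos h1]; exact h2.trans_le (min_le_left _ _)) h6).mul_left τ
  convert! this using 1
  · funext i
    ring
  · ring

end Series

end DiscreteBilaplacian

end

/-! ### The theorem: case distinction by the order of the singularity. -/

open DiscreteBilaplacian in
theorem theorem3 (d : ℕ) (hd : 1 ≤ d) (vhat : (Fin d → ℤ) → ℝ) (hv : vhat ≠ 0)
    (hdecay : ExpDecay vhat) (n : ℕ) (hn : HasVanishingOrder vhat n) :
    0 < Cv vhat n ∧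
    0 < CvHat vhat ∧
    -- the threshold solution
    (3 ≤ 2 * n + d →
      IsSolution vhat (-muTop vhat) (4 * (d : ℝ) ^ 2) (thresholdState vhat) ∧
      IsNonzero (thresholdState vhat)) ∧
    (2 * n + d = 3 ∨ 2 * n + d = 4 → ¬ MemLp (thresholdState vhat) 2 (torusMeasure d)) ∧
    (5 ≤ 2 * n + d → MemLp (thresholdState vhat) 2 (torusMeasure d)) ∧
    (IsResonance vhat (-muTop vhat) (4 * (d : ℝ) ^ 2) (thresholdState vhat) ↔
      2 * n + d = 3 ∨ 2 * n + d = 4) ∧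
    -- the eigenvalue and its expansions
    ∃ e : ℝ → ℝ, IsTopEigenvalueFunction vhat e ∧
      -- `d` odd
      (2 * n + d = 1 → muTop vhat = 0 ∧
        ∃ C : ℕ → ℝ, ∃ δ > 0, ∀ μ : ℝ, -δ < μ → μ < 0 →
          HasSum (fun k : ℕ => C (k + 1) * μ ^ ((k + 1) + 1))
            (Real.sqrt (e μ - 4 * (d : ℝ) ^ 2) - (-(Real.pi * Cv vhat n) * μ))) ∧
      (2 * n + d = 3 → 0 < muTop vhat ∧
        ∃ C : ℕ → ℝ, ∃ δ > 0, ∀ μ τ : ℝ, τ = -(μ + muTop vhat) → 0 < τ → τ < δ →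
          HasSum (fun k : ℕ => C (k + 1) * τ ^ ((k + 1) + 1))
            (Real.sqrt (e μ - 4 * (d : ℝ) ^ 2)
              - (Real.pi * Cv vhat n * muTop vhat ^ 2)⁻¹ * τ)) ∧
      (Odd d → 5 ≤ 2 * n + d → 0 < muTop vhat ∧ CvHat vhat < ⊤ ∧
        ∃ C : ℕ → ℝ, ∃ δ > 0, ∀ μ τ : ℝ, τ = -(μ + muTop vhat) → 0 < τ → τ < δ →
          HasSum (fun k : ℕ => C (k + 1) * Real.sqrt τ ^ ((k + 1) + 1))
            (Real.sqrt (e μ - 4 * (d : ℝ) ^ 2)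
              - (Real.sqrt ((CvHat vhat).toReal * muTop vhat ^ 2))⁻¹ * Real.sqrt τ)) ∧
      -- `d` even
      (2 * n + d = 2 → muTop vhat = 0 ∧
        ∃ c > 0, ∃ C : ℕ → ℕ → ℝ, ∃ δ > 0, ∀ μ : ℝ, -δ < μ → μ < 0 →
          HasSum (fun k : {k : ℕ × ℕ // 1 ≤ k.1 + k.2} =>
              C k.1.1 k.1.2 * μ ^ (k.1.1 + 1)
                * (-(1 / μ) * Real.exp (1 / (Cv vhat n * μ))) ^ (k.1.2 + 1))
            (e μ - 4 * (d : ℝ) ^ 2 - c * Real.exp (1 / (Cv vhat n * μ)))) ∧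
      (2 * n + d = 4 → 0 < muTop vhat ∧
        ∃ C : ℕ → ℕ → ℕ → ℝ, ∃ δ > 0, ∀ μ τ σ η : ℝ, τ = -(μ + muTop vhat) → 0 < τ → τ < δ →
          σ = -(1 / Real.log τ) → η = -(Real.log (Real.log τ⁻¹) / Real.log τ) →
          HasSum (fun k : {k : ℕ × ℕ × ℕ // 1 ≤ k.1 + k.2.1 + k.2.2} =>
              C k.1.1 k.1.2.1 k.1.2.2 * τ ^ (k.1.1 + 1) * σ ^ (k.1.2.1 + 1) * η ^ k.1.2.2)
            (e μ - 4 * (d : ℝ) ^ 2 - (Cv vhat n * muTop vhat ^ 2)⁻¹ * (τ * σ))) ∧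
      (Even d → 6 ≤ 2 * n + d → 0 < muTop vhat ∧ CvHat vhat < ⊤ ∧
        ∃ C : ℕ → ℕ → ℝ, ∃ δ > 0, ∀ μ τ : ℝ, τ = -(μ + muTop vhat) → 0 < τ → τ < δ →
          HasSum (fun k : {k : ℕ × ℕ // 1 ≤ k.1 + k.2} =>
              C k.1.1 k.1.2 * τ ^ (k.1.1 + 1) * (-(τ * Real.log τ)) ^ k.1.2)
            (e μ - 4 * (d : ℝ) ^ 2 - ((CvHat vhat).toReal * muTop vhat ^ 2)⁻¹ * τ)) := by
  -- Write `N = 2k + 1 + p`: `p` selects the type of singularity and `k` its power. Thus `k = 0`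
  -- means `N ∈ {1, 2}` and `k = 1` means `N ∈ {3, 4}`; `n ≤ k` because `d ≥ 1`.
  obtain ⟨k, p, hp, hk, hnk⟩ : ∃ k p, (p = 0 ∨ p = 1) ∧ 2 * n + d = 2 * k + 1 + p ∧ n ≤ k :=
    ⟨(2 * n + d - 1) / 2, (2 * n + d - 1) % 2, by omega, by omega, by omega⟩
  have hN1 : 2 * n + d = 1 → k = 0 ∧ p = 0 := by omega
  have hN2 : 2 * n + d = 2 → k = 0 ∧ p = 1 := by omega
  have hN3 : 2 * n + d = 3 → k = 1 ∧ p = 0 := by omega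
  have hN4 : 2 * n + d = 4 → k = 1 ∧ p = 1 := by omega
  have hN34 : 2 * n + d = 3 ∨ 2 * n + d = 4 ↔ k = 1 := by omega
  have hge3 : 3 ≤ 2 * n + d → 1 ≤ k := by omega
  have hge5 : 5 ≤ 2 * n + d → 2 ≤ k := by omega
  have hge6 : 6 ≤ 2 * n + d → 2 ≤ k := by omega
  have hodd : Odd d → p = 0 := by rintro ⟨j, rfl⟩; omega
  have heven : Even d → p = 1 := by rintro ⟨j, rfl⟩; omega
  have hk1 : 2 ≤ k → 1 ≤ k := by omega
  obtain ⟨A, B, hA, hB, hB0, hF⟩ := exists_resolvent_expansion hd hdecay hn hp hk hnk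
  have hC := Cv_pos hd hdecay hn
  have hzero : k = 0 → thresholdIntegral vhat = ⊤ := by
    rintro rfl
    exact thresholdIntegral_eq_top hd hdecay
      (tendsto_atTop_of_expansion hp hA hB (by simpa [hB0] using hC) hF)
  have hpos : 1 ≤ k → 0 < A 0 ∧ thresholdIntegral vhat = ENNReal.ofReal (A 0) ∧
      muTop vhat = (A 0)⁻¹ := fun h => thresholdIntegral_of_expansion hd hdecay hv hp h hA hB hF
  have hmu0 : 0 ≤ muTop vhat := ENNReal.toReal_nonneg
  have hmu : 1 ≤ k → 0 < muTop vhat ∧ A 0 = (muTop vhat)⁻¹ := fun h => by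
    obtain ⟨h1, -, h2⟩ := hpos h
    rw [h2, inv_inv]
    exact ⟨inv_pos.2 h1, rfl⟩
  have htop : k = 1 → CvHat vhat = ⊤ := by
    rintro rfl
    obtain ⟨h1, h2, -⟩ := hpos le_rfl
    exact CvHat_eq_top hd hdecay h1.le h2
      (tendsto_sub_div_atTop_of_expansion hp hA hB (by simpa [hB0] using hC) hF)
  have hfin : 2 ≤ k → dslope A 0 0 < 0 ∧ CvHat vhat = ENNReal.ofReal (-dslope A 0 0) :=
    fun h => CvHat_of_expansion hd hdecay hv hp h hA hB hF
  have hlt : 2 ≤ k → CvHat vhat < ⊤ := fun h => (hfin h).2 ▸ ENNReal.ofReal_lt_top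
  have hreal : 2 ≤ k → (CvHat vhat).toReal = -dslope A 0 0 := fun h => by
    rw [(hfin h).2, ENNReal.toReal_ofReal (neg_pos.2 (hfin h).1).le]
  have hsol : 1 ≤ k → IsSolution vhat (-muTop vhat) (4 * (d : ℝ) ^ 2) (thresholdState vhat) :=
    fun h => isSolution_thresholdState hd hdecay (hpos h).1 (hpos h).2.1
  have hnz := isNonzero_thresholdState hd hdecay hv
  have hmem := memLp_thresholdState_iff hdecay
  have hnmem : k = 1 → ¬ MemLp (thresholdState vhat) 2 (torusMeasure d) := fun h => by
    rw [hmem, htop h]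
    exact lt_irrefl _
  obtain ⟨e, he, heq⟩ := exists_isTopEigenvalueFunction hdecay hv hmu0 fun c _ hc =>
    eventually_lt_resolventIntegral_of_expansion hd hdecay hv hp hA hB
      (fun h => by simpa [hB0, h] using hC) hF hc
  have hsub : ∀ μ x, μ < -muTop vhat → 0 < x → -μ * resolventIntegral vhat x = 1 →
      e μ - 4 * (d : ℝ) ^ 2 = x := fun μ x h1 h2 h3 => by
    rw [heq μ h1 x h2 h3, add_sub_cancel_left]
  refine ⟨hC, CvHat_pos hd hdecay hv, fun h => ⟨hsol (hge3 h), hnz⟩, fun h => hnmem (hN34.1 h),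
    fun h => hmem.2 (hlt (hge5 h)), ⟨fun h => hN34.2 ?_, fun h => ⟨hsol (hN34.1 h).ge, hnz,
    hnmem (hN34.1 h)⟩⟩, e, he, fun h => ?_, fun h => ?_, fun hd' h => ?_, fun h => ?_, fun h => ?_,
    fun hd' h => ?_⟩
  -- For `k = 0` the threshold state is no solution at all, since `v̄ f` is not integrable; for `k ≥
  -- 2` it lies in `L²`. Only `k = 1` remains for a resonance.
  · have h0 : k ≠ 0 := fun h0 => by
      have := (integrable_conj_mul_thresholdState_iff hdecay).1 h.1.2.1
      rw [hzero h0] at this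
      exact lt_irrefl _ this
    have h2 : ¬ 2 ≤ k := fun h2 => h.2.2 (hmem.2 (hlt h2))
    exact le_antisymm (Nat.lt_succ_iff.1 (not_le.1 h2)) (Nat.pos_of_ne_zero h0)
  · obtain ⟨rfl, rfl⟩ := hN1 h
    have hm := muTop_eq_zero (hzero rfl)
    rw [hm] at hsub
    exact ⟨hm, exists_series_of_inv_sqrt_singularity hA hB hC (by simpa using hB0) hF hsub⟩
  · obtain ⟨rfl, rfl⟩ := hN3 h
    obtain ⟨hm, hA0⟩ := hmu le_rfl
    exact ⟨hm, exists_series_of_sqrt_singularity hA hB hC (by simpa using hB0) hm hA0 hF hsub⟩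
  · obtain rfl := hodd hd'
    have hk2 := hge5 h
    obtain ⟨hm, hA0⟩ := hmu (hk1 hk2)
    rw [hreal hk2]
    exact ⟨hm, hlt hk2,
      exists_series_of_half_odd_singularity hk2 hA hB (hfin hk2).1 hm hA0 hF hsub⟩
  · obtain ⟨rfl, rfl⟩ := hN2 h
    have hm := muTop_eq_zero (hzero rfl)
    rw [hm] at hsub
    exact ⟨hm, exists_series_of_log_singularity hA hB hC (by simpa using hB0) hF hsub⟩
  · obtain ⟨rfl, rfl⟩ := hN4 h
    obtain ⟨hm, hA0⟩ := hmu le_rfl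
    exact ⟨hm, exists_series_of_self_mul_log_singularity hA hB hC (by simpa using hB0) hm hA0 hF
      hsub⟩
  · obtain rfl := heven hd'
    have hk2 := hge6 h
    obtain ⟨hm, hA0⟩ := hmu (hk1 hk2)
    rw [hreal hk2]
    exact ⟨hm, hlt hk2,
      exists_series_of_pow_mul_log_singularity hk2 hA hB (hfin hk2).1 hm hA0 hF hsub⟩
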